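/- **Setting.** For $\alpha\in\mathbb C$ let $\mathcal P^{\alpha,0}$ be the set of smooth $f:\mathbb R\to\mathbb C$ with support in $]0,+\infty[$ such that, for some $c_j\in\mathbb C$, $f(\xi)\sim\sum_{j\ge0}c_j\,\xi^{\alpha-j}$ as $\xi\to+\infty$, i.e. for all $N,\gamma\in\mathbb N$, $\partial_\xi^\gamma\big(f-\sum_{j\le N}c_j\xi^{\alpha-j}\big)=O(\xi^{\mathrm{Re}\,\alpha-N-1-\gamma})$. Let $\mathcal P^{*,0}$ be the linear span of all $\mathcal P^{\alpha,0}$, and $\mathcal A\subset\mathcal P^{*,0}$ a (not necessarily unital) subalgebra for the pointwise product. The real order of $f$ is $\inf\{\lambda\in\mathbb R:\ |\xi|^{-\lambda}f(\xi)\to0 \text{ as } |\xi|\to\infty\}$. Let $W\subset\mathbb C$ be an open neighbourhood of $0$. A simple holomorphic family of order $\alpha(z)$ on $W$ ($\alpha$ holomorphic) is a holomorphic map $z\mapsto f(z)$ from $W$ to $C^\infty(\mathbb R,\mathbb C)$, each $f(z)$ supported in $]0,+\infty[$, with $f(z)(\xi)\sim\sum_j c_j(z)\xi^{\alpha(z)-j}$,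 the $c_j$ being holomorphic on $W$ and the above estimates holding uniformly for $z$ in compact subsets of $W$. A holomorphic regularisation $\mathcal R:\sigma\mapsto(\sigma(z))_{z\in W}$ on $\mathcal A$ is a linear map with $\sigma(0)=\sigma$ such that each $\sigma(z)$ is a finite sum of simple holomorphic families whose orders satisfy $\mathrm{Re}\,\alpha_i'(z)<0$ on $W$. Assume that $\mathcal R$ satisfies the order condition: (a) if $\sigma\in\mathcal A\cap\mathcal P^{a,0}$, then $\sigma(z)$ is a simple holomorphic family of some order $\alpha(z)$ with $\alpha(0)=a$ and $\mathrm{Re}\,\alpha'(z)<0$ for all $z\in W$; (b) for every real $t$ there is $z\in W$ such that, for every $\sigma\in\mathcal A$ of real order $t$, $\sigma(z)$ has real order $<-1$. For letters $f_1,\dots,f_k$ put $\sum_<^{N}f_1\otimes\cdots\otimes f_k=\sum_{0<n_k<\cdots<n_1\le N}f_1(n_1)\cdots f_k(n_k)$, and $\sum_\le^N$ likewise with $0<n_k\le\cdots\le n_1\le N$. Let $\mathrm{fp}_{N\to\infty}$ be the constant term of an asymptotic expansion in the functions $N^\beta\log^lN$ ($\beta\in\mathbb C$, $l\in\mathbb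 N$). The cut-off nested sums are $\mathrm{fp}_{N\to\infty}\sum_<^N$ and $\mathrm{fp}_{N\to\infty}\sum_\le^N$, and the cut-off sum of $f$ is $\mathrm{fp}_{N\to\infty}\sum_{m=0}^Nf(m)$. Let $\bullet$ be the pointwise product in the strict case and its opposite $a\bullet b=-ab$ in the weak case. On $\mathcal T(\mathcal A)=\bigoplus_k\mathcal A^{\otimes k}$ let $\star_\bullet$ be the quasi-shuffle (stuffle) product associated with $\bullet$, and $\Delta$ the deconcatenation, with convolution $*$. For $u=v_1\otimes\cdots\otimes v_n$ and a composition $I=(i_1,\dots,i_k)$ of $n$ let $I[u]$ be obtained by $\bullet$-multiplying the letters in consecutive blocks of lengths $i_1,\dots,i_k$; put $\exp u=\sum_I\frac1{i_1!\cdots i_k!}I[u]$, $\log u=\sum_I\frac{(-1)^{n-k}}{i_1\cdots i_k}I[u]$. Extend $\mathcal R$ by $\tilde{\mathcal R}^\star(z)=\exp\circ\tilde{\mathcal R}(z)\circ\log$, where $\tilde{\mathcal R}(z)(\sigma_1\otimes\cdots\otimes\sigma_k)=\sigma_1(z)\otimes\cdots\otimes\sigma_k(z)$. Let $\Psi^{\mathcal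 R}(x)(z)$, resp. $\Psi'^{\mathcal R}(x)(z)$, be the strict, resp. weak, cut-off nested sum of $\tilde{\mathcal R}^\star(z)(x)$. **Theorem.** These finite parts exist for all $x\in\mathcal T(\mathcal A)$ and $z\in W$; as functions of $z$ they are meromorphic on $W$ (functions agreeing outside a discrete closed subset of $W$ being identified), and $\Psi^{\mathcal R},\Psi'^{\mathcal R}:(\mathcal T(\mathcal A),\star_\bullet)\to\mathcal M(W)$ are characters. For $\Psi=\Psi^{\mathcal R}$, resp. $\Psi'^{\mathcal R}$, there is a unique Birkhoff decomposition $\Psi=\Psi_-^{*-1}*\Psi_+$, where $\Psi_\pm:\mathcal T(\mathcal A)\to\mathcal M(W)$ are linear, $\Psi_-(1)=1$, $\Psi_-$ takes values in $z^{-1}\mathbb C[z^{-1}]$ on tensors of positive degree, and $\Psi_+$ takes values that are holomorphic at $0$; $\Psi_-$ and $\Psi_+$ are characters. Define $\psi^{\mathcal R}$, resp. $\psi'^{\mathcal R}$, by $x\mapsto\Psi_+(x)(0)$. Then: 1. $\psi^{\mathcal R}$, resp. $\psi'^{\mathcal R}$, is a character $(\mathcal T(\mathcal A),\star_\bullet)\to\mathbb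 C$; 2. on $\sigma\in\mathcal A$ both are equal to the constant term $\mathrm{fp}_{z=0}$ of the Laurent expansion at $0$ of the cut-off sum of $\sigma(z)$; 3. if $\sigma_j\in\mathcal A\cap\mathcal P^{\alpha_j,0}$ and $\mathrm{Re}(\alpha_1+\cdots+\alpha_m)<-m$ for all $m\in\{1,\dots,k\}$, then the nested sums $\sum_{0<n_k<\cdots<n_1}\sigma_1(n_1)\cdots\sigma_k(n_k)$, resp. $\sum_{0<n_k\le\cdots\le n_1}\sigma_1(n_1)\cdots\sigma_k(n_k)$, converge (as limits of the sums truncated at $n_1\le N$) and are equal to $\psi^{\mathcal R}(\sigma_1\otimes\cdots\otimes\sigma_k)$, resp. $\psi'^{\mathcal R}(\sigma_1\otimes\cdots\otimes\sigma_k)$. -/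

import Mathlib

open scoped TensorProduct Topology ContDiff

noncomputable section

namespace NestedSums

/-! ## Positively supported classical symbols on the real line -/

/-- `f` is a positively supported classical symbol lying in `𝒫^{α,0}`: it is smooth, its support is
contained in `]0,∞[`, and `f(ξ) ∼ ∑_j c_j ξ^{α-j}` as `ξ → ∞`, with the usual estimates on all
derivatives of the remainders. -/
def IsSymbol (α : ℂ) (f : ℝ → ℂ) : Prop :=
  ContDiff ℝ ∞ f ∧ tsupport f ⊆ Set.Ioi 0 ∧
    ∃ c : ℕ → ℂ, ∀ N γ : ℕ, ∃ C : ℝ, ∀ ξ : ℝ, 1 ≤ ξ →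
      ‖iteratedDeriv γ (fun x : ℝ => f x - ∑ j ∈ Finset.range (N + 1),
          c j * (x : ℂ) ^ (α - (j : ℂ))) ξ‖ ≤ C * ξ ^ (α.re - N - 1 - γ)

/-- `𝒫^{*,0}`: the linear span of all the `𝒫^{α,0}`. -/
def symbolSpace : Submodule ℂ (ℝ → ℂ) :=
  Submodule.span ℂ {f | ∃ α : ℂ, IsSymbol α f}

/-- The real order `inf {r ∈ ℝ | |ξ|^{-r} f(ξ) → 0 as |ξ| → ∞}` (equal to `-∞` for rapidly
decreasing `f`). -/
def realOrder (f : ℝ → ℂ) : EReal :=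
  sInf ((fun r : ℝ => (r : EReal)) ''
    {r : ℝ | Filter.Tendsto (fun ξ : ℝ => (|ξ| ^ (-r)) • f ξ) (Filter.cocompact ℝ) (𝓝 0)})

/-! ## Holomorphic families and holomorphic regularisations -/

/-- `z ↦ f z` is holomorphic on `W` with values in the Fréchet space `C^∞(ℝ,ℂ)`: around each point
of `W` it has a Taylor expansion converging, with all its `ξ`-derivatives, uniformly on compact
sets. -/
def IsHolomorphicSmoothFamily (W : Set ℂ) (f : ℂ → ℝ → ℂ) : Prop :=
  (∀ z ∈ W, ContDiff ℝ ∞ (f z)) ∧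
  ∀ z₀ ∈ W, ∃ r > 0, Metric.ball z₀ r ⊆ W ∧ ∃ a : ℕ → ℝ → ℂ, (∀ k, ContDiff ℝ ∞ (a k)) ∧
    ∀ n : ℕ, TendstoLocallyUniformlyOn
      (fun (K : ℕ) (p : ℂ × ℝ) =>
        ∑ k ∈ Finset.range K, (p.1 - z₀) ^ k * iteratedDeriv n (a k) p.2)
      (fun p : ℂ × ℝ => iteratedDeriv n (f p.1) p.2)
      Filter.atTop (Metric.ball z₀ r ×ˢ Set.univ)

/-- `f` is a simple holomorphic family on `W` of positively supported classical symbols, of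
holomorphic order `α`.  The estimates on the remainders of
`f z ξ ∼ ∑_j c_j(z) ξ^{α(z)-j}` are locally uniform in `z` (the corresponding estimates for the
`z`-derivatives of the remainders then follow from Cauchy's formula). -/
structure IsSimpleFamily (W : Set ℂ) (α : ℂ → ℂ) (f : ℂ → ℝ → ℂ) : Prop where
  holomorphic : IsHolomorphicSmoothFamily W f
  support : ∀ z ∈ W, tsupport (f z) ⊆ Set.Ioi 0
  order : DifferentiableOn ℂ α W
  expansion : ∃ c : ℕ → ℂ → ℂ, (∀ j, DifferentiableOn ℂ (c j) W) ∧
    ∀ K : Set ℂ, IsCompact K → K ⊆ W → ∀ N γ : ℕ, ∃ C : ℝ, ∀ z ∈ K, ∀ ξ : ℝ, 1 ≤ ξ →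
      ‖iteratedDeriv γ (fun x : ℝ => f z x - ∑ j ∈ Finset.range (N + 1),
          c j z * (x : ℂ) ^ (α z - (j : ℂ))) ξ‖ ≤ C * ξ ^ ((α z).re - N - 1 - γ)

/-- A (linear) holomorphic regularisation `σ ↦ (σ(z))_{z ∈ W}` on `A`: `σ(0) = σ`, and `σ(z)` is a
finite sum of simple holomorphic families whose orders satisfy `Re α_i'(z) < 0` on `W`.
Only the values for `z ∈ W` matter. -/
structure HolomorphicRegularisation (W : Set ℂ) (A : NonUnitalSubalgebra ℂ (ℝ → ℂ)) where
  toFun : ℂ → A →ₗ[ℂ] (ℝ → ℂ)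
  at_zero : ∀ σ : A, toFun 0 σ = (σ : ℝ → ℂ)
  sum_of_simple : ∀ σ : A, ∃ (n : ℕ) (α : Fin n → ℂ → ℂ) (f : Fin n → ℂ → ℝ → ℂ),
    (∀ i, IsSimpleFamily W (α i) (f i)) ∧ (∀ i, ∀ z ∈ W, (deriv (α i) z).re < 0) ∧
    ∀ z ∈ W, toFun z σ = ∑ i, f i z

/-- A symbol of order `a` is perturbed into a simple holomorphic family of some order `α(z)`
with `α(0) = a` and `Re α'(z) < 0` on `W`. -/
def HolomorphicRegularisation.PerturbsOrders {W : Set ℂ} {A : NonUnitalSubalgebra ℂ (ℝ → ℂ)}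
    (R : HolomorphicRegularisation W A) : Prop :=
  ∀ (σ : A) (a : ℂ), IsSymbol a σ → ∃ α : ℂ → ℂ, α 0 = a ∧ (∀ z ∈ W, (deriv α z).re < 0) ∧
    IsSimpleFamily W α (fun z => R.toFun z σ)

/-- For every real `t` there is a single `z ∈ W` such that `σ(z)` has real order `< -1` for all the
symbols `σ` of real order `t`. -/
def HolomorphicRegularisation.LowersOrders {W : Set ℂ} {A : NonUnitalSubalgebra ℂ (ℝ → ℂ)}
    (R : HolomorphicRegularisation W A) : Prop :=
  ∀ t : ℝ, ∃ z ∈ W, ∀ σ : A, realOrder (σ : ℝ → ℂ) = (t : EReal) →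
    realOrder (R.toFun z σ) < -1

/-! ## Words and linear maps on the tensor algebra -/

theorem ofFn_update {X : Type*} {n : ℕ} [DecidableEq (Fin n)] (m : Fin n → X) (i : Fin n) (x : X) :
    List.ofFn (Function.update m i x) =
      (List.ofFn m).take i ++ x :: (List.ofFn m).drop (i + 1) := by
  have h1 : List.ofFn (Function.update m i x) = (List.ofFn m).set i x := by
    apply List.ext_getElem (by simp)
    intro k h1 h2
    rw [List.getElem_set]
    simp only [List.getElem_ofFn, Function.update_apply, Fin.ext_iff, eq_comm]
  rw [h1, List.set_eq_take_append_cons_drop]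
  simp

set_option linter.unusedSectionVars false

section Words

variable {B : Type*} [NonUnitalCommRing B] [Module ℂ B]
variable {M : Type*} [AddCommGroup M] [Module ℂ M]

/-- The pure tensor `v₁ ⊗ ⋯ ⊗ v_k` in the tensor algebra `𝒯(B)`. -/
def word (u : List B) : TensorAlgebra ℂ B :=
  (u.map (TensorAlgebra.ι ℂ)).prod

/-- A function of words which is linear in every letter. -/
structure IsMultilinear (F : List B → M) : Prop where
  add : ∀ (u v : List B) (x y : B), F (u ++ (x + y) :: v) = F (u ++ x :: v) + F (u ++ y :: v)
  smul : ∀ (u v : List B) (c : ℂ) (x : B), F (u ++ (c • x) :: v) = c • F (u ++ x :: v)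

/-- The multilinear map on `B^n` given by the restriction of `F` to words of length `n`. -/
def IsMultilinear.toMultilinearMap {F : List B → M} (hF : IsMultilinear F) (n : ℕ) :
    MultilinearMap ℂ (fun _ : Fin n => B) M where
  toFun v := F (List.ofFn v)
  map_update_add' m i x y := by
    simp only [ofFn_update]
    exact hF.add _ _ x y
  map_update_smul' m i c x := by
    simp only [ofFn_update]
    exact hF.smul _ _ c x

/-- The linear map on the tensor algebra with prescribed (multilinear) values on words. -/
def ofWords (F : List B → M) (hF : IsMultilinear F) : TensorAlgebra ℂ B →ₗ[ℂ] M :=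
  (DirectSum.toModule ℂ ℕ M fun n => PiTensorProduct.lift (hF.toMultilinearMap n)) ∘ₗ
    (TensorAlgebra.equivDirectSum (R := ℂ) (M := B)).toLinearMap

theorem word_ofFn {n : ℕ} (v : Fin n → B) :
    word (List.ofFn v) = TensorAlgebra.tprod ℂ B n v := by
  rw [word, TensorAlgebra.tprod_apply, List.map_ofFn]
  rfl

theorem ofWords_word (F : List B → M) (hF : IsMultilinear F) (u : List B) :
    ofWords F hF (word u) = F u := by
  obtain ⟨n, v, rfl⟩ : ∃ n, ∃ v : Fin n → B, u = List.ofFn v :=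
    ⟨u.length, u.get, (List.ofFn_get u).symm⟩
  have h : TensorAlgebra.equivDirectSum (R := ℂ) (M := B) (word (List.ofFn v)) =
      DirectSum.of (fun n => ⨂[ℂ]^n B) n (PiTensorProduct.tprod ℂ v) := by
    rw [word_ofFn, TensorAlgebra.equivDirectSum_apply]
    exact TensorAlgebra.toDirectSum_tensorPower_tprod v
  rw [ofWords, LinearMap.comp_apply, AlgEquiv.toLinearMap_apply, h]
  exact (DirectSum.toModule_lof ℂ n _).trans (by
    rw [PiTensorProduct.lift.tprod]; rfl)

theorem word_append (u v : List B) : word (u ++ v) = word u * word v := by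
  simp [word]

theorem word_cons (a : B) (u : List B) : word (a :: u) = TensorAlgebra.ι ℂ a * word u := by
  simp [word]

theorem isMultilinear_word : IsMultilinear (word : List B → TensorAlgebra ℂ B) where
  add u v x y := by simp [word_append, word_cons, mul_add, add_mul]
  smul u v c x := by simp [word_append, word_cons]

theorem hom_ext_word {L L' : TensorAlgebra ℂ B →ₗ[ℂ] M} (h : ∀ u, L (word u) = L' (word u)) :
    L = L' := by
  have h2 : L ∘ₗ (TensorAlgebra.equivDirectSum (R := ℂ) (M := B)).symm.toLinearMap =
      L' ∘ₗ (TensorAlgebra.equivDirectSum (R := ℂ) (M := B)).symm.toLinearMap := by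
    refine DirectSum.linearMap_ext ℂ fun n => PiTensorProduct.ext (MultilinearMap.ext fun v => ?_)
    have := h (List.ofFn v)
    rw [word_ofFn] at this
    have h3 : (TensorAlgebra.equivDirectSum (R := ℂ) (M := B)).symm
        (DirectSum.lof ℂ ℕ (fun n => ⨂[ℂ]^n B) n (PiTensorProduct.tprod ℂ v)) =
        TensorAlgebra.tprod ℂ B n v := by
      rw [AlgEquiv.symm_apply_eq, TensorAlgebra.equivDirectSum_apply]
      exact (TensorAlgebra.toDirectSum_tensorPower_tprod v).symm
    simpa [h3] using this
  ext1 x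
  have := LinearMap.congr_fun h2 (TensorAlgebra.equivDirectSum (R := ℂ) (M := B) x)
  simpa using this


/-! ## Quasi-shuffle (stuffle) product, deconcatenation and Hoffman's isomorphism -/

/-- The deconcatenation `Δ(v₁⋯v_k) = ∑_{j=0}^k v₁⋯v_j ⊗ v_{j+1}⋯v_k` of a word. -/
def deconcWord : List B → TensorAlgebra ℂ B ⊗[ℂ] TensorAlgebra ℂ B
  | [] => 1
  | a :: u => 1 ⊗ₜ[ℂ] word (a :: u) + (TensorAlgebra.ι ℂ a ⊗ₜ[ℂ] 1) * deconcWord u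

theorem isMultilinear_deconcWord :
    IsMultilinear (deconcWord : List B → TensorAlgebra ℂ B ⊗[ℂ] TensorAlgebra ℂ B) where
  add u v x y := by
    induction u with
    | nil =>
      simp only [List.nil_append, deconcWord, word_cons, map_add, add_mul, TensorProduct.tmul_add,
        TensorProduct.add_tmul]
      abel
    | cons a u ih =>
      simp only [List.cons_append, deconcWord, ih, mul_add]
      have := isMultilinear_word.add (a :: u) v x y
      simp only [List.cons_append] at this
      rw [this, TensorProduct.tmul_add]
      abel
  smul u v c x := by
    induction u with
    | nil =>
      simp only [List.nil_append, deconcWord, word_cons, map_smul, smul_mul_assoc,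
        TensorProduct.tmul_smul, ← TensorProduct.smul_tmul', smul_add]
    | cons a u ih =>
      simp only [List.cons_append, deconcWord, ih, mul_smul_comm, smul_add]
      have := isMultilinear_word.smul (a :: u) v c x
      simp only [List.cons_append] at this
      rw [this, TensorProduct.tmul_smul]

/-- The deconcatenation coproduct on `𝒯(B)`. -/
def deconc : TensorAlgebra ℂ B →ₗ[ℂ] TensorAlgebra ℂ B ⊗[ℂ] TensorAlgebra ℂ B :=
  ofWords deconcWord isMultilinear_deconcWord

/-- The convolution product of two linear maps on `𝒯(B)` with respect to deconcatenation. -/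
def conv {S : Type*} [CommRing S] [Algebra ℂ S] (φ ψ : TensorAlgebra ℂ B →ₗ[ℂ] S) :
    TensorAlgebra ℂ B →ₗ[ℂ] S :=
  LinearMap.mul' ℂ S ∘ₗ TensorProduct.map φ ψ ∘ₗ deconc

/-- The quasi-shuffle product of two words for the product `a • b = ε a b` on letters: the sum of
all the words obtained by shuffling the two words and possibly multiplying (with `•`) pairs
consisting of a letter of each word.  The three terms correspond to the possible first letters. -/
def stuffleWord (ε : ℂ) : List B → List B → TensorAlgebra ℂ B
  | [], v => word v
  | a :: u, [] => word (a :: u)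
  | a :: u, b :: v =>
    TensorAlgebra.ι ℂ a * stuffleWord ε u (b :: v) +
    TensorAlgebra.ι ℂ b * stuffleWord ε (a :: u) v +
    TensorAlgebra.ι ℂ (ε • (a * b)) * stuffleWord ε u v
  termination_by u v => u.length + v.length

variable [IsScalarTower ℂ B B] [SMulCommClass ℂ B B]

theorem stuffleWord_nil_right (ε : ℂ) (u : List B) : stuffleWord ε u [] = word u := by
  cases u <;> simp [stuffleWord]

theorem isMultilinear_stuffleWord_left (ε : ℂ) (w : List B) :
    IsMultilinear (fun u => stuffleWord ε u w) where
  add u v x y := by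
    induction u generalizing w with
    | nil =>
      induction w with
      | nil => simpa [stuffleWord_nil_right] using isMultilinear_word.add [] v x y
      | cons b w ih =>
        simp only [List.nil_append] at ih
        simp only [List.nil_append, stuffleWord, ih, map_add, add_mul, mul_add, smul_add]
        abel
    | cons a u ihu =>
      induction w with
      | nil => simpa [stuffleWord_nil_right] using isMultilinear_word.add (a :: u) v x y
      | cons b w ih =>
        simp only [List.cons_append] at ih
        simp only [List.cons_append, stuffleWord, ih, ihu, mul_add]
        abel
  smul u v c x := by
    induction u generalizing w with
    | nil =>
      induction w with
      | nil => simpa [stuffleWord_nil_right] using isMultilinear_word.smul [] v c x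
      | cons b w ih =>
        simp only [List.nil_append] at ih
        simp only [List.nil_append, stuffleWord, ih, map_smul, smul_mul_assoc, mul_smul_comm,
          smul_add, smul_comm ε c]
    | cons a u ihu =>
      induction w with
      | nil => simpa [stuffleWord_nil_right] using isMultilinear_word.smul (a :: u) v c x
      | cons b w ih =>
        simp only [List.cons_append] at ih
        simp only [List.cons_append, stuffleWord, ih, ihu, mul_smul_comm, smul_add]

theorem stuffleWord_comm (ε : ℂ) (u w : List B) : stuffleWord ε u w = stuffleWord ε w u := by
  induction u generalizing w with
  | nil => simp [stuffleWord_nil_right, stuffleWord]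
  | cons a u ihu =>
    induction w with
    | nil => simp [stuffleWord]
    | cons b w ih =>
      simp only [stuffleWord, ih, ihu, mul_comm a b]
      abel

/-- The quasi-shuffle product `⋆` on `𝒯(B)` for the product `a • b = ε a b` of `B`. -/
def stuffle (ε : ℂ) : TensorAlgebra ℂ B →ₗ[ℂ] TensorAlgebra ℂ B →ₗ[ℂ] TensorAlgebra ℂ B :=
  ofWords
    (fun u => ofWords (fun w => stuffleWord ε u w)
      (by simpa only [stuffleWord_comm ε u] using isMultilinear_stuffleWord_left ε u))
    { add := fun u v x y => hom_ext_word fun w => by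
        simpa only [LinearMap.add_apply, ofWords_word] using
          (isMultilinear_stuffleWord_left ε w).add u v x y
      smul := fun u v c x => hom_ext_word fun w => by
        simpa only [LinearMap.smul_apply, ofWords_word] using
          (isMultilinear_stuffleWord_left ε w).smul u v c x }

theorem stuffle_word (ε : ℂ) (u w : List B) :
    stuffle ε (word u) (word w) = stuffleWord ε u w := by
  simp [stuffle, ofWords_word]

/-- `χ` is a character of `(𝒯(B), ⋆)` with values in `S`. -/
def IsCharacter (ε : ℂ) {S : Type*} [CommRing S] [Algebra ℂ S]
    (χ : TensorAlgebra ℂ B →ₗ[ℂ] S) : Prop :=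
  χ 1 = 1 ∧ ∀ x y, χ (stuffle ε x y) = χ x * χ y

/-- Auxiliary recursion for `blockSumWord`: `acc` is the `•`-product of the `i` letters of the block
under construction, which is either closed or extended by the next letter. -/
def blockSumAux (ε : ℂ) (c : ℕ → ℂ) : B → ℕ → List B → TensorAlgebra ℂ B
  | acc, i, [] => c i • TensorAlgebra.ι ℂ acc
  | acc, i, b :: u => c i • (TensorAlgebra.ι ℂ acc * blockSumAux ε c b 1 u) +
      blockSumAux ε c (ε • (acc * b)) (i + 1) u

/-- `∑_I c_{i₁} ⋯ c_{i_k} I[u]`, the sum being over all compositions `I = (i₁,…,i_k)` of the length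
of `u`, where `I[u]` is obtained by `•`-multiplying the letters of `u` inside the successive blocks
of lengths `i₁,…,i_k`. -/
def blockSumWord (ε : ℂ) (c : ℕ → ℂ) : List B → TensorAlgebra ℂ B
  | [] => 1
  | a :: u => blockSumAux ε c a 1 u

theorem blockSumAux_add (ε : ℂ) (c : ℕ → ℂ) (x y : B) (i : ℕ) (u : List B) :
    blockSumAux ε c (x + y) i u = blockSumAux ε c x i u + blockSumAux ε c y i u := by
  induction u generalizing x y i with
  | nil => simp [blockSumAux]
  | cons b u ih =>
    simp only [blockSumAux, map_add, add_mul, smul_add, ih]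
    abel

theorem blockSumAux_smul (ε : ℂ) (c : ℕ → ℂ) (t : ℂ) (x : B) (i : ℕ) (u : List B) :
    blockSumAux ε c (t • x) i u = t • blockSumAux ε c x i u := by
  induction u generalizing x i with
  | nil => simp [blockSumAux, smul_comm t]
  | cons b u ih =>
    simp only [blockSumAux, map_smul, smul_mul_assoc, smul_add, smul_comm _ t, ih]

theorem isMultilinear_blockSumAux (ε : ℂ) (c : ℕ → ℂ) (acc : B) (i : ℕ) :
    IsMultilinear (blockSumAux ε c acc i) where
  add u v x y := by
    induction u generalizing acc i with
    | nil =>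
      simp only [List.nil_append, blockSumAux, blockSumAux_add, mul_add, smul_add]
      abel
    | cons a u ih =>
      simp only [List.cons_append, blockSumAux, ih, mul_add, smul_add]
      abel
  smul u v t x := by
    induction u generalizing acc i with
    | nil =>
      simp only [List.nil_append, blockSumAux, blockSumAux_smul, mul_smul_comm, smul_add,
        smul_comm _ t]
    | cons a u ih =>
      simp only [List.cons_append, blockSumAux, ih, mul_smul_comm, smul_add, smul_comm _ t]

theorem isMultilinear_blockSumWord (ε : ℂ) (c : ℕ → ℂ) :
    IsMultilinear (blockSumWord ε c : List B → TensorAlgebra ℂ B) where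
  add u v x y := by
    cases u with
    | nil => exact blockSumAux_add ε c x y 1 v
    | cons a u => exact (isMultilinear_blockSumAux ε c a 1).add u v x y
  smul u v t x := by
    cases u with
    | nil => exact blockSumAux_smul ε c t x 1 v
    | cons a u => exact (isMultilinear_blockSumAux ε c a 1).smul u v t x

/-- Hoffman's exponential `exp u = ∑_I (1 / (i₁! ⋯ i_k!)) I[u]`. -/
def hoffmanExp (ε : ℂ) : TensorAlgebra ℂ B →ₗ[ℂ] TensorAlgebra ℂ B :=
  ofWords (blockSumWord ε fun i => 1 / (i.factorial : ℂ)) (isMultilinear_blockSumWord _ _)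

/-- Hoffman's logarithm `log u = ∑_I ((-1)^{n-k} / (i₁ ⋯ i_k)) I[u]`. -/
def hoffmanLog (ε : ℂ) : TensorAlgebra ℂ B →ₗ[ℂ] TensorAlgebra ℂ B :=
  ofWords (blockSumWord ε fun i => (-1) ^ (i - 1) / (i : ℂ)) (isMultilinear_blockSumWord _ _)

end Words

/-! ## Nested sums, finite parts, cut-off sums -/

/-- The two versions of nested sums: with strict and with weak inequalities. -/
inductive Ineq
  | strict
  | weak

/-- The sign in `a • b = ± a b`: `+` for strict inequalities and `-` for weak ones. -/
def Ineq.sign : Ineq → ℂ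
  | .strict => 1
  | .weak => -1

/-- The largest integer `m` with `m < n` (strict), resp. `m ≤ n` (weak), for `n ≥ 1`. -/
def Ineq.below : Ineq → ℕ → ℕ
  | .strict, n => n - 1
  | .weak, n => n

/-- The truncated nested sum `∑ f₁(n₁) ⋯ f_k(n_k)` over `0 < n_k < ⋯ < n₁ ≤ N` (strict), resp. over
`0 < n_k ≤ ⋯ ≤ n₁ ≤ N` (weak). -/
def truncSumWord (v : Ineq) : List (ℝ → ℂ) → ℕ → ℂ
  | [], _ => 1
  | f :: u, N => ∑ n ∈ Finset.Icc 1 N, f n * truncSumWord v u (v.below n)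

theorem isMultilinear_truncSumWord (v : Ineq) : IsMultilinear (truncSumWord v) where
  add u w x y := by
    induction u with
    | nil =>
      funext N
      simp [truncSumWord, add_mul, Finset.sum_add_distrib]
    | cons a u ih =>
      funext N
      simp [truncSumWord, ih, mul_add, Finset.sum_add_distrib]
  smul u w c x := by
    induction u with
    | nil =>
      funext N
      simp [truncSumWord, Finset.mul_sum, mul_assoc]
    | cons a u ih =>
      funext N
      simp [truncSumWord, ih, Finset.mul_sum, mul_left_comm]

/-- The truncated nested sums, extended linearly to the tensor algebra. -/
def truncSum (v : Ineq) : TensorAlgebra ℂ (ℝ → ℂ) →ₗ[ℂ] (ℕ → ℂ) :=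
  ofWords (truncSumWord v) (isMultilinear_truncSumWord v)

/-- `c` is the finite part (constant term) of the asymptotic expansion of `S N` as `N → ∞` in terms
of the functions `N^β (log N)^l`, `β ∈ ℂ`, `l ∈ ℕ`. -/
def HasFinitePart (S : ℕ → ℂ) (c : ℂ) : Prop :=
  ∃ (s : Finset (ℂ × ℕ)) (a : ℂ × ℕ → ℂ), (0, 0) ∉ s ∧
    Filter.Tendsto
      (fun N : ℕ => S N - (c + ∑ p ∈ s, a p * (N : ℂ) ^ p.1 * (Real.log N : ℂ) ^ p.2))
      Filter.atTop (𝓝 0)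

open Classical in
/-- `fp_{N → ∞} S N`. -/
def finitePart (S : ℕ → ℂ) : ℂ :=
  if h : ∃ c, HasFinitePart S c then h.choose else 0

/-- The cut-off sum `fp_{N → ∞} ∑_{m=0}^N f m`. -/
def cutoffSum (f : ℝ → ℂ) : ℂ :=
  finitePart fun N => ∑ m ∈ Finset.range (N + 1), f m

/-- The cut-off nested sum of an element of the tensor algebra. -/
def cutoffNestedSum (v : Ineq) (x : TensorAlgebra ℂ (ℝ → ℂ)) : ℂ :=
  finitePart (truncSum v x)

/-- The extended regularisation `exp ∘ 𝓡̃(z) ∘ log` on the tensor algebra, where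
`𝓡̃(z)(σ₁ ⊗ ⋯ ⊗ σ_k) = σ₁(z) ⊗ ⋯ ⊗ σ_k(z)`. -/
def HolomorphicRegularisation.star {W : Set ℂ} {A : NonUnitalSubalgebra ℂ (ℝ → ℂ)}
    (R : HolomorphicRegularisation W A) (v : Ineq) (z : ℂ) :
    TensorAlgebra ℂ A →ₗ[ℂ] TensorAlgebra ℂ (ℝ → ℂ) :=
  hoffmanExp v.sign ∘ₗ (TensorAlgebra.lift ℂ (TensorAlgebra.ι ℂ ∘ₗ R.toFun z)).toLinearMap ∘ₗ hoffmanLog v.sign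

/-! ## Meromorphic functions and Birkhoff decomposition -/

/-- The functions that are meromorphic on `W` (with arbitrary values at the poles). -/
def meromorphicFunctions (W : Set ℂ) : Subalgebra ℂ (ℂ → ℂ) where
  carrier := {f | MeromorphicOn f W}
  mul_mem' hf hg := fun z hz => (hf z hz).mul (hg z hz)
  add_mem' hf hg := fun z hz => (hf z hz).add (hg z hz)
  algebraMap_mem' c := fun z _ => MeromorphicAt.const c z

/-- The functions that vanish on `W` outside a discrete closed subset of `W`. -/
def negligible (W : Set ℂ) : Ideal (meromorphicFunctions W) where
  carrier := {f | ∀ᶠ z in Filter.codiscreteWithin W, (f : ℂ → ℂ) z = 0}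
  zero_mem' := by simp
  add_mem' := by
    intro f g hf hg
    simp only [Set.mem_ofPred_eq] at hf hg ⊢
    filter_upwards [hf, hg] with z h1 h2
    simp [h1, h2]
  smul_mem' := by
    intro c f hf
    simp only [Set.mem_ofPred_eq] at hf ⊢
    filter_upwards [hf] with z h
    simp [h]

/-- The algebra `ℳ(W)` of meromorphic functions on `W`. -/
def Mero (W : Set ℂ) : Type :=
  meromorphicFunctions W ⧸ negligible W

instance (W : Set ℂ) : CommRing (Mero W) :=
  inferInstanceAs (CommRing (meromorphicFunctions W ⧸ negligible W))

instance (W : Set ℂ) : Algebra ℂ (Mero W) :=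
  inferInstanceAs (Algebra ℂ (meromorphicFunctions W ⧸ negligible W))

/-- The meromorphic function on `W` defined by `f`. -/
def Mero.mk {W : Set ℂ} (f : ℂ → ℂ) (hf : MeromorphicOn f W) : Mero W :=
  Ideal.Quotient.mk (negligible W) ⟨f, hf⟩

variable {W : Set ℂ}

/-- The meromorphic function `F` is given by `f`, outside a discrete closed subset of `W`. -/
def Mero.IsGivenBy (F : Mero W) (f : ℂ → ℂ) : Prop :=
  ∃ hf : MeromorphicOn f W, F = Mero.mk f hf

/-- `F` is holomorphic at `0` with value `c` there. -/
def Mero.HasValueAtZero (F : Mero W) (c : ℂ) : Prop :=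
  ∃ f : ℂ → ℂ, F.IsGivenBy f ∧ AnalyticAt ℂ f 0 ∧ f 0 = c

/-- `F` belongs to `z⁻¹ ℂ[z⁻¹]`. -/
def Mero.IsPolePart (F : Mero W) : Prop :=
  ∃ p : Polynomial ℂ, p.coeff 0 = 0 ∧ F.IsGivenBy fun z => p.eval z⁻¹

/-- `c` is the finite part at `z = 0` (the constant Laurent coefficient) of `f`. -/
def HasFinitePartAtZero (f : ℂ → ℂ) (c : ℂ) : Prop :=
  ∃ (p : Polynomial ℂ) (g : ℂ → ℂ), p.coeff 0 = 0 ∧ AnalyticAt ℂ g 0 ∧ g 0 = c ∧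
    ∀ᶠ z in 𝓝[≠] (0 : ℂ), f z = p.eval z⁻¹ + g z

/-- The Birkhoff decomposition `Ψ = Ψ₋^{*-1} * Ψ₊`, written as `Ψ₋ * Ψ = Ψ₊`, for the minimal
subtraction scheme: `Ψ₊` is holomorphic at `0`, and `Ψ₋` is normalised and takes its values in
`z⁻¹ ℂ[z⁻¹]` on non-empty words. -/
structure IsBirkhoff {B : Type*} [NonUnitalCommRing B] [Module ℂ B]
    (Ψ Ψm Ψp : TensorAlgebra ℂ B →ₗ[ℂ] Mero W) : Prop where
  factor : conv Ψm Ψ = Ψp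
  minus_one : Ψm 1 = 1
  minus_pole : ∀ (a : B) (x : TensorAlgebra ℂ B),
    (Ψm (TensorAlgebra.ι ℂ a * x)).IsPolePart
  plus_holomorphic : ∀ x, ∃ c, (Ψp x).HasValueAtZero c

end NestedSums

end

open NestedSums

noncomputable section

namespace NestedSums

section Algebra

variable {B : Type*} [NonUnitalCommRing B] [Module ℂ B]

theorem span_range_word : Submodule.span ℂ (Set.range (word : List B → TensorAlgebra ℂ B)) = ⊤ := by
  have h : (Submodule.span ℂ (Set.range (word : List B → TensorAlgebra ℂ B))).mkQ = 0 :=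
    hom_ext_word fun u => by
      simpa using Submodule.subset_span (Set.mem_range_self u)
  rw [← Submodule.ker_mkQ (Submodule.span ℂ _), h, LinearMap.ker_zero]

theorem word_induction {p : TensorAlgebra ℂ B → Prop} (word : ∀ u, p (word u))
    (add : ∀ x y, p x → p y → p (x + y)) (smul : ∀ (c : ℂ) x, p x → p (c • x))
    (x : TensorAlgebra ℂ B) : p x := by
  have hx : x ∈ Submodule.span ℂ (Set.range (NestedSums.word : List B → TensorAlgebra ℂ B)) := by
    rw [span_range_word]; trivial
  induction hx using Submodule.span_induction with
  | mem x h => obtain ⟨u, rfl⟩ := h; exact word u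
  | zero => simpa using smul 0 _ (word [])
  | add x y _ _ hx hy => exact add x y hx hy
  | smul c x _ hx => exact smul c x hx

@[simp] theorem word_nil : word ([] : List B) = 1 := rfl

theorem word_singleton (a : B) : word [a] = TensorAlgebra.ι ℂ a := by simp [word]

theorem deconc_word (u : List B) : deconc (word u) = deconcWord u := ofWords_word _ _ u

theorem deconc_one : deconc (1 : TensorAlgebra ℂ B) = 1 := deconc_word []

theorem deconc_ι_mul (a : B) (x : TensorAlgebra ℂ B) :
    deconc (TensorAlgebra.ι ℂ a * x) =
      1 ⊗ₜ[ℂ] (TensorAlgebra.ι ℂ a * x) + (TensorAlgebra.ι ℂ a ⊗ₜ[ℂ] 1) * deconc x := by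
  induction x using word_induction with
  | word u => rw [← word_cons, deconc_word, deconc_word, deconcWord]
  | add x y hx hy =>
    simp only [mul_add, map_add, hx, hy, TensorProduct.tmul_add]
    abel
  | smul c x hx => simp only [mul_smul_comm, map_smul, hx, TensorProduct.tmul_smul, smul_add]

theorem deconcWord_eq_sum (u : List B) :
    deconcWord u = ∑ i ∈ Finset.range (u.length + 1), word (u.take i) ⊗ₜ[ℂ] word (u.drop i) := by
  induction u with
  | nil => simp [deconcWord, Algebra.TensorProduct.one_def]
  | cons a u ih =>
    rw [deconcWord, ih, List.length_cons, Finset.sum_range_succ' _ (_ + 1), add_comm]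
    simp [Finset.mul_sum, word_cons]

variable [IsScalarTower ℂ B B] [SMulCommClass ℂ B B]

theorem deconc_stuffleWord (ε : ℂ) (u w : List B) :
    deconc (stuffleWord ε u w) =
      ∑ i ∈ Finset.range (u.length + 1), ∑ j ∈ Finset.range (w.length + 1),
        stuffleWord ε (u.take i) (w.take j) ⊗ₜ[ℂ] stuffleWord ε (u.drop i) (w.drop j) := by
  induction u generalizing w with
  | nil => simp [stuffleWord, deconc_word, deconcWord_eq_sum]
  | cons a u ihu =>
    induction w with
    | nil => simp [stuffleWord_nil_right, deconc_word, deconcWord_eq_sum]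
    | cons b w ihw =>
      have e1 := ihu (b :: w)
      have e2 := ihu w
      simp only [List.length_cons, Finset.sum_range_succ' _ (_ + 1), List.take_succ_cons,
        List.drop_succ_cons, List.take_zero, List.drop_zero, stuffleWord_nil_right,
        stuffleWord.eq_1] at e1 e2 ihw ⊢
      simp only [stuffleWord, map_add, deconc_ι_mul, e1, e2, ihw, TensorProduct.tmul_add,
        TensorProduct.add_tmul, mul_add, Finset.mul_sum, Finset.sum_add_distrib,
        Algebra.TensorProduct.tmul_mul_tmul, one_mul, word_cons, word_nil]
      abel

/-- Characters can be checked on words. -/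
theorem isCharacter_of_word {ε : ℂ} {S : Type*} [CommRing S] [Algebra ℂ S]
    {χ : TensorAlgebra ℂ B →ₗ[ℂ] S} (h1 : χ 1 = 1)
    (h : ∀ u w, χ (stuffleWord ε u w) = χ (word u) * χ (word w)) : IsCharacter ε χ := by
  refine ⟨h1, fun x y => ?_⟩
  induction x using word_induction with
  | word u =>
    induction y using word_induction with
    | word w => rw [stuffle_word, h]
    | add x y hx hy => simp only [map_add, hx, hy, mul_add]
    | smul c x hx => simp only [map_smul, hx, mul_smul_comm]
  | add x y hx hy => simp only [map_add, LinearMap.add_apply, hx, hy, add_mul]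
  | smul c x hx => simp only [map_smul, LinearMap.smul_apply, hx, smul_mul_assoc]

end Algebra

section PowerSeries

open PowerSeries

/-- The `n`-th coefficient of the composition `∑ c_k D^k` for a power series `D` without constant
term. -/
def compCoeff (D : PowerSeries ℂ) (c : ℕ → ℂ) (n : ℕ) : ℂ :=
  ∑ k ∈ Finset.range (n + 1), c k * coeff n (D ^ k)

theorem coeff_pow_eq_zero {D : PowerSeries ℂ} (hD : constantCoeff D = 0) {n k : ℕ} (h : n < k) :
    coeff n (D ^ k) = 0 :=
  X_pow_dvd_iff.1 (pow_dvd_pow_of_dvd (X_dvd_iff.2 hD) k) n h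

theorem compCoeff_eq {D : PowerSeries ℂ} (hD : constantCoeff D = 0) (c : ℕ → ℂ) {n N : ℕ}
    (h : n < N) : compCoeff D c n = ∑ k ∈ Finset.range N, c k * coeff n (D ^ k) := by
  refine Finset.sum_subset (by simpa using h) fun k _ hk => ?_
  rw [coeff_pow_eq_zero hD (by simpa using hk), mul_zero]

theorem compCoeff_zero (D : PowerSeries ℂ) (c : ℕ → ℂ) : compCoeff D c 0 = c 0 := by
  simp [compCoeff]

theorem compCoeff_succ {D : PowerSeries ℂ} (hD : constantCoeff D = 0) (c : ℕ → ℂ) (n : ℕ) :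
    compCoeff D c (n + 1) =
      ∑ j ∈ Finset.range (n + 1), coeff (j + 1) D * compCoeff D (fun k => c (k + 1)) (n - j) := by
  have h0 : coeff 0 D = 0 := by simpa using hD
  have h1 : ∀ k, coeff (n + 1) (D ^ (k + 1)) =
      ∑ j ∈ Finset.range (n + 1), coeff (j + 1) D * coeff (n - j) (D ^ k) := by
    intro k
    rw [pow_succ', coeff_mul,
      Finset.Nat.sum_antidiagonal_eq_sum_range_succ_mk, Finset.sum_range_succ' _ (n + 1)]
    simp [h0]
  rw [compCoeff, Finset.sum_range_succ' _ (n + 1)]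
  simp only [h1, pow_zero, coeff_one, Nat.add_eq_zero_iff, one_ne_zero, and_false, if_false,
    mul_zero, add_zero, Finset.mul_sum]
  rw [Finset.sum_comm]
  refine Finset.sum_congr rfl fun j hj => ?_
  rw [compCoeff_eq hD _ (show n - j < n + 1 by omega), Finset.mul_sum]
  exact Finset.sum_congr rfl fun k _ => by ring

theorem compCoeff_exp_log (n : ℕ) :
    compCoeff (log ℂ) (fun k => 1 / (k.factorial : ℂ)) (n + 1) = if n = 0 then 1 else 0 := by
  set Y : ℕ → PowerSeries ℂ := fun K =>
    ∑ k ∈ Finset.range K, C (1 / (k.factorial : ℂ)) * log ℂ ^ k with hY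
  have hc : ∀ {n K : ℕ}, n < K →
      coeff n (Y K) = compCoeff (log ℂ) (fun k => 1 / (k.factorial : ℂ)) n := by
    intro n K h
    rw [compCoeff_eq constantCoeff_log _ h, hY, map_sum]
    simp only [coeff_C_mul]
  have hL : (1 + X) * d⁄dX ℂ (log ℂ) = 1 := by
    rw [deriv_log]
    ext n
    cases n with
    | zero => simp [add_mul]
    | succ n => simp [add_mul, coeff_succ_X_mul, coeff_one, pow_succ]
  have hd : ∀ K, (1 + X) * d⁄dX ℂ (Y (K + 1)) = Y K := by
    intro K
    rw [hY]
    simp only [Finset.sum_range_succ' _ K, map_add, map_sum, mul_add, Finset.mul_sum]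
    have : ∀ k, (1 + X) * d⁄dX ℂ (C (1 / ((k + 1).factorial : ℂ)) * log ℂ ^ (k + 1)) =
        C (1 / (k.factorial : ℂ)) * log ℂ ^ k := by
      intro k
      have h1 : d⁄dX ℂ (C (1 / ((k + 1).factorial : ℂ)) * log ℂ ^ (k + 1)) =
          C (1 / (k.factorial : ℂ)) * (log ℂ ^ k * d⁄dX ℂ (log ℂ)) := by
        rw [Derivation.leibniz, Derivation.leibniz_pow]
        simp only [derivative_C, mul_zero, add_zero, Nat.add_sub_cancel, smul_eq_mul, nsmul_eq_mul]
        rw [← mul_assoc]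
        congr 1
        rw [show ((k + 1 : ℕ) : PowerSeries ℂ) = C ((k + 1 : ℕ) : ℂ) by simp, ← map_mul]
        congr 1
        rw [Nat.factorial_succ]
        have : (k.factorial : ℂ) ≠ 0 := by exact_mod_cast k.factorial_ne_zero
        have : ((k : ℂ) + 1) ≠ 0 := by exact_mod_cast k.succ_ne_zero
        push_cast
        field_simp
      rw [h1]
      linear_combination C (1 / (k.factorial : ℂ)) * log ℂ ^ k * hL
    simp only [this]
    simp
  have hrec : ∀ n : ℕ, ((n : ℂ) + 1) *
      compCoeff (log ℂ) (fun k => 1 / (k.factorial : ℂ)) (n + 1) =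
      (1 - n) * compCoeff (log ℂ) (fun k => 1 / (k.factorial : ℂ)) n := by
    intro n
    have h := congrArg (coeff n) (hd (n + 1))
    rw [add_mul, one_mul, map_add, coeff_derivative, hc (by omega), hc (by omega)] at h
    cases n with
    | zero => simp at h ⊢; linear_combination h
    | succ n =>
      rw [coeff_succ_X_mul, coeff_derivative, hc (by omega)] at h
      push_cast at h ⊢
      linear_combination h
  induction n with
  | zero => simpa [compCoeff_zero] using hrec 0
  | succ n ih =>
    have h := hrec (n + 1)
    rw [ih] at h
    have h2 : ((n + 1 : ℕ) : ℂ) + 1 ≠ 0 := by exact_mod_cast (n + 1).succ_ne_zero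
    have h3 : (1 - ((n + 1 : ℕ) : ℂ)) * (if n = 0 then 1 else 0) = 0 := by
      split_ifs with h <;> simp [h]
    rw [h3] at h
    rw [if_neg (by omega)]
    exact (mul_eq_zero.1 h).resolve_left h2

end PowerSeries

section Blocks

set_option linter.unusedSectionVars false

variable {B : Type*} [NonUnitalCommRing B] [Module ℂ B]

/-- The `•`-product of `y` and the letters of `u`. -/
def bulletProd (ε : ℂ) (y : B) (u : List B) : B :=
  u.foldl (fun acc b => ε • (acc * b)) y

@[simp] theorem bulletProd_nil (ε : ℂ) (y : B) : bulletProd ε y [] = y := rfl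

@[simp] theorem bulletProd_cons (ε : ℂ) (y b : B) (u : List B) :
    bulletProd ε y (b :: u) = bulletProd ε (ε • (y * b)) u := rfl

theorem bulletProd_append (ε : ℂ) (y : B) (u w : List B) :
    bulletProd ε y (u ++ w) = bulletProd ε (bulletProd ε y u) w :=
  List.foldl_append

variable [IsScalarTower ℂ B B] [SMulCommClass ℂ B B]

theorem bulletProd_add (ε : ℂ) (x y : B) (u : List B) :
    bulletProd ε (x + y) u = bulletProd ε x u + bulletProd ε y u := by
  induction u generalizing x y with
  | nil => rfl
  | cons b u ih => simp [add_mul, smul_add, ih]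

theorem bulletProd_smul (ε c : ℂ) (x : B) (u : List B) :
    bulletProd ε (c • x) u = c • bulletProd ε x u := by
  induction u generalizing x with
  | nil => rfl
  | cons b u ih => simp [smul_mul_assoc, smul_comm ε c, ih]

theorem isMultilinear_bulletProd (ε : ℂ) (y : B) : IsMultilinear (bulletProd ε y) where
  add u v a b := by simp [bulletProd_append, mul_add, smul_add, bulletProd_add]
  smul u v c a := by simp [bulletProd_append, mul_smul_comm, smul_comm ε c, bulletProd_smul]

theorem bulletProd_mul (ε : ℂ) (x y : B) (u : List B) :
    bulletProd ε (ε • (x * y)) u = ε • (x * bulletProd ε y u) := by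
  induction u generalizing y with
  | nil => rfl
  | cons b u ih =>
    rw [bulletProd_cons, bulletProd_cons, ← ih, smul_mul_assoc, mul_assoc, mul_smul_comm]

theorem bulletProd_perm (ε : ℂ) (y : B) {u w : List B} (h : u.Perm w) :
    bulletProd ε y u = bulletProd ε y w := by
  induction h generalizing y with
  | nil => rfl
  | cons a _ ih => exact ih _
  | swap a b u =>
    simp only [bulletProd_cons, smul_mul_assoc, mul_assoc]
    rw [mul_comm a b]
  | trans _ _ h1 h2 => rw [h1, h2]

/-- The linear form of `blockSumWord`. -/
def blockSum (ε : ℂ) (c : ℕ → ℂ) : TensorAlgebra ℂ B →ₗ[ℂ] TensorAlgebra ℂ B :=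
  ofWords (blockSumWord ε c) (isMultilinear_blockSumWord _ _)

theorem blockSum_word (ε : ℂ) (c : ℕ → ℂ) (u : List B) :
    blockSum ε c (word u) = blockSumWord ε c u := ofWords_word _ _ u

theorem blockSumAux_eq_sum (ε : ℂ) (c : ℕ → ℂ) (y : B) (i : ℕ) (u : List B) :
    blockSumAux ε c y i u = ∑ j ∈ Finset.range (u.length + 1),
      c (i + j) • (TensorAlgebra.ι ℂ (bulletProd ε y (u.take j)) *
        blockSumWord ε c (u.drop j)) := by
  induction u generalizing y i with
  | nil => simp [blockSumAux, blockSumWord]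
  | cons b u ih =>
    rw [List.length_cons, Finset.sum_range_succ' _ (_ + 1), blockSumAux, ih (ε • (y * b)), add_comm]
    simp [blockSumWord, add_assoc, add_comm 1]

theorem deconc_blockSumAux (ε : ℂ) (c : ℕ → ℂ) (y : B) (i : ℕ) (u : List B) :
    deconc (blockSumAux ε c y i u) = 1 ⊗ₜ[ℂ] blockSumAux ε c y i u +
      ∑ j ∈ Finset.range (u.length + 1),
        blockSumAux ε c y i (u.take j) ⊗ₜ[ℂ] blockSumWord ε c (u.drop j) := by
  induction u generalizing y i with
  | nil =>
    have h := deconc_ι_mul y (1 : TensorAlgebra ℂ B)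
    rw [mul_one, deconc_one, mul_one] at h
    simp [blockSumAux, blockSumWord, h, TensorProduct.tmul_smul, TensorProduct.smul_tmul']
  | cons b u ih =>
    rw [List.length_cons, Finset.sum_range_succ' _ (_ + 1)]
    simp only [blockSumAux, map_add, map_smul, deconc_ι_mul, ih, List.take_succ_cons,
      List.drop_succ_cons, List.take_zero, List.drop_zero, TensorProduct.tmul_add,
      TensorProduct.add_tmul, Finset.sum_add_distrib, mul_add, Finset.mul_sum, smul_add,
      Algebra.TensorProduct.tmul_mul_tmul, one_mul, mul_one, TensorProduct.tmul_smul,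
      Finset.smul_sum, ← TensorProduct.smul_tmul', blockSumWord]
    abel

theorem deconc_blockSumWord (ε : ℂ) (c : ℕ → ℂ) (u : List B) :
    deconc (blockSumWord ε c u) = ∑ j ∈ Finset.range (u.length + 1),
      blockSumWord ε c (u.take j) ⊗ₜ[ℂ] blockSumWord ε c (u.drop j) := by
  cases u with
  | nil => simp [blockSumWord, deconc_one, Algebra.TensorProduct.one_def]
  | cons a u =>
    rw [List.length_cons, Finset.sum_range_succ' _ (_ + 1), add_comm]
    simp [blockSumWord, deconc_blockSumAux]

/-- The linear map `u ↦ c_{|u|} (y • u)`. -/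
def blockWeight (ε : ℂ) (c : ℕ → ℂ) (y : B) : TensorAlgebra ℂ B →ₗ[ℂ] B :=
  ofWords (fun u => c u.length • bulletProd ε y u)
    { add := fun u v x z => by
        simp [(isMultilinear_bulletProd ε y).add, smul_add]
      smul := fun u v t x => by
        simp [(isMultilinear_bulletProd ε y).smul, smul_comm t] }

theorem blockWeight_word (ε : ℂ) (c : ℕ → ℂ) (y : B) (u : List B) :
    blockWeight ε c y (word u) = c u.length • bulletProd ε y u := ofWords_word _ _ u

theorem blockWeight_ι_mul (ε : ℂ) (c : ℕ → ℂ) (y a : B) (x : TensorAlgebra ℂ B) :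
    blockWeight ε c y (TensorAlgebra.ι ℂ a * x) =
      blockWeight ε (fun k => c (k + 1)) (ε • (y * a)) x := by
  induction x using word_induction with
  | word u => rw [← word_cons, blockWeight_word, blockWeight_word]; rfl
  | add x y hx hy => simp only [mul_add, map_add, hx, hy]
  | smul c x hx => simp only [mul_smul_comm, map_smul, hx]

/-- The linear map `u ↦ c_{|u|} u_•` where `u_•` is the `•`-product of the letters of the non-empty
word `u`; it vanishes on the empty word. -/
def blockProj (ε : ℂ) (c : ℕ → ℂ) : TensorAlgebra ℂ B →ₗ[ℂ] B :=
  ofWords (fun u => match u with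
      | [] => 0
      | a :: u => c (u.length + 1) • bulletProd ε a u)
    { add := fun u v x z => by
        cases u with
        | nil => simp [bulletProd_add]
        | cons a u => simp [(isMultilinear_bulletProd ε a).add, smul_add]
      smul := fun u v t x => by
        cases u with
        | nil => simp [bulletProd_smul, smul_comm t]
        | cons a u => simp [(isMultilinear_bulletProd ε a).smul, smul_comm t] }

theorem blockProj_one (ε : ℂ) (c : ℕ → ℂ) : blockProj ε c (1 : TensorAlgebra ℂ B) = 0 :=
  ofWords_word _ _ []

theorem blockProj_cons (ε : ℂ) (c : ℕ → ℂ) (a : B) (u : List B) :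
    blockProj ε c (word (a :: u)) = c (u.length + 1) • bulletProd ε a u :=
  ofWords_word _ _ (a :: u)

theorem blockProj_ι_mul (ε : ℂ) (c : ℕ → ℂ) (a : B) (x : TensorAlgebra ℂ B) :
    blockProj ε c (TensorAlgebra.ι ℂ a * x) = blockWeight ε (fun k => c (k + 1)) a x := by
  induction x using word_induction with
  | word u => rw [← word_cons, blockProj_cons, blockWeight_word]
  | add x y hx hy => simp only [mul_add, map_add, hx, hy]
  | smul c x hx => simp only [mul_smul_comm, map_smul, hx]

/-- The block sum of a word, decomposed according to its first block. -/
theorem blockSum_eq (ε : ℂ) (c : ℕ → ℂ) (x : TensorAlgebra ℂ B) :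
    blockSum ε c x = algebraMap ℂ _ (TensorAlgebra.algebraMapInv x) +
      LinearMap.mul' ℂ _ (TensorProduct.map (TensorAlgebra.ι ℂ ∘ₗ blockProj ε c) (blockSum ε c)
        (deconc x)) := by
  induction x using word_induction with
  | word u =>
    rw [deconc_word, deconcWord_eq_sum]
    cases u with
    | nil =>
      have : blockSum ε c (1 : TensorAlgebra ℂ B) = 1 := blockSum_word ε c []
      simp [this, blockProj_one]
    | cons a u =>
      rw [List.length_cons, Finset.sum_range_succ' _ (_ + 1), blockSum_word, blockSumWord,
        blockSumAux_eq_sum]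
      simp only [List.take_zero, word_nil, map_add, map_sum, TensorProduct.map_tmul,
        LinearMap.comp_apply, blockProj_one, map_zero, TensorProduct.zero_tmul, add_zero,
        LinearMap.mul'_apply, blockSum_word, List.drop_succ_cons, List.take_succ_cons,
        blockProj_cons, map_smul, smul_mul_assoc]
      rw [word_cons, map_mul]
      simp only [TensorAlgebra.algebraMapInv, TensorAlgebra.lift_ι_apply, LinearMap.zero_apply,
        zero_mul, map_zero, zero_add]
      refine Finset.sum_congr rfl fun j hj => ?_
      rw [List.length_take, min_eq_left (by simpa [Nat.lt_succ_iff] using hj), add_comm 1 j]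
  | add x y hx hy => simp only [map_add, hx, hy]; abel
  | smul t x hx =>
    simp only [map_smul, hx, smul_add]
    simp [Algebra.smul_def]

theorem algebraMapInv_ι_mul (a : B) (x : TensorAlgebra ℂ B) :
    TensorAlgebra.algebraMapInv (TensorAlgebra.ι ℂ a * x) = (0 : ℂ) := by
  simp [TensorAlgebra.algebraMapInv]

theorem algebraMapInv_blockSumAux (ε : ℂ) (c : ℕ → ℂ) (y : B) (i : ℕ) (u : List B) :
    TensorAlgebra.algebraMapInv (blockSumAux ε c y i u) = (0 : ℂ) := by
  rw [blockSumAux_eq_sum]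
  simp [algebraMapInv_ι_mul]

theorem algebraMapInv_stuffleWord (ε : ℂ) (a b : B) (u w : List B) :
    TensorAlgebra.algebraMapInv (stuffleWord ε (a :: u) (b :: w)) = (0 : ℂ) := by
  simp [stuffleWord, algebraMapInv_ι_mul]

theorem blockWeight_shuffle (ε : ℂ) (c : ℕ → ℂ) (y : B) (u w : List B) :
    blockWeight ε c y (stuffleWord 0 u w) =
      (c (u.length + w.length) * ((u.length + w.length).choose u.length : ℂ)) •
        bulletProd ε y (u ++ w) := by
  induction u generalizing w c y with
  | nil => simp [stuffleWord, blockWeight_word]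
  | cons a u ihu =>
    induction w generalizing c y with
    | nil => simp [stuffleWord_nil_right, blockWeight_word]
    | cons b w ihw =>
      simp only [stuffleWord, map_add, blockWeight_ι_mul, ihu, ihw, zero_smul, map_zero, zero_mul,
        add_zero]
      have h1 : bulletProd ε (ε • (y * b)) (a :: u ++ w) = bulletProd ε y (a :: u ++ b :: w) :=
        bulletProd_perm ε y (u := b :: (a :: u ++ w)) List.perm_middle.symm
      rw [h1, List.cons_append, bulletProd_cons, ← add_smul]
      congr 1
      simp only [List.length_cons]
      rw [show u.length + 1 + (w.length + 1) = (u.length + (w.length + 1)) + 1 by omega,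
        show u.length + 1 + w.length + 1 = (u.length + (w.length + 1)) + 1 by omega,
        show u.length + 1 + w.length = u.length + (w.length + 1) by omega,
        Nat.choose_succ_succ]
      push_cast
      ring

theorem blockProj_shuffle (ε : ℂ) (a b : B) (u w : List B) :
    blockProj ε (fun k => 1 / (k.factorial : ℂ)) (stuffleWord 0 (a :: u) (b :: w)) =
      (1 / ((u.length + 1).factorial : ℂ) * (1 / ((w.length + 1).factorial : ℂ))) •
        ε • (bulletProd ε a u * bulletProd ε b w) := by
  have h1 : bulletProd ε b (a :: u ++ w) = ε • (bulletProd ε a u * bulletProd ε b w) := by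
    rw [bulletProd_append, bulletProd_cons, bulletProd_mul, mul_comm b, bulletProd_mul]
  have h2 : bulletProd ε a (u ++ b :: w) = ε • (bulletProd ε a u * bulletProd ε b w) := by
    rw [bulletProd_append, bulletProd_cons, bulletProd_mul]
  rw [stuffleWord]
  simp only [map_add, blockProj_ι_mul, blockWeight_shuffle, h1, h2, zero_smul, map_zero, zero_mul,
    add_zero]
  rw [← add_smul]
  congr 1
  simp only [List.length_cons]
  rw [show u.length + 1 + w.length = u.length + (w.length + 1) by omega, ← mul_add]
  have h3 := Nat.add_choose_mul_factorial_mul_factorial (w.length + 1) (u.length + 1)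
  rw [show w.length + 1 + (u.length + 1) = u.length + (w.length + 1) + 1 by omega,
    Nat.choose_succ_succ'] at h3
  have h4 : ((u.length + 1).factorial : ℂ) ≠ 0 := by exact_mod_cast Nat.factorial_ne_zero _
  have h5 : ((w.length + 1).factorial : ℂ) ≠ 0 := by exact_mod_cast Nat.factorial_ne_zero _
  have h6 : ((u.length + (w.length + 1) + 1).factorial : ℂ) ≠ 0 := by
    exact_mod_cast Nat.factorial_ne_zero _
  have h7 := congrArg (Nat.cast : ℕ → ℂ) h3
  push_cast at h7
  field_simp
  linear_combination h7

theorem stuffle_one_left (ε : ℂ) (x : TensorAlgebra ℂ B) : stuffle ε 1 x = x := by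
  induction x using word_induction with
  | word u => rw [← word_nil, stuffle_word, stuffleWord]
  | add x y hx hy => rw [map_add, hx, hy]
  | smul c x hx => rw [map_smul, hx]

theorem stuffle_one_right (ε : ℂ) (x : TensorAlgebra ℂ B) : stuffle ε x 1 = x := by
  induction x using word_induction with
  | word u => rw [← word_nil, stuffle_word, stuffleWord_nil_right]
  | add x y hx hy => rw [map_add, LinearMap.add_apply, hx, hy]
  | smul c x hx => rw [map_smul, LinearMap.smul_apply, hx]

theorem stuffle_ι_mul_ι_mul (ε : ℂ) (a b : B) (x y : TensorAlgebra ℂ B) :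
    stuffle ε (TensorAlgebra.ι ℂ a * x) (TensorAlgebra.ι ℂ b * y) =
      TensorAlgebra.ι ℂ a * stuffle ε x (TensorAlgebra.ι ℂ b * y) +
      TensorAlgebra.ι ℂ b * stuffle ε (TensorAlgebra.ι ℂ a * x) y +
      TensorAlgebra.ι ℂ (ε • (a * b)) * stuffle ε x y := by
  induction x using word_induction with
  | word u =>
    induction y using word_induction with
    | word w => simp only [← word_cons, stuffle_word, stuffleWord]
    | add x y hx hy => simp only [mul_add, map_add, hx, hy]; abel
    | smul c x hx => simp only [mul_smul_comm, map_smul, hx, smul_add]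
  | add x y hx hy => simp only [mul_add, map_add, LinearMap.add_apply, hx, hy]; abel
  | smul c x hx => simp only [mul_smul_comm, map_smul, LinearMap.smul_apply, hx, smul_add]

theorem stuffle_sum_sum (ε : ℂ) {I J : Type*} (s : Finset I) (t : Finset J) (c : I → ℂ) (d : J → ℂ)
    (p : I → B) (q : J → B) (X : I → TensorAlgebra ℂ B) (Y : J → TensorAlgebra ℂ B) :
    stuffle ε (∑ i ∈ s, c i • (TensorAlgebra.ι ℂ (p i) * X i))
        (∑ j ∈ t, d j • (TensorAlgebra.ι ℂ (q j) * Y j)) =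
      ∑ i ∈ s, ∑ j ∈ t, (c i * d j) • (TensorAlgebra.ι ℂ (ε • (p i * q j)) * stuffle ε (X i) (Y j)) +
      ∑ i ∈ s, c i • (TensorAlgebra.ι ℂ (p i) *
        stuffle ε (X i) (∑ j ∈ t, d j • (TensorAlgebra.ι ℂ (q j) * Y j))) +
      ∑ j ∈ t, d j • (TensorAlgebra.ι ℂ (q j) *
        stuffle ε (∑ i ∈ s, c i • (TensorAlgebra.ι ℂ (p i) * X i)) (Y j)) := by
  simp only [map_sum (stuffle ε), map_sum (stuffle ε _), LinearMap.sum_apply, map_smul (stuffle ε),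
    map_smul (stuffle ε _), LinearMap.smul_apply, stuffle_ι_mul_ι_mul, Finset.mul_sum,
    Finset.smul_sum, mul_smul_comm, smul_add, Finset.sum_add_distrib, mul_smul]
  rw [Finset.sum_comm (s := t)]
  simp only [smul_comm (d _) (c _)]
  rw [add_right_comm, add_rotate, add_right_comm]

theorem hoffmanExp_eq (ε : ℂ) :
    (hoffmanExp ε : TensorAlgebra ℂ B →ₗ[ℂ] _) = blockSum ε fun i => 1 / (i.factorial : ℂ) := rfl

theorem hoffmanLog_eq (ε : ℂ) :
    (hoffmanLog ε : TensorAlgebra ℂ B →ₗ[ℂ] _) =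
      blockSum ε fun i => (-1) ^ (i - 1) / (i : ℂ) := rfl

theorem blockSum_one (ε : ℂ) (c : ℕ → ℂ) : blockSum ε c (1 : TensorAlgebra ℂ B) = 1 :=
  blockSum_word ε c []

theorem blockSum_cons (ε : ℂ) (c : ℕ → ℂ) (a : B) (u : List B) :
    blockSum ε c (word (a :: u)) = ∑ j ∈ Finset.range (u.length + 1),
      c (j + 1) • (TensorAlgebra.ι ℂ (bulletProd ε a (u.take j)) *
        blockSum ε c (word (u.drop j))) := by
  rw [blockSum_word, blockSumWord, blockSumAux_eq_sum]
  exact Finset.sum_congr rfl fun j _ => by rw [blockSum_word, add_comm 1]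

/-- Hoffman's exponential is a morphism from the shuffle to the quasi-shuffle algebra. -/
theorem hoffmanExp_shuffleWord (ε : ℂ) (u w : List B) :
    hoffmanExp ε (stuffleWord 0 u w) =
      stuffle ε (hoffmanExp ε (word u)) (hoffmanExp ε (word w)) := by
  rw [hoffmanExp_eq]
  induction h : u.length + w.length using Nat.strong_induction_on generalizing u w with
  | _ n ih =>
  cases u with
  | nil => rw [stuffleWord, word_nil, blockSum_one, stuffle_one_left]
  | cons a u =>
  cases w with
  | nil => rw [stuffleWord_nil_right, word_nil, blockSum_one, stuffle_one_right]
  | cons b w =>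
  simp only [List.length_cons] at h
  rw [blockSum_eq, algebraMapInv_stuffleWord, map_zero, zero_add, deconc_stuffleWord]
  simp only [List.length_cons, Finset.sum_range_succ' _ (_ + 1), List.take_zero, List.drop_zero,
    List.take_succ_cons, List.drop_succ_cons, stuffleWord_nil_right, stuffleWord.eq_1, map_add,
    map_sum, TensorProduct.map_tmul, LinearMap.mul'_apply, LinearMap.comp_apply, word_nil,
    blockProj_one, map_zero, zero_mul, add_zero, blockProj_shuffle, blockProj_cons]
  have e1 : ∀ i ∈ Finset.range (u.length + 1), ∀ j ∈ Finset.range (w.length + 1),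
      blockSum ε (fun i => 1 / (i.factorial : ℂ)) (stuffleWord 0 (u.drop i) (w.drop j)) =
      stuffle ε (blockSum ε (fun i => 1 / (i.factorial : ℂ)) (word (u.drop i)))
        (blockSum ε (fun i => 1 / (i.factorial : ℂ)) (word (w.drop j))) := fun i _ j _ =>
    ih _ (by rw [List.length_drop, List.length_drop]; omega) _ _ rfl
  have e2 : ∀ i ∈ Finset.range (u.length + 1),
      blockSum ε (fun i => 1 / (i.factorial : ℂ)) (stuffleWord 0 (u.drop i) (b :: w)) =
      stuffle ε (blockSum ε (fun i => 1 / (i.factorial : ℂ)) (word (u.drop i)))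
        (blockSum ε (fun i => 1 / (i.factorial : ℂ)) (word (b :: w))) := fun i _ =>
    ih _ (by rw [List.length_drop, List.length_cons]; omega) _ _ rfl
  have e3 : ∀ j ∈ Finset.range (w.length + 1),
      blockSum ε (fun i => 1 / (i.factorial : ℂ)) (stuffleWord 0 (a :: u) (w.drop j)) =
      stuffle ε (blockSum ε (fun i => 1 / (i.factorial : ℂ)) (word (a :: u)))
        (blockSum ε (fun i => 1 / (i.factorial : ℂ)) (word (w.drop j))) := fun j _ =>
    ih _ (by rw [List.length_drop, List.length_cons]; omega) _ _ rfl
  have l1 : ∀ i ∈ Finset.range (u.length + 1), (u.take i).length = i := fun i hi => by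
    rw [List.length_take, min_eq_left (by simpa [Nat.lt_succ_iff] using hi)]
  have l2 : ∀ i ∈ Finset.range (w.length + 1), (w.take i).length = i := fun i hi => by
    rw [List.length_take, min_eq_left (by simpa [Nat.lt_succ_iff] using hi)]
  set E : TensorAlgebra ℂ B →ₗ[ℂ] TensorAlgebra ℂ B := blockSum ε fun i => 1 / (i.factorial : ℂ)
  have key : stuffle ε (E (word (a :: u))) (E (word (b :: w))) =
      ∑ i ∈ Finset.range (u.length + 1), ∑ j ∈ Finset.range (w.length + 1),
        (1 / ((i + 1).factorial : ℂ) * (1 / ((j + 1).factorial : ℂ))) •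
          (TensorAlgebra.ι ℂ (ε • (bulletProd ε a (u.take i) * bulletProd ε b (w.take j))) *
            stuffle ε (E (word (u.drop i))) (E (word (w.drop j)))) +
      ∑ i ∈ Finset.range (u.length + 1), (1 / ((i + 1).factorial : ℂ)) •
        (TensorAlgebra.ι ℂ (bulletProd ε a (u.take i)) *
          stuffle ε (E (word (u.drop i))) (E (word (b :: w)))) +
      ∑ j ∈ Finset.range (w.length + 1), (1 / ((j + 1).factorial : ℂ)) •
        (TensorAlgebra.ι ℂ (bulletProd ε b (w.take j)) *
          stuffle ε (E (word (a :: u))) (E (word (w.drop j)))) := by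
    rw [show E (word (a :: u)) = _ from blockSum_cons _ _ _ _,
      show E (word (b :: w)) = _ from blockSum_cons _ _ _ _, stuffle_sum_sum]
  rw [key, Finset.sum_add_distrib]
  refine congrArg₂ _ (congrArg₂ _ ?_ ?_) ?_
  · refine Finset.sum_congr rfl fun i hi => ?_
    refine Finset.sum_congr rfl fun j hj => ?_
    rw [e1 i hi j hj, l1 i hi, l2 j hj, map_smul, smul_mul_assoc]
  · refine Finset.sum_congr rfl fun i hi => ?_
    rw [e2 i hi, l1 i hi, map_smul, smul_mul_assoc]
  · refine Finset.sum_congr rfl fun j hj => ?_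
    rw [e3 j hj, l2 j hj, map_smul, smul_mul_assoc]

end Blocks

section Hoffman

set_option linter.unusedSectionVars false

variable {B : Type*} [NonUnitalCommRing B] [Module ℂ B] [IsScalarTower ℂ B B] [SMulCommClass ℂ B B]

theorem blockWeight_blockSumWord (ε : ℂ) (c : ℕ → ℂ) {D : PowerSeries ℂ}
    (hD : PowerSeries.constantCoeff D = 0) (y : B) (u : List B) :
    blockWeight ε c y (blockSumWord ε (fun j => PowerSeries.coeff j D) u) =
      compCoeff D c u.length • bulletProd ε y u := by
  induction h : u.length using Nat.strong_induction_on generalizing u c y with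
  | _ n ih =>
  cases u with
  | nil =>
    obtain rfl : n = 0 := by simpa using h.symm
    rw [compCoeff_zero]
    exact blockWeight_word ε c y []
  | cons b u =>
    obtain rfl : n = u.length + 1 := by simpa using h.symm
    rw [compCoeff_succ hD, blockSumWord, blockSumAux_eq_sum, map_sum, Finset.sum_smul]
    refine Finset.sum_congr rfl fun j hj => ?_
    have hj' : j ≤ u.length := by simpa [Nat.lt_succ_iff] using hj
    rw [map_smul, blockWeight_ι_mul, ih _ _ _ _ _ rfl, bulletProd_mul, ← bulletProd_append,
      List.take_append_drop, ← bulletProd_mul, ← bulletProd_cons, List.length_drop, mul_smul,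
      add_comm 1 j]
    · rw [List.length_drop]; omega

theorem blockProj_blockSumWord (ε : ℂ) (c : ℕ → ℂ) {D : PowerSeries ℂ}
    (hD : PowerSeries.constantCoeff D = 0) (a : B) (u : List B) :
    blockProj ε c (blockSumWord ε (fun j => PowerSeries.coeff j D) (a :: u)) =
      compCoeff D c (u.length + 1) • bulletProd ε a u := by
  rw [compCoeff_succ hD, blockSumWord, blockSumAux_eq_sum, map_sum, Finset.sum_smul]
  refine Finset.sum_congr rfl fun j hj => ?_
  rw [map_smul, blockProj_ι_mul, blockWeight_blockSumWord _ _ hD, ← bulletProd_append,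
    List.take_append_drop, List.length_drop, mul_smul, add_comm 1 j]

theorem blockSumAux_congr (ε : ℂ) {c d : ℕ → ℂ} (h : ∀ i, c (i + 1) = d (i + 1)) (y : B) (i : ℕ)
    (u : List B) : blockSumAux ε c y (i + 1) u = blockSumAux ε d y (i + 1) u := by
  induction u generalizing y i with
  | nil => simp [blockSumAux, h]
  | cons b u ih =>
    rw [blockSumAux, blockSumAux, h, ih (ε • (y * b)), ← zero_add 1, ih b]

theorem hoffmanLog_word (ε : ℂ) (u : List B) : hoffmanLog ε (word u) =
    blockSumWord ε (fun j => PowerSeries.coeff j (PowerSeries.log ℂ)) u := by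
  rw [hoffmanLog_eq, blockSum_word]
  cases u with
  | nil => rfl
  | cons a u =>
    refine blockSumAux_congr ε (fun i => ?_) a 0 u
    simp [pow_succ]

theorem blockSumWord_nil (ε : ℂ) (c : ℕ → ℂ) : blockSumWord ε c ([] : List B) = 1 := rfl

theorem algebraMapInv_blockSumWord_cons (ε : ℂ) (c : ℕ → ℂ) (a : B) (u : List B) :
    TensorAlgebra.algebraMapInv (blockSumWord ε c (a :: u)) = (0 : ℂ) :=
  algebraMapInv_blockSumAux ..

theorem hoffmanExp_hoffmanLog (ε : ℂ) (x : TensorAlgebra ℂ B) :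
    hoffmanExp ε (hoffmanLog ε x) = x := by
  induction x using word_induction with
  | add x y hx hy => rw [map_add, map_add, hx, hy]
  | smul c x hx => rw [map_smul, map_smul, hx]
  | word u =>
  induction u with
  | nil =>
    rw [word_nil, hoffmanLog_eq, hoffmanExp_eq, blockSum_one, blockSum_one]
  | cons a u ih =>
    rw [hoffmanExp_eq, blockSum_eq, hoffmanLog_word, algebraMapInv_blockSumWord_cons, map_zero,
      zero_add, deconc_blockSumWord, List.length_cons, Finset.sum_range_succ' _ (_ + 1)]
    simp only [List.take_succ_cons, List.drop_succ_cons, map_add, map_sum, TensorProduct.map_tmul,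
      LinearMap.mul'_apply, LinearMap.comp_apply, List.take_zero, blockSumWord_nil, blockProj_one,
      map_zero, zero_mul, add_zero]
    rw [Finset.sum_eq_single 0]
    · have h := blockProj_blockSumWord ε (fun k => 1 / (k.factorial : ℂ))
        PowerSeries.constantCoeff_log a []
      rw [List.length_nil, compCoeff_exp_log, if_pos rfl, one_smul, bulletProd_nil] at h
      rw [List.take_zero, List.drop_zero, h, ← hoffmanLog_word, ← hoffmanExp_eq, ih, word_cons]
    · intro j hj hj0
      have h := blockProj_blockSumWord ε (fun k => 1 / (k.factorial : ℂ))
        PowerSeries.constantCoeff_log a (u.take j)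
      rw [compCoeff_exp_log, if_neg, zero_smul] at h
      · rw [h, map_zero, zero_mul]
      · rw [List.length_take, min_eq_left (by simpa [Nat.lt_succ_iff] using hj)]
        exact hj0
    · simp

/-- The span of the words of length at most `n`. -/
def shortWords (B : Type*) [NonUnitalCommRing B] [Module ℂ B] (n : ℕ) :
    Submodule ℂ (TensorAlgebra ℂ B) :=
  Submodule.span ℂ {x | ∃ u : List B, u.length ≤ n ∧ word u = x}

theorem word_mem_shortWords {u : List B} {n : ℕ} (h : u.length ≤ n) : word u ∈ shortWords B n :=
  Submodule.subset_span ⟨u, h, rfl⟩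

theorem ι_mul_mem_shortWords {n : ℕ} (a : B) {x : TensorAlgebra ℂ B} (hx : x ∈ shortWords B n) :
    TensorAlgebra.ι ℂ a * x ∈ shortWords B (n + 1) := by
  induction hx using Submodule.span_induction with
  | mem x h =>
    obtain ⟨u, hu, rfl⟩ := h
    rw [← word_cons]
    exact word_mem_shortWords (by simpa using hu)
  | zero => simp
  | add x y _ _ hx hy => rw [mul_add]; exact add_mem hx hy
  | smul c x _ hx => rw [mul_smul_comm]; exact Submodule.smul_mem _ c hx

theorem shortWords_mono {n m : ℕ} (h : n ≤ m) : shortWords B n ≤ shortWords B m :=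
  Submodule.span_mono fun _ ⟨u, hu, e⟩ => ⟨u, hu.trans h, e⟩

theorem blockSumAux_mem_shortWords (ε : ℂ) (c : ℕ → ℂ) (y : B) (i : ℕ) (u : List B) :
    blockSumAux ε c y i u ∈ shortWords B (u.length + 1) := by
  induction u generalizing y i with
  | nil =>
    rw [blockSumAux, ← word_singleton]
    exact Submodule.smul_mem _ _ (word_mem_shortWords (by simp))
  | cons b u ih =>
    rw [blockSumAux]
    exact add_mem (Submodule.smul_mem _ _ (ι_mul_mem_shortWords _ (ih _ _)))
      (shortWords_mono (by simp) (ih _ _))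

theorem blockSumAux_sub_mem_shortWords (ε : ℂ) (c : ℕ → ℂ) (hc : c 1 = 1) (y : B)
    (u : List B) : blockSumAux ε c y 1 u - word (y :: u) ∈ shortWords B u.length := by
  induction u generalizing y with
  | nil => simp [blockSumAux, hc, word_singleton]
  | cons b u ih =>
    rw [blockSumAux, hc, one_smul, word_cons, add_sub_right_comm, ← mul_sub]
    exact add_mem (ι_mul_mem_shortWords _ (ih _)) (blockSumAux_mem_shortWords _ _ _ _ _)

theorem blockSum_surjective (ε : ℂ) (c : ℕ → ℂ) (hc : c 1 = 1) :
    Function.Surjective (blockSum ε c : TensorAlgebra ℂ B →ₗ[ℂ] _) := by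
  have key : ∀ n, shortWords B n ≤ LinearMap.range (blockSum ε c) := by
    intro n
    induction n with
    | zero =>
      refine Submodule.span_le.2 ?_
      rintro _ ⟨u, hu, rfl⟩
      obtain rfl : u = [] := by simpa using hu
      exact ⟨1, blockSum_one ε c⟩
    | succ n ih =>
      refine Submodule.span_le.2 ?_
      rintro _ ⟨u, hu, rfl⟩
      cases u with
      | nil => exact ⟨1, blockSum_one ε c⟩
      | cons a u =>
        have h1 := ih (shortWords_mono (by simpa using hu)
          (blockSumAux_sub_mem_shortWords ε c hc a u))
        have h2 : blockSumAux ε c a 1 u ∈ LinearMap.range (blockSum ε c) :=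
          ⟨word (a :: u), blockSum_word _ _ _⟩
        simpa using sub_mem h2 h1
  intro x
  induction x using word_induction with
  | word u => exact key _ (word_mem_shortWords le_rfl)
  | add x y hx hy => exact add_mem (S := Submodule ℂ _) (s := LinearMap.range (blockSum ε c)) hx hy
  | smul t x hx => exact Submodule.smul_mem (LinearMap.range (blockSum ε c)) t hx

theorem hoffmanLog_hoffmanExp (ε : ℂ) (x : TensorAlgebra ℂ B) :
    hoffmanLog ε (hoffmanExp ε x) = x := by
  obtain ⟨y, rfl⟩ := blockSum_surjective ε (fun i => (-1) ^ (i - 1) / (i : ℂ)) (by simp) x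
  rw [← hoffmanLog_eq, hoffmanExp_hoffmanLog]

theorem hoffmanExp_shuffle (ε : ℂ) (x y : TensorAlgebra ℂ B) :
    hoffmanExp ε (stuffle 0 x y) = stuffle ε (hoffmanExp ε x) (hoffmanExp ε y) := by
  induction x using word_induction with
  | word u =>
    induction y using word_induction with
    | word w => rw [stuffle_word, hoffmanExp_shuffleWord]
    | add x y hx hy => simp only [map_add, hx, hy]
    | smul c x hx => simp only [map_smul, hx]
  | add x y hx hy => simp only [map_add, LinearMap.add_apply, hx, hy]
  | smul c x hx => simp only [map_smul, LinearMap.smul_apply, hx]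

theorem hoffmanLog_stuffle (ε : ℂ) (x y : TensorAlgebra ℂ B) :
    hoffmanLog ε (stuffle ε x y) = stuffle 0 (hoffmanLog ε x) (hoffmanLog ε y) := by
  rw [← hoffmanLog_hoffmanExp ε (stuffle 0 _ _), hoffmanExp_shuffle, hoffmanExp_hoffmanLog,
    hoffmanExp_hoffmanLog]

variable {B' : Type*} [NonUnitalCommRing B'] [Module ℂ B'] [IsScalarTower ℂ B' B']
  [SMulCommClass ℂ B' B']

/-- The algebra morphism of tensor algebras induced by a linear map of letters. -/
def mapLetters (φ : B →ₗ[ℂ] B') : TensorAlgebra ℂ B →ₐ[ℂ] TensorAlgebra ℂ B' :=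
  TensorAlgebra.lift ℂ (TensorAlgebra.ι ℂ ∘ₗ φ)

@[simp] theorem mapLetters_ι (φ : B →ₗ[ℂ] B') (a : B) :
    mapLetters φ (TensorAlgebra.ι ℂ a) = TensorAlgebra.ι ℂ (φ a) := by
  simp [mapLetters]

theorem mapLetters_word (φ : B →ₗ[ℂ] B') (u : List B) :
    mapLetters φ (word u) = word (u.map φ) := by
  induction u with
  | nil => simp
  | cons a u ih => rw [word_cons, map_mul, ih, mapLetters_ι, List.map_cons, word_cons]

theorem mapLetters_shuffle (φ : B →ₗ[ℂ] B') (x y : TensorAlgebra ℂ B) :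
    mapLetters φ (stuffle 0 x y) = stuffle 0 (mapLetters φ x) (mapLetters φ y) := by
  have h : ∀ u w : List B, mapLetters φ (stuffleWord 0 u w) =
      stuffleWord 0 (u.map φ) (w.map φ) := by
    intro u w
    induction u generalizing w with
    | nil => simp [stuffleWord, mapLetters_word]
    | cons a u ihu =>
      induction w with
      | nil => simp [stuffleWord_nil_right, mapLetters_word]
      | cons b w ihw =>
        rw [List.map_cons] at ihw
        simp [stuffleWord, ihu, ihw]
  induction x using word_induction with
  | word u =>
    induction y using word_induction with
    | word w => rw [stuffle_word, mapLetters_word, mapLetters_word, stuffle_word, h]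
    | add x y hx hy => simp only [map_add, hx, hy]
    | smul c x hx => simp only [map_smul, hx]
  | add x y hx hy => simp only [map_add, LinearMap.add_apply, hx, hy]
  | smul c x hx => simp only [map_smul, LinearMap.smul_apply, hx]

theorem mapLetters_blockSum (φ : B →ₗ[ℂ] B') (hφ : ∀ a b, φ (a * b) = φ a * φ b) (ε : ℂ)
    (c : ℕ → ℂ) (x : TensorAlgebra ℂ B) :
    mapLetters φ (blockSum ε c x) = blockSum ε c (mapLetters φ x) := by
  have h : ∀ (y : B) (i : ℕ) (u : List B), mapLetters φ (blockSumAux ε c y i u) =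
      blockSumAux ε c (φ y) i (u.map φ) := by
    intro y i u
    induction u generalizing y i with
    | nil => simp [blockSumAux]
    | cons b u ih => simp [blockSumAux, ih, hφ]
  induction x using word_induction with
  | word u =>
    rw [blockSum_word, mapLetters_word, blockSum_word]
    cases u with
    | nil => simp [blockSumWord]
    | cons a u => exact h a 1 u
  | add x y hx hy => simp only [map_add, hx, hy]
  | smul c x hx => simp only [map_smul, hx]

end Hoffman

section TruncSum

theorem truncSum_word (v : Ineq) (u : List (ℝ → ℂ)) : truncSum v (word u) = truncSumWord v u :=
  ofWords_word _ _ u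

theorem truncSum_one (v : Ineq) : truncSum v 1 = 1 := truncSum_word v []

theorem truncSum_ι_mul (v : Ineq) (f : ℝ → ℂ) (x : TensorAlgebra ℂ (ℝ → ℂ)) (N : ℕ) :
    truncSum v (TensorAlgebra.ι ℂ f * x) N =
      ∑ n ∈ Finset.Icc 1 N, f n * truncSum v x (v.below n) := by
  induction x using word_induction with
  | word u => rw [← word_cons, truncSum_word, truncSum_word, truncSumWord]
  | add x y hx hy =>
    simp only [mul_add, map_add, Pi.add_apply, hx, hy, Finset.sum_add_distrib]
  | smul c x hx =>
    simp only [mul_smul_comm, map_smul, Pi.smul_apply, hx, Finset.smul_sum]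

theorem truncSum_stuffleWord (v : Ineq) (u w : List (ℝ → ℂ)) (N : ℕ) :
    truncSum v (stuffleWord v.sign u w) N = truncSumWord v u N * truncSumWord v w N := by
  induction u generalizing w N with
  | nil => simp [stuffleWord, truncSum_word, truncSumWord]
  | cons a u ihu =>
  induction w generalizing N with
  | nil => simp [stuffleWord_nil_right, truncSum_word, truncSumWord]
  | cons b w ihw =>
  simp only [stuffleWord, map_add, Pi.add_apply, truncSum_ι_mul, ihu, ihw]
  induction N with
  | zero => simp [truncSumWord]
  | succ N ih =>
    simp only [truncSumWord, Finset.sum_Icc_succ_top (Nat.le_add_left 1 N)] at ih ⊢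
    cases v with
    | strict =>
      simp only [Ineq.below, Nat.add_sub_cancel, Ineq.sign, Pi.smul_apply, Pi.mul_apply, one_smul] at ih ⊢
      linear_combination ih
    | weak =>
      simp only [Ineq.below, Ineq.sign, Pi.smul_apply, Pi.mul_apply, smul_eq_mul,
        Finset.sum_Icc_succ_top (Nat.le_add_left 1 N)] at ih ⊢
      linear_combination ih

theorem truncSum_stuffle (v : Ineq) (x y : TensorAlgebra ℂ (ℝ → ℂ)) :
    truncSum v (stuffle v.sign x y) = truncSum v x * truncSum v y := by
  refine (isCharacter_of_word (truncSum_one v) fun u w => ?_).2 x y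
  funext N
  rw [truncSum_stuffleWord, Pi.mul_apply, truncSum_word, truncSum_word]

end TruncSum

section FinitePart

open Filter Polynomial

theorem HasFinitePart.congr {S T : ℕ → ℂ} {c : ℂ} (h : HasFinitePart S c)
    (hST : S =ᶠ[atTop] T) : HasFinitePart T c := by
  obtain ⟨s, a, hs, h⟩ := h
  exact ⟨s, a, hs, h.congr' (hST.mono fun N hN => by simp only [hN])⟩

theorem HasFinitePart.of_tendsto {S : ℕ → ℂ} {c : ℂ} (h : Tendsto S atTop (𝓝 c)) :
    HasFinitePart S c :=
  ⟨∅, 0, by simp, by simpa using h.sub_const c⟩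

theorem HasFinitePart.add {S T : ℕ → ℂ} {c d : ℂ} (hS : HasFinitePart S c)
    (hT : HasFinitePart T d) : HasFinitePart (S + T) (c + d) := by
  classical
  obtain ⟨s, a, hs, h⟩ := hS
  obtain ⟨t, b, ht, k⟩ := hT
  refine ⟨s ∪ t, fun p => (if p ∈ s then a p else 0) + (if p ∈ t then b p else 0), by simp [hs, ht],
    ?_⟩
  have e := h.add k
  rw [add_zero] at e
  refine e.congr fun N => ?_
  have e1 : ∑ p ∈ s, a p * (N : ℂ) ^ p.1 * (Real.log N : ℂ) ^ p.2 =
      ∑ p ∈ s ∪ t, (if p ∈ s then a p else 0) * (N : ℂ) ^ p.1 * (Real.log N : ℂ) ^ p.2 := by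
    rw [← Finset.sum_subset Finset.subset_union_left]
    · exact Finset.sum_congr rfl fun p hp => by rw [if_pos hp]
    · intro p _ hp; simp [hp]
  have e2 : ∑ p ∈ t, b p * (N : ℂ) ^ p.1 * (Real.log N : ℂ) ^ p.2 =
      ∑ p ∈ s ∪ t, (if p ∈ t then b p else 0) * (N : ℂ) ^ p.1 * (Real.log N : ℂ) ^ p.2 := by
    rw [← Finset.sum_subset Finset.subset_union_right]
    · exact Finset.sum_congr rfl fun p hp => by rw [if_pos hp]
    · intro p _ hp; simp [hp]
  simp only [add_mul, Finset.sum_add_distrib, ← e1, ← e2, Pi.add_apply]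
  ring

theorem HasFinitePart.smul {S : ℕ → ℂ} {c : ℂ} (t : ℂ) (hS : HasFinitePart S c) :
    HasFinitePart (t • S) (t * c) := by
  obtain ⟨s, a, hs, h⟩ := hS
  refine ⟨s, fun p => t * a p, hs, ?_⟩
  have e := h.const_mul t
  rw [mul_zero] at e
  refine e.congr fun N => ?_
  simp only [Pi.smul_apply, smul_eq_mul, mul_sub, mul_add, Finset.mul_sum, mul_assoc]

theorem HasFinitePart.term (d β : ℂ) (l : ℕ) (h : ¬ (β = 0 ∧ l = 0)) :
    HasFinitePart (fun N => d * (N : ℂ) ^ β * (Real.log N : ℂ) ^ l) 0 :=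
  ⟨{(β, l)}, fun _ => d, by simpa [eq_comm] using h, by simp⟩

theorem exists_natCast_cpow_ne_one {β : ℂ} (hβ : β ≠ 0) : ∃ m : ℕ, 0 < m ∧ (m : ℂ) ^ β ≠ 1 := by
  by_contra! H
  have h2 := H 2 (by norm_num)
  have h3 := H 3 (by norm_num)
  rw [Complex.cpow_def_of_ne_zero (by norm_num), Complex.exp_eq_one_iff] at h2 h3
  obtain ⟨n, hn⟩ := h2
  obtain ⟨k, hk⟩ := h3
  rw [← Complex.natCast_log] at hn hk
  have hpi : (2 * Real.pi * Complex.I : ℂ) ≠ 0 := by simp [Real.pi_ne_zero]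
  have e : (n : ℂ) * (Real.log (3 : ℕ) : ℂ) = k * (Real.log (2 : ℕ) : ℂ) := by
    have : ((n : ℂ) * (Real.log (3 : ℕ) : ℂ) - k * (Real.log (2 : ℕ) : ℂ)) *
      (2 * Real.pi * Complex.I) = 0 := by
      linear_combination (-(Real.log (3 : ℕ) : ℂ)) * hn + (Real.log (2 : ℕ) : ℂ) * hk
    simpa [sub_eq_zero, hpi, Real.pi_ne_zero] using this
  have e' : (n : ℝ) * Real.log 3 = k * Real.log 2 := by exact_mod_cast e
  have hl2 : 0 < Real.log 2 := Real.log_pos (by norm_num)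
  have hl3 : 0 < Real.log 3 := Real.log_pos (by norm_num)
  have e2 : (n.natAbs : ℝ) * Real.log 3 = k.natAbs * Real.log 2 := by
    have := congrArg abs e'
    rw [abs_mul, abs_mul, abs_of_pos hl2, abs_of_pos hl3] at this
    simpa [Nat.cast_natAbs] using this
  rw [← Real.log_pow, ← Real.log_pow] at e2
  have e3 : (3 : ℝ) ^ n.natAbs = 2 ^ k.natAbs :=
    Real.log_injOn_pos (Set.mem_Ioi.2 (by positivity)) (Set.mem_Ioi.2 (by positivity)) e2
  have e4 : 3 ^ n.natAbs = 2 ^ k.natAbs := by exact_mod_cast e3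
  have hn0 : n.natAbs ≠ 0 := by
    intro h0
    rw [Int.natAbs_eq_zero] at h0
    rw [h0] at hn
    have : (Real.log (2 : ℕ) : ℂ) ≠ 0 := by exact_mod_cast hl2.ne'
    rw [Int.cast_zero, zero_mul] at hn
    exact mul_ne_zero this hβ hn
  have hk0 : k.natAbs ≠ 0 := by
    intro h0
    rw [h0, pow_zero] at e4
    exact absurd e4 (Nat.one_lt_pow hn0 (by norm_num)).ne'
  have odd : Odd (3 ^ n.natAbs) := Odd.pow (by decide)
  rw [e4] at odd
  exact (Nat.not_even_iff_odd.2 odd) ((Nat.even_pow.2 ⟨even_two, hk0⟩))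

theorem polynomial_eq_zero_of_tendsto_log {Q : ℂ[X]}
    (h : Tendsto (fun N : ℕ => Q.eval (Real.log N : ℂ)) atTop (𝓝 0)) : Q = 0 := by
  by_cases hd : 0 < Q.degree
  · have h1 : Tendsto (fun N : ℕ => ‖(Real.log N : ℂ)‖) atTop atTop := by
      simp only [Complex.norm_real]
      exact tendsto_norm_atTop_atTop.comp (Real.tendsto_log_atTop.comp tendsto_natCast_atTop_atTop)
    exact absurd h.norm (not_tendsto_nhds_of_tendsto_atTop (Q.tendsto_norm_atTop hd h1) _)
  · rw [Polynomial.eq_C_of_degree_le_zero (not_lt.1 hd)] at h ⊢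
    simp only [eval_C] at h
    rw [tendsto_nhds_unique tendsto_const_nhds h, C_0]

theorem polynomial_eq_zero_of_tendsto (k : ℕ) : ∀ (t : Finset ℂ) (P : ℂ → ℂ[X]) (Q : ℂ[X]),
    0 ∉ t → ∑ β ∈ t, ((P β).natDegree + 1) ≤ k →
    Tendsto (fun N : ℕ => Q.eval (Real.log N : ℂ) +
      ∑ β ∈ t, (N : ℂ) ^ β * (P β).eval (Real.log N : ℂ)) atTop (𝓝 0) → Q = 0 := by
  induction k with
  | zero =>
    intro t P Q _ hk h
    have ht : t = ∅ := by
      by_contra hne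
      obtain ⟨β, hβ⟩ := Finset.nonempty_iff_ne_empty.2 hne
      have := Finset.single_le_sum (f := fun β => (P β).natDegree + 1) (fun _ _ => Nat.zero_le _) hβ
      omega
    subst ht
    exact polynomial_eq_zero_of_tendsto_log (by simpa using h)
  | succ k ih =>
    intro t P Q h0 hk h
    rcases t.eq_empty_or_nonempty with rfl | ⟨β, hβ⟩
    · exact polynomial_eq_zero_of_tendsto_log (by simpa using h)
    obtain ⟨m, hm, hmβ⟩ := exists_natCast_cpow_ne_one (β := β) (by rintro rfl; exact h0 hβ)
    have hm' : (m : ℂ) ≠ 0 := by exact_mod_cast hm.ne'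
    set L : ℂ := (Real.log m : ℂ)
    set P' : ℂ → ℂ[X] := fun γ => C ((m : ℂ) ^ γ) * taylor L (P γ) - C ((m : ℂ) ^ β) * P γ
    set Q' : ℂ[X] := taylor L Q - C ((m : ℂ) ^ β) * Q
    have hlim : Tendsto (fun N : ℕ => Q'.eval (Real.log N : ℂ) +
        ∑ γ ∈ t, (N : ℂ) ^ γ * (P' γ).eval (Real.log N : ℂ)) atTop (𝓝 0) := by
      have h1 := h.comp (tendsto_id.const_mul_atTop' hm)
      have h2 := h1.sub (h.const_mul ((m : ℂ) ^ β))
      rw [mul_zero, sub_zero] at h2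
      refine h2.congr' ?_
      filter_upwards [eventually_ge_atTop 1] with N hN
      have hlog : (Real.log ((m : ℝ) * N) : ℂ) = Real.log N + L := by
        rw [Real.log_mul (by exact_mod_cast hm.ne') (by positivity), Complex.ofReal_add, add_comm]
      simp only [Function.comp_apply, id, hlog, Q', P', eval_sub, taylor_eval, eval_mul, eval_C,
        Nat.cast_mul, Complex.natCast_mul_natCast_cpow, mul_add, Finset.mul_sum, mul_sub,
        Finset.sum_sub_distrib]
      rw [add_sub_add_comm]
      congr 2
      · exact Finset.sum_congr rfl fun γ _ => by ring
      · exact Finset.sum_congr rfl fun γ _ => by ring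
    have hdeg : ∀ γ, (P' γ).natDegree ≤ (P γ).natDegree := fun γ => by
      refine (natDegree_sub_le _ _).trans (max_le ?_ (natDegree_C_mul_le _ _))
      exact (natDegree_C_mul_le _ _).trans (natDegree_taylor _ _).le
    have hP'β : P' β = C ((m : ℂ) ^ β) * (taylor L (P β) - P β) := by
      simp only [P', mul_sub]
    have hQ' : Q' = 0 := by
      have hsplit := Finset.add_sum_erase t (fun β => (P β).natDegree + 1) hβ
      by_cases hd : (P β).natDegree = 0
      · refine ih (t.erase β) P' Q' (fun h => h0 (Finset.mem_of_mem_erase h)) ?_ ?_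
        · refine (Finset.sum_le_sum fun γ _ => Nat.succ_le_succ (hdeg γ)).trans ?_
          simp only [Nat.succ_eq_add_one]
          omega
        · refine hlim.congr fun N => ?_
          rw [← Finset.add_sum_erase t _ hβ, hP'β, eq_C_of_natDegree_eq_zero hd]
          simp
      · refine ih t P' Q' h0 ?_ hlim
        have hlt : (P' β).natDegree < (P β).natDegree := by
          rw [hP'β]
          refine (natDegree_C_mul_le _ _).trans_lt ?_
          have hne : P β ≠ 0 := by rintro h; simp [h] at hd
          by_cases hz : taylor L (P β) - P β = 0
          · rw [hz, natDegree_zero]; omega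
          refine natDegree_lt_natDegree hz ?_
          have := degree_sub_lt_left (p := taylor L (P β)) (q := P β) (degree_taylor _ _)
            (by simpa using hne) (leadingCoeff_taylor _ _)
          rwa [degree_taylor] at this
        have : ∑ γ ∈ t, ((P' γ).natDegree + 1) < ∑ γ ∈ t, ((P γ).natDegree + 1) :=
          Finset.sum_lt_sum (fun γ _ => Nat.succ_le_succ (hdeg γ)) ⟨β, hβ, Nat.succ_lt_succ hlt⟩
        omega
    have e := congrArg leadingCoeff (sub_eq_zero.1 hQ')
    rw [leadingCoeff_taylor, leadingCoeff_mul, leadingCoeff_C] at e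
    by_contra hQ
    exact hmβ (mul_right_cancel₀ (leadingCoeff_ne_zero.2 hQ) (by rw [one_mul, ← e]))

theorem HasFinitePart.eq_zero {c : ℂ} (h : HasFinitePart 0 c) : c = 0 := by
  classical
  obtain ⟨s, a, hs, h⟩ := h
  set P : ℂ → ℂ[X] := fun β => ∑ p ∈ s with p.1 = β, monomial p.2 (a p)
  set t := insert 0 (s.image Prod.fst)
  have hsum : ∀ N : ℕ, ∑ p ∈ s, a p * (N : ℂ) ^ p.1 * (Real.log N : ℂ) ^ p.2 =
      ∑ β ∈ t, (N : ℂ) ^ β * (P β).eval (Real.log N : ℂ) := by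
    intro N
    rw [← Finset.sum_fiberwise_of_maps_to (g := Prod.fst) (t := t)
      fun p hp => Finset.mem_insert_of_mem (Finset.mem_image_of_mem _ hp)]
    refine Finset.sum_congr rfl fun β _ => ?_
    simp only [P, eval_finsetSum, eval_monomial, Finset.mul_sum]
    refine Finset.sum_congr rfl fun p hp => ?_
    rw [(Finset.mem_filter.1 hp).2]
    ring
  have hQ := polynomial_eq_zero_of_tendsto _ (t.erase 0) P (C c + P 0) (by simp) le_rfl (by
    have := h.neg
    rw [neg_zero] at this
    refine this.congr fun N => ?_
    rw [hsum, ← Finset.add_sum_erase t _ (Finset.mem_insert_self _ _)]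
    simp [add_assoc])
  have h0 : (P 0).coeff 0 = 0 := by
    simp only [P, finsetSum_coeff, coeff_monomial]
    refine Finset.sum_eq_zero fun p hp => ?_
    rw [if_neg]
    intro hp2
    rw [Finset.mem_filter] at hp
    exact hs (by convert hp.1 using 1; exact Prod.ext hp.2.symm hp2.symm)
  have := congrArg (fun q => coeff q 0) hQ
  simpa [h0] using this

theorem HasFinitePart.unique {S : ℕ → ℂ} {c d : ℂ} (hc : HasFinitePart S c)
    (hd : HasFinitePart S d) : c = d := by
  have h := hc.add (hd.smul (-1))
  rw [neg_one_smul, add_neg_cancel] at h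
  linear_combination h.eq_zero

theorem finitePart_eq {S : ℕ → ℂ} {c : ℂ} (h : HasFinitePart S c) : finitePart S = c := by
  have : ∃ c, HasFinitePart S c := ⟨c, h⟩
  rw [finitePart, dif_pos this]
  exact this.choose_spec.unique h

end FinitePart

section Asymptotics

open Filter

variable {z₀ : ℂ} {F G : ℂ → ℕ → ℂ} {r s : ℝ}

/-- `F z n = O(n ^ r)`, uniformly for `z` near `z₀` up to a power of `z - z₀`. -/
def ErrAt (z₀ : ℂ) (r : ℝ) (F : ℂ → ℕ → ℂ) : Prop :=
  ∃ (m : ℕ) (K : ℝ), 0 ≤ K ∧ ∀ᶠ z in 𝓝[≠] z₀, ∀ n : ℕ, 1 ≤ n →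
    ‖(z - z₀) ^ m * F z n‖ ≤ K * (n : ℝ) ^ r

/-- The functions `F · n`, `n ≥ 1`, are analytic in a common punctured neighbourhood of `z₀`. -/
def HolAt (z₀ : ℂ) (F : ℂ → ℕ → ℂ) : Prop :=
  ∀ᶠ z in 𝓝[≠] z₀, ∀ n : ℕ, 1 ≤ n → AnalyticAt ℂ (fun w => F w n) z

/-- The family of sequences `d(z) n^{β(z)} (log n)^l`. -/
def powTerm (d β : ℂ → ℂ) (l : ℕ) (z : ℂ) (n : ℕ) : ℂ :=
  d z * (n : ℂ) ^ β z * (Real.log n : ℂ) ^ l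

/-- Finite sums of families `d(z) n^{β(z)} (log n)^l` with `T (β'(z₀))`. -/
def mainTerms (T : ℂ → Prop) (z₀ : ℂ) : AddSubmonoid (ℂ → ℕ → ℂ) :=
  AddSubmonoid.closure {F | ∃ (d β : ℂ → ℂ) (l : ℕ), MeromorphicAt d z₀ ∧ AnalyticAt ℂ β z₀ ∧
    T (deriv β z₀) ∧ F = powTerm d β l}

/-- Families of constant sequences. -/
def constTerms (z₀ : ℂ) : AddSubmonoid (ℂ → ℕ → ℂ) where
  carrier := {F | ∃ d : ℂ → ℂ, MeromorphicAt d z₀ ∧ F = fun z _ => d z}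
  zero_mem' := ⟨0, MeromorphicAt.const 0 z₀, rfl⟩
  add_mem' := by
    rintro _ _ ⟨d, hd, rfl⟩ ⟨e, he, rfl⟩
    exact ⟨d + e, hd.add he, rfl⟩

/-- The family `F` has asymptotic expansions, up to any order, with main parts in `P`. -/
def HasExpansion (P : AddSubmonoid (ℂ → ℕ → ℂ)) (z₀ : ℂ) (F : ℂ → ℕ → ℂ) : Prop :=
  HolAt z₀ F ∧ ∀ r : ℝ, ∃ G ∈ P, ErrAt z₀ r (F - G)

theorem eventually_norm_sub_le_one (z₀ : ℂ) : ∀ᶠ z in 𝓝[≠] z₀, ‖z - z₀‖ ≤ 1 := by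
  refine eventually_nhdsWithin_of_eventually_nhds ?_
  filter_upwards [Metric.closedBall_mem_nhds z₀ one_pos] with z hz
  simpa [dist_eq_norm] using hz

theorem ErrAt.congr (h : ErrAt z₀ r F) (hFG : ∀ᶠ z in 𝓝[≠] z₀, ∀ n, 1 ≤ n → F z n = G z n) :
    ErrAt z₀ r G := by
  obtain ⟨m, K, hK, h⟩ := h
  refine ⟨m, K, hK, ?_⟩
  filter_upwards [h, hFG] with z h1 h2 n hn
  rw [← h2 n hn]
  exact h1 n hn

theorem ErrAt.mono (h : ErrAt z₀ r F) (hrs : r ≤ s) : ErrAt z₀ s F := by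
  obtain ⟨m, K, hK, h⟩ := h
  refine ⟨m, K, hK, ?_⟩
  filter_upwards [h] with z h1 n hn
  refine (h1 n hn).trans (mul_le_mul_of_nonneg_left ?_ hK)
  exact Real.rpow_le_rpow_of_exponent_le (by exact_mod_cast hn) hrs

theorem ErrAt.add (hF : ErrAt z₀ r F) (hG : ErrAt z₀ r G) : ErrAt z₀ r (F + G) := by
  obtain ⟨m, K, hK, h⟩ := hF
  obtain ⟨m', K', hK', h'⟩ := hG
  refine ⟨m + m', K + K', add_nonneg hK hK', ?_⟩
  filter_upwards [h, h', eventually_norm_sub_le_one z₀] with z h1 h2 h3 n hn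
  have e : (z - z₀) ^ (m + m') * (F + G) z n =
      (z - z₀) ^ m' * ((z - z₀) ^ m * F z n) + (z - z₀) ^ m * ((z - z₀) ^ m' * G z n) := by
    simp only [Pi.add_apply]; ring
  rw [e, add_mul]
  refine (norm_add_le _ _).trans (add_le_add ?_ ?_)
  · rw [norm_mul, norm_pow]
    exact (mul_le_of_le_one_left (norm_nonneg _) (pow_le_one₀ (norm_nonneg _) h3)).trans (h1 n hn)
  · rw [norm_mul, norm_pow]
    exact (mul_le_of_le_one_left (norm_nonneg _) (pow_le_one₀ (norm_nonneg _) h3)).trans (h2 n hn)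

theorem ErrAt.mul (hF : ErrAt z₀ r F) (hG : ErrAt z₀ s G) : ErrAt z₀ (r + s) (F * G) := by
  obtain ⟨m, K, hK, h⟩ := hF
  obtain ⟨m', K', hK', h'⟩ := hG
  refine ⟨m + m', K * K', mul_nonneg hK hK', ?_⟩
  filter_upwards [h, h'] with z h1 h2 n hn
  have e : (z - z₀) ^ (m + m') * (F * G) z n =
      ((z - z₀) ^ m * F z n) * ((z - z₀) ^ m' * G z n) := by
    simp only [Pi.mul_apply]; ring
  rw [e, norm_mul, Real.rpow_add (by exact_mod_cast hn), mul_mul_mul_comm]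
  exact mul_le_mul (h1 n hn) (h2 n hn) (norm_nonneg _) (by positivity)

theorem ErrAt.zero : ErrAt z₀ r 0 := ⟨0, 0, le_rfl, Eventually.of_forall fun z n _ => by simp⟩

theorem MeromorphicAt.exists_bound {d : ℂ → ℂ} (hd : MeromorphicAt d z₀) :
    ∃ (m : ℕ) (K : ℝ), 0 ≤ K ∧ ∀ᶠ z in 𝓝[≠] z₀, ‖(z - z₀) ^ m * d z‖ ≤ K := by
  obtain ⟨m, hm⟩ := hd
  refine ⟨m, ‖(z₀ - z₀) ^ m • d z₀‖ + 1, by positivity, eventually_nhdsWithin_of_eventually_nhds ?_⟩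
  filter_upwards [hm.continuousAt.norm.eventually (eventually_lt_nhds (lt_add_one _))] with z hz
  exact hz.le

theorem ErrAt.const {d : ℂ → ℂ} (hd : MeromorphicAt d z₀) : ErrAt z₀ 0 (fun z _ => d z) := by
  obtain ⟨m, K, hK, h⟩ := MeromorphicAt.exists_bound hd
  exact ⟨m, K, hK, h.mono fun _ hz _ _ => by simpa using hz⟩

theorem ErrAt.const_mul {d : ℂ → ℂ} (hd : MeromorphicAt d z₀) (hF : ErrAt z₀ r F) :
    ErrAt z₀ r (fun z n => d z * F z n) := by
  have := (ErrAt.const hd).mul hF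
  rwa [zero_add] at this

theorem log_pow_le (l : ℕ) {δ : ℝ} (hδ : 0 < δ) : ∃ K : ℝ, 0 ≤ K ∧ ∀ x : ℝ, 1 ≤ x →
    Real.log x ^ l ≤ K * x ^ δ := by
  set ε : ℝ := δ / (l + 1)
  have hε : 0 < ε := by positivity
  refine ⟨(ε ^ l)⁻¹, by positivity, fun x hx => ?_⟩
  calc Real.log x ^ l ≤ (x ^ ε / ε) ^ l :=
        pow_le_pow_left₀ (Real.log_nonneg hx) (Real.log_le_rpow_div (by linarith) hε) l
    _ = (ε ^ l)⁻¹ * x ^ (ε * l) := by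
        rw [div_pow, ← Real.rpow_natCast (x ^ ε), ← Real.rpow_mul (by linarith)]; ring
    _ ≤ (ε ^ l)⁻¹ * x ^ δ := by
        refine mul_le_mul_of_nonneg_left (Real.rpow_le_rpow_of_exponent_le hx ?_) (by positivity)
        rw [div_mul_eq_mul_div, div_le_iff₀ (by positivity)]
        nlinarith

theorem exists_bound_cpow_log {β : ℂ → ℂ} (hβ : ContinuousAt β z₀) (hs : (β z₀).re < s) (l : ℕ) :
    ∃ K : ℝ, 0 ≤ K ∧ ∀ᶠ z in 𝓝 z₀, ∀ x : ℝ, 1 ≤ x →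
      ‖(x : ℂ) ^ β z * (Real.log x : ℂ) ^ l‖ ≤ K * x ^ s := by
  obtain ⟨t, h1, h2⟩ := exists_between hs
  obtain ⟨K, hK, h⟩ := log_pow_le l (sub_pos.2 h2)
  refine ⟨K, hK, ?_⟩
  filter_upwards [(Complex.continuous_re.continuousAt.comp hβ).eventually (eventually_lt_nhds h1)]
    with z hz x hx
  have hx0 : 0 < x := by linarith
  rw [norm_mul, norm_pow, Complex.norm_cpow_eq_rpow_re_of_pos hx0, Complex.norm_real,
    Real.norm_of_nonneg (Real.log_nonneg hx)]
  calc x ^ (β z).re * Real.log x ^ l ≤ x ^ t * (K * x ^ (s - t)) :=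
        mul_le_mul (Real.rpow_le_rpow_of_exponent_le hx hz.le) (h x hx)
          (pow_nonneg (Real.log_nonneg hx) l) (by positivity)
    _ = K * x ^ s := by
        rw [mul_left_comm, ← Real.rpow_add hx0, add_sub_cancel]

theorem ErrAt.powTerm {d β : ℂ → ℂ} (hd : MeromorphicAt d z₀) (hβ : ContinuousAt β z₀)
    (hs : (β z₀).re < s) (l : ℕ) : ErrAt z₀ s (powTerm d β l) := by
  obtain ⟨K, hK, h⟩ := exists_bound_cpow_log hβ hs l
  have h1 : ErrAt z₀ s (fun z n => (n : ℂ) ^ β z * (Real.log n : ℂ) ^ l) :=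
    ⟨0, K, hK, eventually_nhdsWithin_of_eventually_nhds (h.mono fun z hz n hn => by
      simpa using hz n (by exact_mod_cast hn))⟩
  refine (h1.const_mul hd).congr (Eventually.of_forall fun _ _ _ => ?_)
  simp only [NestedSums.powTerm, mul_assoc]

theorem HolAt.add (hF : HolAt z₀ F) (hG : HolAt z₀ G) : HolAt z₀ (F + G) := by
  filter_upwards [hF, hG] with z h1 h2 n hn using (h1 n hn).add (h2 n hn)

theorem HolAt.mul (hF : HolAt z₀ F) (hG : HolAt z₀ G) : HolAt z₀ (F * G) := by
  filter_upwards [hF, hG] with z h1 h2 n hn using (h1 n hn).mul (h2 n hn)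

theorem HolAt.sub (hF : HolAt z₀ F) (hG : HolAt z₀ G) : HolAt z₀ (F - G) := by
  filter_upwards [hF, hG] with z h1 h2 n hn using (h1 n hn).sub (h2 n hn)

theorem HolAt.const {d : ℂ → ℂ} (hd : MeromorphicAt d z₀) : HolAt z₀ (fun z _ => d z) :=
  hd.eventually_analyticAt.mono fun _ hz _ _ => hz

theorem HolAt.zero : HolAt z₀ 0 := Eventually.of_forall fun _ _ _ => analyticAt_const

theorem HolAt.congr (h : HolAt z₀ F) (hFG : ∀ᶠ z in 𝓝[≠] z₀, ∀ n, 1 ≤ n → F z n = G z n) :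
    HolAt z₀ G := by
  filter_upwards [h, eventually_eventually_nhdsWithin.2 hFG, self_mem_nhdsWithin]
    with z h1 h2 hz n hn
  rw [(isOpen_compl_singleton).nhdsWithin_eq hz] at h2
  exact (h1 n hn).congr (h2.mono fun w hw => hw n hn)

theorem HolAt.powTerm {d β : ℂ → ℂ} (hd : MeromorphicAt d z₀) (hβ : AnalyticAt ℂ β z₀) (l : ℕ) :
    HolAt z₀ (powTerm d β l) := by
  filter_upwards [hd.eventually_analyticAt,
    eventually_nhdsWithin_of_eventually_nhds hβ.eventually_analyticAt] with z h1 h2 n hn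
  refine (h1.mul ?_).mul analyticAt_const
  have : AnalyticAt ℂ (fun w => Complex.exp (Complex.log n * β w)) z :=
    (analyticAt_const.mul h2).cexp
  refine this.congr (Eventually.of_forall fun w => ?_)
  exact (Complex.cpow_def_of_ne_zero (by exact_mod_cast Nat.one_le_iff_ne_zero.1 hn) _).symm

variable {T : ℂ → Prop}

theorem powTerm_mem {d β : ℂ → ℂ} (hd : MeromorphicAt d z₀) (hβ : AnalyticAt ℂ β z₀)
    (hT : T (deriv β z₀)) (l : ℕ) : powTerm d β l ∈ mainTerms T z₀ :=
  AddSubmonoid.subset_closure ⟨d, β, l, hd, hβ, hT, rfl⟩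

theorem exists_errAt_of_mem_mainTerms (h : F ∈ mainTerms T z₀) : ∃ s, ErrAt z₀ s F := by
  induction h using AddSubmonoid.closure_induction with
  | mem F h =>
    obtain ⟨d, β, l, hd, hβ, -, rfl⟩ := h
    exact ⟨_, ErrAt.powTerm hd hβ.continuousAt (lt_add_one _) l⟩
  | zero => exact ⟨0, ErrAt.zero⟩
  | add F G _ _ hF hG =>
    obtain ⟨s, hs⟩ := hF
    obtain ⟨t, ht⟩ := hG
    exact ⟨max s t, (hs.mono (le_max_left _ _)).add (ht.mono (le_max_right _ _))⟩

theorem holAt_of_mem_mainTerms (h : F ∈ mainTerms T z₀) : HolAt z₀ F := by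
  induction h using AddSubmonoid.closure_induction with
  | mem F h =>
    obtain ⟨d, β, l, hd, hβ, -, rfl⟩ := h
    exact HolAt.powTerm hd hβ l
  | zero => exact HolAt.zero
  | add F G _ _ hF hG => exact hF.add hG

theorem const_mul_mem_mainTerms {d : ℂ → ℂ} (hd : MeromorphicAt d z₀) (h : F ∈ mainTerms T z₀) :
    (fun z n => d z * F z n) ∈ mainTerms T z₀ := by
  induction h using AddSubmonoid.closure_induction with
  | mem F h =>
    obtain ⟨e, β, l, he, hβ, hT, rfl⟩ := h
    have : (fun z n => d z * powTerm e β l z n) = powTerm (d * e) β l := by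
      funext z n; simp only [powTerm, Pi.mul_apply, mul_assoc]
    rw [this]
    exact powTerm_mem (hd.mul he) hβ hT l
  | zero =>
    convert AddSubmonoid.zero_mem _ using 1
    funext z n; simp
  | add F G _ _ hF hG =>
    convert AddSubmonoid.add_mem _ hF hG using 1
    funext z n; simp [mul_add]

end Asymptotics

section Asymptotics

open Filter

variable {z₀ : ℂ} {F G : ℂ → ℕ → ℂ} {r s : ℝ} {T : ℂ → Prop}

theorem exists_mul_mem_mainTerms (hT : ∀ a b, T a → T b → T (a + b))
    (hF : F ∈ mainTerms T z₀) (hG : G ∈ mainTerms T z₀) :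
    ∃ H ∈ mainTerms T z₀, ∀ z, ∀ n, 1 ≤ n → (F * G) z n = H z n := by
  induction hF using AddSubmonoid.closure_induction with
  | mem F h =>
    obtain ⟨d, β, l, hd, hβ, hTβ, rfl⟩ := h
    induction hG using AddSubmonoid.closure_induction with
    | mem G h =>
      obtain ⟨e, γ, k, he, hγ, hTγ, rfl⟩ := h
      refine ⟨powTerm (d * e) (β + γ) (l + k), powTerm_mem (hd.mul he) (hβ.add hγ) ?_ _,
        fun z n hn => ?_⟩
      · rw [deriv_add hβ.differentiableAt hγ.differentiableAt]
        exact hT _ _ hTβ hTγ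
      · simp only [powTerm, Pi.mul_apply, Pi.add_apply]
        rw [Complex.cpow_add _ _ (by exact_mod_cast Nat.one_le_iff_ne_zero.1 hn)]
        ring
    | zero => exact ⟨0, AddSubmonoid.zero_mem _, fun z n _ => by simp⟩
    | add G G' _ _ hG hG' =>
      obtain ⟨H, hH, h⟩ := hG
      obtain ⟨H', hH', h'⟩ := hG'
      refine ⟨H + H', AddSubmonoid.add_mem _ hH hH', fun z n hn => ?_⟩
      rw [mul_add, Pi.add_apply, Pi.add_apply, h z n hn, h' z n hn, Pi.add_apply, Pi.add_apply]
  | zero => exact ⟨0, AddSubmonoid.zero_mem _, fun z n _ => by simp⟩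
  | add F F' _ _ hF hF' =>
    obtain ⟨H, hH, h⟩ := hF
    obtain ⟨H', hH', h'⟩ := hF'
    refine ⟨H + H', AddSubmonoid.add_mem _ hH hH', fun z n hn => ?_⟩
    rw [add_mul, Pi.add_apply, Pi.add_apply, h z n hn, h' z n hn, Pi.add_apply, Pi.add_apply]

/-- Finite sums of constants and families `d(z) n^{β(z)} (log n)^l` with `T (β'(z₀))`. -/
def fullTerms (T : ℂ → Prop) (z₀ : ℂ) : AddSubmonoid (ℂ → ℕ → ℂ) :=
  mainTerms T z₀ ⊔ constTerms z₀

theorem mem_fullTerms : F ∈ fullTerms T z₀ ↔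
    ∃ G ∈ mainTerms T z₀, ∃ d : ℂ → ℂ, MeromorphicAt d z₀ ∧ F = G + fun z _ => d z := by
  rw [fullTerms, AddSubmonoid.mem_sup]
  constructor
  · rintro ⟨G, hG, _, ⟨d, hd, rfl⟩, rfl⟩
    exact ⟨G, hG, d, hd, rfl⟩
  · rintro ⟨G, hG, d, hd, rfl⟩
    exact ⟨G, hG, _, ⟨d, hd, rfl⟩, rfl⟩

theorem mainTerms_le_fullTerms : mainTerms T z₀ ≤ fullTerms T z₀ := le_sup_left

theorem const_mem_fullTerms {d : ℂ → ℂ} (hd : MeromorphicAt d z₀) :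
    (fun z _ => d z) ∈ fullTerms T z₀ :=
  (le_sup_right : constTerms z₀ ≤ _) ⟨d, hd, rfl⟩

theorem exists_errAt_of_mem_fullTerms (h : F ∈ fullTerms T z₀) : ∃ s, ErrAt z₀ s F := by
  obtain ⟨G, hG, d, hd, rfl⟩ := mem_fullTerms.1 h
  obtain ⟨s, hs⟩ := exists_errAt_of_mem_mainTerms hG
  exact ⟨max s 0, (hs.mono (le_max_left _ _)).add ((ErrAt.const hd).mono (le_max_right _ _))⟩

theorem const_mul_mem_fullTerms {d : ℂ → ℂ} (hd : MeromorphicAt d z₀) (h : F ∈ fullTerms T z₀) :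
    (fun z n => d z * F z n) ∈ fullTerms T z₀ := by
  obtain ⟨G, hG, e, he, rfl⟩ := mem_fullTerms.1 h
  refine mem_fullTerms.2 ⟨_, const_mul_mem_mainTerms hd hG, d * e, hd.mul he, ?_⟩
  funext z n
  simp [mul_add]

theorem exists_mul_mem_fullTerms (hT : ∀ a b, T a → T b → T (a + b))
    (hF : F ∈ mainTerms T z₀) (hG : G ∈ fullTerms T z₀) :
    ∃ H ∈ mainTerms T z₀, ∀ z, ∀ n, 1 ≤ n → (F * G) z n = H z n := by
  obtain ⟨G, hG', e, he, rfl⟩ := mem_fullTerms.1 hG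
  obtain ⟨H, hH, h⟩ := exists_mul_mem_mainTerms hT hF hG'
  refine ⟨_, AddSubmonoid.add_mem _ hH (const_mul_mem_mainTerms he hF), fun z n hn => ?_⟩
  rw [mul_add, Pi.add_apply, Pi.add_apply, h z n hn]
  simp [mul_comm]

theorem HasExpansion.congr {P : AddSubmonoid (ℂ → ℕ → ℂ)} (h : HasExpansion P z₀ F)
    (hFG : ∀ᶠ z in 𝓝[≠] z₀, ∀ n, 1 ≤ n → F z n = G z n) : HasExpansion P z₀ G := by
  refine ⟨h.1.congr hFG, fun r => ?_⟩
  obtain ⟨H, hH, e⟩ := h.2 r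
  refine ⟨H, hH, e.congr (hFG.mono fun z hz n hn => ?_)⟩
  simp only [Pi.sub_apply, hz n hn]

theorem HasExpansion.add {P : AddSubmonoid (ℂ → ℕ → ℂ)} (hF : HasExpansion P z₀ F)
    (hG : HasExpansion P z₀ G) : HasExpansion P z₀ (F + G) := by
  refine ⟨hF.1.add hG.1, fun r => ?_⟩
  obtain ⟨H, hH, e⟩ := hF.2 r
  obtain ⟨H', hH', e'⟩ := hG.2 r
  refine ⟨_, AddSubmonoid.add_mem _ hH hH', ?_⟩
  rw [add_sub_add_comm]
  exact e.add e'

theorem HasExpansion.mono {P Q : AddSubmonoid (ℂ → ℕ → ℂ)} (hPQ : P ≤ Q)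
    (hF : HasExpansion P z₀ F) : HasExpansion Q z₀ F :=
  ⟨hF.1, fun r => let ⟨H, hH, e⟩ := hF.2 r; ⟨H, hPQ hH, e⟩⟩

theorem HasExpansion.exists_errAt (hF : HasExpansion (fullTerms T z₀) z₀ F) :
    ∃ s, ErrAt z₀ s F := by
  obtain ⟨H, hH, e⟩ := hF.2 0
  obtain ⟨s, hs⟩ := exists_errAt_of_mem_fullTerms hH
  refine ⟨max 0 s, ?_⟩
  rw [← sub_add_cancel F H]
  exact (e.mono (le_max_left _ _)).add (hs.mono (le_max_right _ _))

/-- Approximations of two families up to any order give approximations of their product. -/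
theorem exists_mul_approx (hF : HasExpansion (fullTerms T z₀) z₀ F) {Q : AddSubmonoid (ℂ → ℕ → ℂ)}
    (hQ : Q ≤ fullTerms T z₀) (hG : HasExpansion Q z₀ G) {P : AddSubmonoid (ℂ → ℕ → ℂ)}
    (hF' : HasExpansion P z₀ F) (r : ℝ) :
    ∃ H ∈ P, ∃ H' ∈ Q, ErrAt z₀ r (F - H) ∧ ErrAt z₀ r (G - H') ∧
      ErrAt z₀ r (F * G - H * H') := by
  obtain ⟨s, hs⟩ := hF.exists_errAt
  obtain ⟨H', hH', e'⟩ := hG.2 (min r (r - s))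
  obtain ⟨t, ht⟩ := exists_errAt_of_mem_fullTerms (hQ hH')
  obtain ⟨H, hH, e⟩ := hF'.2 (min r (r - t))
  refine ⟨H, hH, H', hH', e.mono (min_le_left _ _), e'.mono (min_le_left _ _), ?_⟩
  have h1 : F * G - H * H' = F * (G - H') + (F - H) * H' := by ring
  rw [h1]
  refine ErrAt.add ?_ ?_
  · have := hs.mul (e'.mono (min_le_right _ _))
    rwa [add_sub_cancel] at this
  · have := (e.mono (min_le_right _ _)).mul ht
    rwa [sub_add_cancel] at this

theorem HasExpansion.mul (hT : ∀ a b, T a → T b → T (a + b))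
    (hF : HasExpansion (mainTerms T z₀) z₀ F) (hG : HasExpansion (fullTerms T z₀) z₀ G) :
    HasExpansion (mainTerms T z₀) z₀ (F * G) := by
  refine ⟨hF.1.mul hG.1, fun r => ?_⟩
  obtain ⟨H, hH, H', hH', -, -, e⟩ :=
    exists_mul_approx (hF.mono mainTerms_le_fullTerms) le_rfl hG hF r
  obtain ⟨M, hM, h⟩ := exists_mul_mem_fullTerms hT hH hH'
  refine ⟨M, hM, e.congr (Eventually.of_forall fun z n hn => ?_)⟩
  simp only [Pi.sub_apply, h z n hn]

/-- The partial sums of a family of sequences. -/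
def partialSum (F : ℂ → ℕ → ℂ) (z : ℂ) (N : ℕ) : ℂ := ∑ n ∈ Finset.Icc 1 N, F z n

theorem partialSum_add : partialSum (F + G) = partialSum F + partialSum G := by
  funext z N; simp [partialSum, Finset.sum_add_distrib]

theorem partialSum_zero : partialSum 0 = 0 := by
  funext z N; simp [partialSum]

theorem partialSum_const_mul (d : ℂ → ℂ) :
    partialSum (fun z n => d z * F z n) = fun z n => d z * partialSum F z n := by
  funext z N; simp [partialSum, Finset.mul_sum]

theorem HolAt.partialSum (hF : HolAt z₀ F) : HolAt z₀ (partialSum F) := by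
  filter_upwards [hF] with z hz N _
  exact Finset.analyticAt_fun_sum _ fun n hn => hz n (Finset.mem_Icc.1 hn).1

/-- The partial sums of `F` have an asymptotic expansion up to `O(N^r)`. -/
def SumExpansion (T : ℂ → Prop) (z₀ : ℂ) (r : ℝ) (F : ℂ → ℕ → ℂ) : Prop :=
  ∃ H ∈ fullTerms T z₀, ErrAt z₀ r (partialSum F - H)

theorem SumExpansion.add (hF : SumExpansion T z₀ r F) (hG : SumExpansion T z₀ r G) :
    SumExpansion T z₀ r (F + G) := by
  obtain ⟨H, hH, e⟩ := hF
  obtain ⟨H', hH', e'⟩ := hG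
  refine ⟨_, AddSubmonoid.add_mem _ hH hH', ?_⟩
  rw [partialSum_add, add_sub_add_comm]
  exact e.add e'

theorem SumExpansion.zero : SumExpansion T z₀ r 0 :=
  ⟨0, AddSubmonoid.zero_mem _, by rw [partialSum_zero, sub_zero]; exact ErrAt.zero⟩

theorem SumExpansion.const_mul {d : ℂ → ℂ} (hd : MeromorphicAt d z₀)
    (hF : SumExpansion T z₀ r F) : SumExpansion T z₀ r (fun z n => d z * F z n) := by
  obtain ⟨H, hH, e⟩ := hF
  refine ⟨_, const_mul_mem_fullTerms hd hH, ?_⟩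
  rw [partialSum_const_mul]
  convert e.const_mul hd using 1
  funext z n
  simp [mul_sub]

theorem SumExpansion.sum {ι : Type*} {t : Finset ι} {F : ι → ℂ → ℕ → ℂ}
    (h : ∀ i ∈ t, SumExpansion T z₀ r (F i)) : SumExpansion T z₀ r (∑ i ∈ t, F i) :=
  Finset.sum_induction _ (SumExpansion T z₀ r) (fun _ _ => SumExpansion.add) SumExpansion.zero h

theorem SumExpansion.congr (hF : SumExpansion T z₀ r F)
    (hFG : ∀ᶠ z in 𝓝[≠] z₀, ∀ n, 1 ≤ n → F z n = G z n) : SumExpansion T z₀ r G := by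
  obtain ⟨H, hH, e⟩ := hF
  refine ⟨H, hH, e.congr (hFG.mono fun z hz n _ => ?_)⟩
  simp only [Pi.sub_apply, partialSum]
  rw [Finset.sum_congr rfl fun k hk => hz k (Finset.mem_Icc.1 hk).1]

theorem meromorphicAt_of_bounded {g : ℂ → ℂ} (h : ∀ᶠ z in 𝓝[≠] z₀, DifferentiableAt ℂ g z)
    {K : ℝ} (hb : ∀ᶠ z in 𝓝[≠] z₀, ‖g z‖ ≤ K) : MeromorphicAt g z₀ := by
  refine ⟨1, Complex.analyticAt_of_differentiable_on_punctured_nhds_of_continuousAt ?_ ?_⟩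
  · filter_upwards [h] with z hz
    exact ((differentiableAt_id.sub_const z₀).pow 1).smul hz
  · rw [continuousAt_iff_punctured_nhds]
    have h1 : Tendsto (fun z => ‖z - z₀‖ * K) (𝓝[≠] z₀) (𝓝 0) := by
      have : ContinuousAt (fun z : ℂ => ‖z - z₀‖ * K) z₀ := by fun_prop
      simpa [ContinuousAt] using this.tendsto.mono_left nhdsWithin_le_nhds
    simp only [sub_self, pow_one, zero_smul]
    refine squeeze_zero_norm' ?_ h1
    filter_upwards [hb] with z hz
    rw [norm_smul]
    exact mul_le_mul_of_nonneg_left hz (norm_nonneg _)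

/-- Summation of rapidly decreasing families. -/
theorem SumExpansion.of_errAt (hF : HolAt z₀ F) (hs : ErrAt z₀ s F) (hs2 : s ≤ -2)
    (hr : s + 2 ≤ r) : SumExpansion T z₀ r F := by
  obtain ⟨m, K, hK, hb⟩ := hs
  set f : ℕ → ℂ → ℂ := fun n z => (z - z₀) ^ m * F z (n + 1) with hf
  have hsum : Summable fun n : ℕ => K * ((n + 1 : ℕ) : ℝ) ^ (-2 : ℝ) :=
    ((summable_nat_add_iff 1).2 (Real.summable_nat_rpow.2 (by norm_num))).mul_left K
  set σ := ∑' n : ℕ, K * ((n + 1 : ℕ) : ℝ) ^ (-2 : ℝ)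
  have hbound : ∀ᶠ z in 𝓝[≠] z₀, ∀ n, ‖f n z‖ ≤ K * ((n + 1 : ℕ) : ℝ) ^ (-2 : ℝ) := by
    filter_upwards [hb] with z hz n
    refine (hz (n + 1) (by omega)).trans (mul_le_mul_of_nonneg_left ?_ hK)
    exact Real.rpow_le_rpow_of_exponent_le (by simp) hs2
  set g : ℂ → ℂ := fun z => ∑' n, f n z
  have hgd : ∀ᶠ z in 𝓝[≠] z₀, DifferentiableAt ℂ g z := by
    filter_upwards [eventually_eventually_nhdsWithin.2 (hF.and hbound), self_mem_nhdsWithin]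
      with z hz hne
    rw [(isOpen_compl_singleton).nhdsWithin_eq hne] at hz
    obtain ⟨U, hU, hUo, hzU⟩ := eventually_nhds_iff.1 hz
    refine (Complex.differentiableOn_tsum_of_summable_norm hsum (fun n w hw => ?_) hUo
      fun n w hw => (hU w hw).2 n).differentiableAt (hUo.mem_nhds hzU)
    exact (((differentiableAt_id.sub_const z₀).pow m).mul
      ((hU w hw).1 (n + 1) (by omega)).differentiableAt).differentiableWithinAt
  have hg : MeromorphicAt g z₀ := by
    refine meromorphicAt_of_bounded hgd (K := σ) ?_
    filter_upwards [hbound] with z hz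
    exact tsum_of_norm_bounded hsum.hasSum hz
  have hpow : MeromorphicAt (fun z : ℂ => (z - z₀) ^ m) z₀ := by fun_prop
  refine ⟨_, const_mem_fullTerms (hpow.inv.mul hg), m, σ, ?_, ?_⟩
  · exact tsum_nonneg fun n => by positivity
  filter_upwards [hb, hbound, self_mem_nhdsWithin] with z hz hz2 hne N hN
  have hne' : (z - z₀) ^ m ≠ 0 := pow_ne_zero _ (sub_ne_zero.2 hne)
  have hN0 : (0 : ℝ) < N := by exact_mod_cast hN
  have hfs : Summable fun n => f n z := Summable.of_norm_bounded hsum hz2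
  have e1 : (z - z₀) ^ m * (partialSum F z N - ((z - z₀) ^ m)⁻¹ * g z) =
      - ∑' n, f (n + N) z := by
    have h1 := hfs.sum_add_tsum_nat_add N
    have h2 : ∑ n ∈ Finset.range N, f n z = (z - z₀) ^ m * partialSum F z N := by
      rw [partialSum, Finset.mul_sum, Finset.range_eq_Ico,
        Finset.sum_Ico_add' (fun n => (z - z₀) ^ m * F z n) 0 N 1]
      rfl
    rw [mul_sub, mul_inv_cancel_left₀ hne', ← h2]
    linear_combination h1
  have e2 : ‖∑' n, f (n + N) z‖ ≤ σ * (N : ℝ) ^ (s + 2) := by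
    refine tsum_of_norm_bounded (hsum.hasSum.mul_right _) fun n => ?_
    refine (hz (n + N + 1) (by omega)).trans ?_
    rw [mul_assoc]
    refine mul_le_mul_of_nonneg_left ?_ hK
    have hp : (0 : ℝ) < ((n + N + 1 : ℕ) : ℝ) := by positivity
    rw [show s = -2 + (s + 2) by ring, Real.rpow_add hp, show -2 + (s + 2) + 2 = s + 2 by ring]
    refine mul_le_mul ?_ ?_ (by positivity) (by positivity)
    · exact Real.rpow_le_rpow_of_nonpos (by positivity) (by push_cast; linarith) (by norm_num)
    · exact Real.rpow_le_rpow_of_nonpos hN0 (by push_cast; linarith) (by linarith)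
  show ‖(z - z₀) ^ m * (partialSum F z N - ((z - z₀) ^ m)⁻¹ * g z)‖ ≤ _
  rw [e1, norm_neg]
  refine e2.trans (mul_le_mul_of_nonneg_left ?_ (tsum_nonneg fun n => by positivity))
  exact Real.rpow_le_rpow_of_exponent_le (by exact_mod_cast hN) hr

end Asymptotics

section Taylor

open Filter Polynomial

/-- Taylor's formula on an interval of length one. -/
theorem norm_sub_taylor_le {a B : ℝ} (K : ℕ) : ∀ (g : ℕ → ℝ → ℂ),
    (∀ k, ∀ x ∈ Set.Icc a (a + 1), HasDerivAt (g k) (g (k + 1) x) x) →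
    (∀ x ∈ Set.Icc a (a + 1), ‖g (K + 1) x‖ ≤ B) →
    ∀ x ∈ Set.Icc a (a + 1), ‖g 0 x - ∑ k ∈ Finset.range (K + 1),
      g k a * ((x - a : ℝ) : ℂ) ^ k / (k.factorial : ℂ)‖ ≤ B := by
  induction K with
  | zero =>
    intro g hg hB x hx
    have h := norm_image_sub_le_of_norm_deriv_le_segment' (f := g 0) (f' := g 1) (C := B)
      (fun y hy => (hg 0 y hy).hasDerivWithinAt) (fun y hy => hB y (Set.Ico_subset_Icc_self hy)) x hx
    have hB0 : 0 ≤ B := (norm_nonneg _).trans (hB x hx)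
    simp only [zero_add, Finset.sum_range_one, pow_zero, mul_one, Nat.factorial_zero, Nat.cast_one,
      div_one]
    refine h.trans (mul_le_of_le_one_right hB0 ?_)
    linarith [hx.2]
  | succ K ih =>
    intro g hg hB x hx
    have ih' := ih (fun k => g (k + 1)) (fun k => hg (k + 1)) hB
    have hd : ∀ y ∈ Set.Icc a (a + 1), HasDerivWithinAt
        (fun x => g 0 x - ∑ k ∈ Finset.range (K + 1 + 1),
          g k a * ((x - a : ℝ) : ℂ) ^ k / (k.factorial : ℂ))
        (g 1 y - ∑ k ∈ Finset.range (K + 1),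
          g (k + 1) a * ((y - a : ℝ) : ℂ) ^ k / (k.factorial : ℂ)) (Set.Icc a (a + 1)) y := by
      intro y hy
      refine ((hg 0 y hy).sub ?_).hasDerivWithinAt
      simp only [Finset.sum_range_succ' _ (K + 1)]
      rw [← add_zero (∑ k ∈ Finset.range (K + 1), _)]
      refine HasDerivAt.add (HasDerivAt.fun_sum fun k _ => ?_) ?_
      · have h1 : HasDerivAt (fun x : ℝ => ((x - a : ℝ) : ℂ)) 1 y := by
          simpa using ((hasDerivAt_id y).sub_const a).ofReal_comp
        have h2 := ((h1.pow (k + 1)).const_mul (g (k + 1) a)).div_const ((k + 1).factorial : ℂ)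
        refine h2.congr_deriv ?_
        have e1 : (k.factorial : ℂ) ≠ 0 := by exact_mod_cast k.factorial_ne_zero
        have e2 : ((k : ℂ) + 1) ≠ 0 := by exact_mod_cast k.succ_ne_zero
        rw [Nat.factorial_succ]
        push_cast
        field_simp
      · simpa using hasDerivAt_const y (g 0 a)
    have h := norm_image_sub_le_of_norm_deriv_le_segment' (C := B) hd
      (fun y hy => ih' y (Set.Ico_subset_Icc_self hy)) x hx
    have hB0 : 0 ≤ B := (norm_nonneg _).trans (hB x hx)
    have h0 : g 0 a - ∑ k ∈ Finset.range (K + 1 + 1),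
        g k a * ((a - a : ℝ) : ℂ) ^ k / (k.factorial : ℂ) = 0 := by
      simp [Finset.sum_range_succ' _ (K + 1)]
    rw [h0, sub_zero] at h
    exact h.trans (mul_le_of_le_one_right hB0 (by linarith [hx.2]))

/-- The polynomials `P_k` such that the `k`-th derivative of `x^b (log x)^l` is
`x^{b-k} P_k(log x)`. -/
def logPoly (b : ℂ) (l : ℕ) : ℕ → ℂ[X]
  | 0 => X ^ l
  | k + 1 => C (b - k) * logPoly b l k + derivative (logPoly b l k)

theorem natDegree_logPoly_le (b : ℂ) (l k : ℕ) : (logPoly b l k).natDegree ≤ l := by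
  induction k with
  | zero => simp [logPoly]
  | succ k ih =>
    refine (natDegree_add_le _ _).trans (max_le ((natDegree_C_mul_le _ _).trans ih) ?_)
    exact (natDegree_derivative_le _).trans (by omega)

theorem analyticAt_coeff_logPoly {β : ℂ → ℂ} {z₀ : ℂ} (hβ : AnalyticAt ℂ β z₀) (l k i : ℕ) :
    AnalyticAt ℂ (fun z => (logPoly (β z) l k).coeff i) z₀ := by
  induction k generalizing i with
  | zero => exact analyticAt_const
  | succ k ih =>
    simp only [logPoly, coeff_add, coeff_C_mul, coeff_derivative]
    exact ((hβ.sub analyticAt_const).mul (ih i)).add ((ih (i + 1)).mul analyticAt_const)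

/-- The `k`-th derivative of `x^b (log x)^l`. -/
def powLogDeriv (b : ℂ) (l k : ℕ) (x : ℝ) : ℂ :=
  (x : ℂ) ^ (b - k) * (logPoly b l k).eval (Real.log x : ℂ)

theorem hasDerivAt_powLogDeriv (b : ℂ) (l k : ℕ) {x : ℝ} (hx : 0 < x) :
    HasDerivAt (powLogDeriv b l k) (powLogDeriv b l (k + 1) x) x := by
  have hx' : (x : ℂ) ≠ 0 := by exact_mod_cast hx.ne'
  have h1 : HasDerivAt (fun y : ℝ => (y : ℂ) ^ (b - k)) ((b - k) * (x : ℂ) ^ (b - k - 1)) x := by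
    have := (hasDerivAt_id (x : ℂ)).cpow_const (c := b - k) (Or.inl (by simpa using hx))
    simpa using this.comp_ofReal
  have h2 : HasDerivAt (fun y : ℝ => (Real.log y : ℂ)) ((x : ℂ)⁻¹) x := by
    simpa using (Real.hasDerivAt_log hx.ne').ofReal_comp
  have h3 : HasDerivAt (fun y : ℝ => (logPoly b l k).eval (Real.log y : ℂ))
      ((derivative (logPoly b l k)).eval (Real.log x : ℂ) * (x : ℂ)⁻¹) x :=
    HasDerivAt.comp x (h₂ := fun w => (logPoly b l k).eval w) ((logPoly b l k).hasDerivAt _) h2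
  refine (h1.mul h3).congr_deriv ?_
  have h4 : (x : ℂ) ^ (b - k) = x ^ (b - k - 1) * x := by
    nth_rw 3 [← Complex.cpow_one (x : ℂ)]
    rw [← Complex.cpow_add _ _ hx', sub_add_cancel]
  simp only [powLogDeriv, logPoly, eval_add, eval_mul, eval_C, h4]
  rw [show b - ((k + 1 : ℕ) : ℂ) = b - k - 1 by push_cast; ring]
  field_simp

theorem powLogDeriv_eq_sum (b : ℂ) (l k : ℕ) (x : ℝ) :
    powLogDeriv b l k x = ∑ i ∈ Finset.range (l + 1),
      (logPoly b l k).coeff i * ((x : ℂ) ^ (b - k) * (Real.log x : ℂ) ^ i) := by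
  rw [powLogDeriv, eval_eq_sum_range' (Nat.lt_succ_of_le (natDegree_logPoly_le b l k)),
    Finset.mul_sum]
  exact Finset.sum_congr rfl fun i _ => by ring

theorem exists_bound_powLogDeriv {β : ℂ → ℂ} {z₀ : ℂ} (hβ : AnalyticAt ℂ β z₀) (l k : ℕ) {s : ℝ}
    (hs : (β z₀).re - k < s) : ∃ K : ℝ, 0 ≤ K ∧ ∀ᶠ z in 𝓝 z₀, ∀ x : ℝ, 1 ≤ x →
      ‖powLogDeriv (β z) l k x‖ ≤ K * x ^ s := by
  have h1 : ∀ i, ∃ K : ℝ, 0 ≤ K ∧ ∀ᶠ z in 𝓝 z₀, ∀ x : ℝ, 1 ≤ x →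
      ‖(logPoly (β z) l k).coeff i * ((x : ℂ) ^ (β z - k) * (Real.log x : ℂ) ^ i)‖ ≤
        K * x ^ s := by
    intro i
    obtain ⟨K, hK, h⟩ := exists_bound_cpow_log (β := fun z => β z - k)
      (hβ.continuousAt.sub continuousAt_const) (s := s) (by simpa using hs) i
    have hc := (analyticAt_coeff_logPoly hβ l k i).continuousAt.norm.eventually
      (eventually_lt_nhds (lt_add_one _))
    refine ⟨(‖(logPoly (β z₀) l k).coeff i‖ + 1) * K, by positivity, ?_⟩
    filter_upwards [h, hc] with z h2 h3 x hx
    rw [norm_mul, mul_assoc]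
    exact mul_le_mul h3.le (h2 x hx) (norm_nonneg _) (by positivity)
  choose K hK h using h1
  refine ⟨∑ i ∈ Finset.range (l + 1), K i, Finset.sum_nonneg fun i _ => hK i, ?_⟩
  filter_upwards [(Finset.range (l + 1)).eventually_all.2 fun i _ => h i] with z hz x hx
  rw [powLogDeriv_eq_sum, Finset.sum_mul]
  exact norm_sum_le_of_le _ fun i hi => hz i hi x hx

end Taylor

section Summation

open Filter

variable {z₀ : ℂ} {F G : ℂ → ℕ → ℂ} {r s : ℝ} {T : ℂ → Prop}

/-- The family of sequences `n ↦ ∂_x^k (x^{β(z)} (log x)^l)|_{x = n}`. -/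
def powLogFamily (β : ℂ → ℂ) (l k : ℕ) (z : ℂ) (n : ℕ) : ℂ := powLogDeriv (β z) l k n

/-- The forward difference. -/
def fwdDiffFamily (F : ℂ → ℕ → ℂ) (z : ℂ) (n : ℕ) : ℂ := F z (n + 1) - F z n

theorem powLogFamily_eq_sum (β : ℂ → ℂ) (l k : ℕ) :
    powLogFamily β l k = ∑ i ∈ Finset.range (l + 1),
      powTerm (fun z => (logPoly (β z) l k).coeff i) (fun z => β z - k) i := by
  funext z n
  simp only [powLogFamily, powLogDeriv_eq_sum, Finset.sum_apply, powTerm, mul_assoc,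
    Complex.ofReal_natCast]

theorem powLogFamily_mem_mainTerms {β : ℂ → ℂ} (hβ : AnalyticAt ℂ β z₀) (hT : T (deriv β z₀))
    (l k : ℕ) : powLogFamily β l k ∈ mainTerms T z₀ := by
  rw [powLogFamily_eq_sum]
  refine AddSubmonoid.sum_mem _ fun i _ => powTerm_mem
    (analyticAt_coeff_logPoly hβ l k i).meromorphicAt (hβ.fun_sub analyticAt_const) ?_ i
  rwa [deriv_sub_const_fun]

theorem fwdDiff_powLogFamily {β : ℂ → ℂ} (hβ : AnalyticAt ℂ β z₀) (l : ℕ) {K : ℕ}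
    (hs : (β z₀).re - (K + 1) < s) (hs0 : s ≤ 0) :
    ErrAt z₀ s (fwdDiffFamily (powLogFamily β l 0) -
      ∑ k ∈ Finset.range K, fun z n => (((k + 1).factorial : ℂ))⁻¹ * powLogFamily β l (k + 1) z n) := by
  obtain ⟨C, hC, h⟩ := exists_bound_powLogDeriv hβ l (K + 1) (s := s) (by push_cast; exact hs)
  refine ⟨0, C, hC, eventually_nhdsWithin_of_eventually_nhds (h.mono fun z hz n hn => ?_)⟩
  have hn0 : (0 : ℝ) < n := by exact_mod_cast hn
  have ht := norm_sub_taylor_le (a := n) (B := C * (n : ℝ) ^ s) K (powLogDeriv (β z) l)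
    (fun k x hx => hasDerivAt_powLogDeriv _ _ _ (hn0.trans_le hx.1)) (fun x hx => ?_) (n + 1)
    (by simp)
  · rw [pow_zero, one_mul]
    refine le_trans (le_of_eq ?_) ht
    congr 1
    rw [Finset.sum_range_succ' _ K]
    simp only [Pi.sub_apply, fwdDiffFamily, powLogFamily, Finset.sum_apply, Nat.cast_add,
      Nat.cast_one, add_sub_cancel_left, Complex.ofReal_one, one_pow, mul_one, pow_zero,
      Nat.factorial_zero, div_one]
    rw [sub_sub, add_comm (powLogDeriv _ _ 0 _)]
    congr 2
    exact Finset.sum_congr rfl fun k _ => by rw [div_eq_inv_mul]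
  · refine (hz x ((by exact_mod_cast hn : (1 : ℝ) ≤ n).trans hx.1)).trans
      (mul_le_mul_of_nonneg_left (Real.rpow_le_rpow_of_nonpos hn0 hx.1 hs0) hC)

theorem partialSum_fwdDiff (z : ℂ) (N : ℕ) :
    partialSum (fwdDiffFamily F) z N = F z (N + 1) - F z 1 := by
  rw [partialSum]
  induction N with
  | zero => simp
  | succ N ih =>
    rw [Finset.sum_Icc_succ_top (Nat.le_add_left 1 N), ih, fwdDiffFamily]
    ring

theorem HolAt.powLogFamily {β : ℂ → ℂ} (hβ : AnalyticAt ℂ β z₀) (l k : ℕ) :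
    HolAt z₀ (powLogFamily β l k) :=
  holAt_of_mem_mainTerms (T := fun _ => True) (powLogFamily_mem_mainTerms hβ trivial l k)

theorem sumExpansion_fwdDiff {β : ℂ → ℂ} (hβ : AnalyticAt ℂ β z₀) (hT : T (deriv β z₀)) (l : ℕ)
    (hr : r ≤ 0) : SumExpansion T z₀ r (fwdDiffFamily (powLogFamily β l 0)) := by
  obtain ⟨K, hK⟩ := exists_nat_gt ((β z₀).re - r)
  have h := fwdDiff_powLogFamily hβ l (K := K) (s := r) (by linarith) hr
  have h1 : (fun z (_ : ℕ) => - powLogFamily β l 0 z 1) ∈ fullTerms T z₀ := by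
    refine const_mem_fullTerms (MeromorphicAt.const (-(logPoly 0 l 0).eval 0) z₀ |>.congr ?_)
    refine Eventually.of_forall fun z => ?_
    simp [powLogFamily, powLogDeriv, logPoly]
  refine ⟨(powLogFamily β l 0 + ∑ k ∈ Finset.range K,
    fun z n => (((k + 1).factorial : ℂ))⁻¹ * powLogFamily β l (k + 1) z n) +
      fun z _ => - powLogFamily β l 0 z 1, AddSubmonoid.add_mem _ (mainTerms_le_fullTerms
        (AddSubmonoid.add_mem _ (powLogFamily_mem_mainTerms hβ hT l 0)
          (AddSubmonoid.sum_mem _ fun k _ => const_mul_mem_mainTerms (MeromorphicAt.const _ z₀)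
            (powLogFamily_mem_mainTerms hβ hT l (k + 1))))) h1, ?_⟩
  refine h.congr (Eventually.of_forall fun z n _ => ?_)
  simp only [Pi.sub_apply, Pi.add_apply, partialSum_fwdDiff, fwdDiffFamily]
  ring

theorem powTerm_one_eq (β : ℂ → ℂ) (l k : ℕ) :
    powLogFamily β l k = ∑ i ∈ Finset.range (l + 1),
      fun z n => (logPoly (β z) l k).coeff i * powTerm 1 (fun z => β z - k) i z n := by
  rw [powLogFamily_eq_sum]
  refine Finset.sum_congr rfl fun i _ => ?_
  funext z n
  simp only [powTerm, Pi.one_apply, one_mul, mul_assoc]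

theorem sumExpansion_powTerm_one (r : ℝ) (j : ℕ) : ∀ β : ℂ → ℂ, AnalyticAt ℂ β z₀ →
    T (deriv β z₀) → (β z₀).re < min r 0 - 2 + j → ∀ l, SumExpansion T z₀ r (powTerm 1 β l) := by
  induction j with
  | zero =>
    intro β hβ hT hre l
    have hone : MeromorphicAt (1 : ℂ → ℂ) z₀ := MeromorphicAt.const 1 z₀
    refine SumExpansion.of_errAt (HolAt.powTerm hone hβ l)
      (ErrAt.powTerm hone hβ.continuousAt (by simpa using hre) l) ?_ ?_
    · linarith [min_le_right r 0]
    · linarith [min_le_left r 0]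
  | succ j ih =>
    intro β hβ hT hre
    set γ : ℂ → ℂ := fun z => β z + 1 with hγdef
    have hγ : AnalyticAt ℂ γ z₀ := hβ.add analyticAt_const
    have hTγ : T (deriv γ z₀) := by rwa [hγdef, deriv_add_const']
    have hfirst : ∀ l, SumExpansion T z₀ r (powLogFamily γ l 1) := by
      intro l
      obtain ⟨K, hK⟩ := exists_nat_gt ((γ z₀).re - (min r 0 - 2))
      have hd : SumExpansion T z₀ r (fwdDiffFamily (powLogFamily γ l 0)) := by
        obtain ⟨H, hH, e⟩ := sumExpansion_fwdDiff (r := min r 0) hγ hTγ l (min_le_right _ _)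
        exact ⟨H, hH, e.mono (min_le_left _ _)⟩
      have herr := fwdDiff_powLogFamily hγ l (K := K + 1) (s := min r 0 - 2)
        (by push_cast; linarith) (by linarith [min_le_right r 0])
      have hhigh : ∀ k, SumExpansion T z₀ r
          (fun z n => (((k + 1 + 1).factorial : ℂ))⁻¹ * powLogFamily γ l (k + 1 + 1) z n) := by
        intro k
        refine SumExpansion.const_mul (MeromorphicAt.const _ z₀) ?_
        rw [powTerm_one_eq]
        refine SumExpansion.sum fun i _ => SumExpansion.const_mul
          (analyticAt_coeff_logPoly hγ l _ i).meromorphicAt ?_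
        refine ih _ (hγ.fun_sub analyticAt_const) (by rwa [deriv_sub_const_fun]) ?_ i
        simp only [hγdef, Complex.sub_re, Complex.add_re, Complex.one_re, Complex.natCast_re]
        push_cast at hre ⊢
        have : (0 : ℝ) ≤ k := k.cast_nonneg
        linarith
      have hhol : HolAt z₀ (fwdDiffFamily (powLogFamily γ l 0) - ∑ k ∈ Finset.range (K + 1),
          fun z n => (((k + 1).factorial : ℂ))⁻¹ * powLogFamily γ l (k + 1) z n) := by
        refine HolAt.sub ?_ (holAt_of_mem_mainTerms (T := T) (AddSubmonoid.sum_mem _ fun k _ =>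
          const_mul_mem_mainTerms (MeromorphicAt.const _ z₀)
            (powLogFamily_mem_mainTerms hγ hTγ l (k + 1))))
        filter_upwards [HolAt.powLogFamily hγ l 0] with z hz n hn
        exact (hz (n + 1) (by omega)).sub (hz n hn)
      have hrest := SumExpansion.of_errAt (T := T) (r := r) hhol herr
        (by linarith [min_le_right r 0]) (by linarith [min_le_left r 0])
      have hneg : ∀ {F}, SumExpansion T z₀ r F → SumExpansion T z₀ r (-F) := fun {F} h => by
        refine (h.const_mul (MeromorphicAt.const (-1) z₀)).congr (Eventually.of_forall ?_)
        intro z n _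
        simp
      refine ((hd.add (hneg hrest)).add (hneg (SumExpansion.sum (t := Finset.range K)
        fun k _ => hhigh k))).congr (Eventually.of_forall fun z n _ => ?_)
      rw [Finset.sum_range_succ' _ K]
      simp only [Pi.add_apply, Pi.neg_apply, Pi.sub_apply, Finset.sum_apply, zero_add,
        Nat.factorial_one, Nat.cast_one, inv_one, one_mul]
      ring
    have hexp : ∀ l z n, powLogFamily γ (l + 1) 1 z n =
        γ z * powTerm 1 β (l + 1) z n + (l + 1) * powTerm 1 β l z n := by
      intro l z n
      have e : β z = γ z - ((1 : ℕ) : ℂ) := by simp [hγdef]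
      simp only [powLogFamily, powLogDeriv, logPoly, powTerm, e, Pi.one_apply]
      simp
      ring
    rcases hγ.eventually_eq_zero_or_eventually_ne_zero with h0 | h0
    · intro l
      have hl : ((l : ℂ) + 1) ≠ 0 := by exact_mod_cast l.succ_ne_zero
      refine ((hfirst (l + 1)).const_mul (MeromorphicAt.const (((l : ℂ) + 1)⁻¹) z₀)).congr ?_
      filter_upwards [eventually_nhdsWithin_of_eventually_nhds h0] with z hz n _
      rw [hexp, hz, zero_mul, zero_add, inv_mul_cancel_left₀ hl]
    · intro l
      induction l with
      | zero =>
        refine ((hfirst 0).const_mul hγ.meromorphicAt.inv).congr ?_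
        filter_upwards [h0] with z hz n _
        have e : β z = γ z - ((1 : ℕ) : ℂ) := by simp [hγdef]
        simp only [powLogFamily, powLogDeriv, logPoly, powTerm, e, Pi.one_apply, Pi.inv_apply]
        simp
        field_simp
      | succ l ihl =>
        have h1 := (hfirst (l + 1)).add (ihl.const_mul (MeromorphicAt.const (-((l : ℂ) + 1)) z₀))
        refine (h1.const_mul hγ.meromorphicAt.inv).congr ?_
        filter_upwards [h0] with z hz n _
        simp only [Pi.add_apply, hexp, Pi.inv_apply]
        field_simp
        ring

theorem sumExpansion_of_mem_mainTerms (hF : F ∈ mainTerms T z₀) : SumExpansion T z₀ r F := by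
  induction hF using AddSubmonoid.closure_induction with
  | mem F h =>
    obtain ⟨d, β, l, hd, hβ, hT, rfl⟩ := h
    obtain ⟨j, hj⟩ := exists_nat_gt ((β z₀).re - (min r 0 - 2))
    refine ((sumExpansion_powTerm_one r j β hβ hT (by linarith) l).const_mul hd).congr
      (Eventually.of_forall fun z n _ => ?_)
    simp only [powTerm, Pi.one_apply, one_mul, mul_assoc]
  | zero => exact SumExpansion.zero
  | add F G _ _ hF hG => exact hF.add hG

/-- The partial sums of a family with an asymptotic expansion have an asymptotic expansion. -/
theorem HasExpansion.partialSum (hF : HasExpansion (mainTerms T z₀) z₀ F) :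
    HasExpansion (fullTerms T z₀) z₀ (partialSum F) := by
  refine ⟨hF.1.partialSum, fun r => ?_⟩
  obtain ⟨G, hG, e⟩ := hF.2 (min r 0 - 2)
  have h := (SumExpansion.of_errAt (T := T) (r := r) (hF.1.sub (holAt_of_mem_mainTerms hG)) e
    (by linarith [min_le_right r 0]) (by linarith [min_le_left r 0])).add
      (sumExpansion_of_mem_mainTerms hG)
  rwa [sub_add_cancel] at h

end Summation

section Nested

open Filter

variable {z₀ : ℂ} {F G : ℂ → ℕ → ℂ} {r s : ℝ} {T : ℂ → Prop}

theorem HasExpansion.const_mul {P : AddSubmonoid (ℂ → ℕ → ℂ)} (c : ℂ)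
    (hP : ∀ G ∈ P, (fun z n => c * G z n) ∈ P) (hF : HasExpansion P z₀ F) :
    HasExpansion P z₀ (fun z n => c * F z n) := by
  refine ⟨(HolAt.const (MeromorphicAt.const c z₀)).mul hF.1, fun r => ?_⟩
  obtain ⟨H, hH, e⟩ := hF.2 r
  refine ⟨_, hP H hH, ?_⟩
  convert e.const_mul (MeromorphicAt.const c z₀) using 1
  funext z n
  simp [mul_sub]

theorem hasExpansion_const (c : ℂ) : HasExpansion (fullTerms T z₀) z₀ (fun _ _ => c) :=
  ⟨HolAt.const (MeromorphicAt.const c z₀), fun _ => ⟨_, const_mem_fullTerms (MeromorphicAt.const c z₀),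
    by rw [sub_self]; exact ErrAt.zero⟩⟩

/-- The values at the positive integers of the family of functions `f` have asymptotic
expansions without constant terms. -/
def LetterAt (T : ℂ → Prop) (z₀ : ℂ) (f : ℂ → ℝ → ℂ) : Prop :=
  HasExpansion (mainTerms T z₀) z₀ (fun z n => f z n)

theorem LetterAt.mul (hT : ∀ a b, T a → T b → T (a + b)) {f g : ℂ → ℝ → ℂ}
    (hf : LetterAt T z₀ f) (hg : LetterAt T z₀ g) : LetterAt T z₀ (fun z => f z * g z) :=
  HasExpansion.mul hT hf (hg.mono mainTerms_le_fullTerms)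

theorem LetterAt.smul (c : ℂ) {f : ℂ → ℝ → ℂ} (hf : LetterAt T z₀ f) :
    LetterAt T z₀ (fun z => c • f z) :=
  HasExpansion.const_mul c
    (fun _ hG => const_mul_mem_mainTerms (MeromorphicAt.const c z₀) hG) hf

theorem LetterAt.zero : LetterAt T z₀ 0 :=
  ⟨HolAt.zero, fun _ => ⟨0, AddSubmonoid.zero_mem _, by rw [sub_zero]; exact ErrAt.zero⟩⟩

theorem LetterAt.sum {ι : Type*} {t : Finset ι} {f : ι → ℂ → ℝ → ℂ}
    (h : ∀ i ∈ t, LetterAt T z₀ (f i)) : LetterAt T z₀ (∑ i ∈ t, f i) :=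
  Finset.sum_induction _ (LetterAt T z₀) (fun _ _ hf hg => HasExpansion.add hf hg)
    LetterAt.zero h

theorem hasExpansion_truncSumWord (hT : ∀ a b, T a → T b → T (a + b)) (v : Ineq)
    (u : List (ℂ → ℝ → ℂ)) (hu : ∀ f ∈ u, LetterAt T z₀ f) :
    HasExpansion (fullTerms T z₀) z₀ (fun z N => truncSumWord v (u.map (· z)) N) ∧
    HasExpansion (fullTerms T z₀) z₀ (fun z N => truncSumWord v (u.map (· z)) (v.below N)) := by
  induction u with
  | nil => exact ⟨hasExpansion_const 1, hasExpansion_const 1⟩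
  | cons f u ih =>
    have ih' := ih fun g hg => hu g (List.mem_cons_of_mem _ hg)
    have hg := HasExpansion.mul hT (hu f List.mem_cons_self) ih'.2
    have h1 : HasExpansion (fullTerms T z₀) z₀
        (fun z N => truncSumWord v ((f :: u).map (· z)) N) := hg.partialSum
    refine ⟨h1, ?_⟩
    cases v with
    | weak => exact h1
    | strict =>
      have h2 := HasExpansion.const_mul (-1)
        (fun _ hG => const_mul_mem_fullTerms (MeromorphicAt.const (-1) z₀) hG)
        (hg.mono mainTerms_le_fullTerms)
      refine (h1.add h2).congr (Eventually.of_forall fun z N hN => ?_)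
      obtain ⟨N, rfl⟩ : ∃ M, N = M + 1 := ⟨N - 1, by omega⟩
      simp [truncSumWord, Ineq.below, Finset.sum_Icc_succ_top]

theorem hasExpansion_blockSumAux (hT : ∀ a b, T a → T b → T (a + b)) (v : Ineq) (ε : ℂ)
    (c : ℕ → ℂ) (p : List (ℂ → ℝ → ℂ)) (hp : ∀ f ∈ p, LetterAt T z₀ f) (y : ℂ → ℝ → ℂ)
    (hy : LetterAt T z₀ y) (i : ℕ) (u : List (ℂ → ℝ → ℂ)) (hu : ∀ f ∈ u, LetterAt T z₀ f) :
    HasExpansion (fullTerms T z₀) z₀ (fun z N => truncSum v (word (p.map (· z)) *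
      blockSumAux ε c (y z) i (u.map (· z))) N) := by
  have hsnoc : ∀ {p : List (ℂ → ℝ → ℂ)} {y : ℂ → ℝ → ℂ}, (∀ f ∈ p, LetterAt T z₀ f) →
      LetterAt T z₀ y → ∀ f ∈ p ++ [y], LetterAt T z₀ f := by
    intro p y hp hy f hf
    rcases List.mem_append.1 hf with h | h
    · exact hp f h
    · rw [List.mem_singleton.1 h]; exact hy
  have hfull : ∀ (c : ℂ), ∀ G ∈ fullTerms T z₀, (fun z n => c * G z n) ∈ fullTerms T z₀ :=
    fun c _ hG => const_mul_mem_fullTerms (MeromorphicAt.const c z₀) hG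
  induction u generalizing p y i with
  | nil =>
    refine ((hasExpansion_truncSumWord hT v (p ++ [y]) (hsnoc hp hy)).1.const_mul (c i)
      (hfull _)).congr (Eventually.of_forall fun z N _ => ?_)
    rw [List.map_nil, blockSumAux, mul_smul_comm, map_smul, Pi.smul_apply, smul_eq_mul,
      ← word_singleton, ← word_append, truncSum_word, List.map_append]
    rfl
  | cons b u ih =>
    have hu' : ∀ f ∈ u, LetterAt T z₀ f := fun g hg => hu g (List.mem_cons_of_mem _ hg)
    have hb := hu b List.mem_cons_self
    have h1 := (ih (p ++ [y]) (hsnoc hp hy) b hb 1 hu').const_mul (c i) (hfull _)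
    have h2 := ih p hp (fun z => ε • (y z * b z)) ((hy.mul hT hb).smul ε) (i + 1) hu'
    refine (h1.add h2).congr (Eventually.of_forall fun z N _ => ?_)
    have e : word ((p ++ [y]).map (· z)) = word (p.map (· z)) * TensorAlgebra.ι ℂ (y z) := by
      rw [List.map_append, word_append, List.map_cons, List.map_nil, word_singleton]
    rw [List.map_cons, blockSumAux, mul_add, map_add, mul_smul_comm, map_smul, Pi.add_apply,
      Pi.add_apply, e, mul_assoc]
    rfl

theorem hasExpansion_hoffman (hT : ∀ a b, T a → T b → T (a + b)) (v : Ineq)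
    {B : Type*} [NonUnitalCommRing B] [Module ℂ B] [IsScalarTower ℂ B B] [SMulCommClass ℂ B B]
    (φ : ℂ → B →ₗ[ℂ] (ℝ → ℂ)) (hφ : ∀ σ, LetterAt T z₀ (fun z => φ z σ)) (x : TensorAlgebra ℂ B) :
    HasExpansion (fullTerms T z₀) z₀
      (fun z N => truncSum v (hoffmanExp v.sign (mapLetters (φ z) x)) N) := by
  induction x using word_induction with
  | word u =>
    have hm : ∀ z, mapLetters (φ z) (word u) =
        word ((u.map fun σ z => φ z σ).map (· z)) := fun z => by
      rw [mapLetters_word, List.map_map]; rfl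
    simp only [hm, hoffmanExp_eq, blockSum_word]
    cases u with
    | nil =>
      simp only [List.map_nil, blockSumWord, truncSum_one]
      exact hasExpansion_const 1
    | cons a u =>
      have := hasExpansion_blockSumAux hT v v.sign (fun i => 1 / (i.factorial : ℂ)) [] (by simp)
        _ (hφ a) 1 (u.map fun σ z => φ z σ) (by
          intro f hf
          obtain ⟨σ, _, rfl⟩ := List.mem_map.1 hf
          exact hφ σ)
      simpa [blockSumWord] using this
  | add x y hx hy =>
    convert hx.add hy using 1
    funext z N
    simp
  | smul c x hx =>
    convert hx.const_mul c
      (fun _ hG => const_mul_mem_fullTerms (MeromorphicAt.const c z₀) hG) using 1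
    funext z N
    simp

end Nested

section Letters

open Filter

variable {z₀ : ℂ} {T : ℂ → Prop} {W : Set ℂ}

theorem LetterAt.of_expansion {f : ℂ → ℝ → ℂ} (hf : HolAt z₀ fun z n => f z n) {α : ℂ → ℂ}
    (hα : AnalyticAt ℂ α z₀) (hT : T (deriv α z₀)) {c : ℕ → ℂ → ℂ} (hc : ∀ j, AnalyticAt ℂ (c j) z₀)
    (h : ∀ N : ℕ, ∃ C : ℝ, ∀ᶠ z in 𝓝 z₀, ∀ n : ℕ, 1 ≤ n →
      ‖f z n - ∑ j ∈ Finset.range (N + 1), c j z * (n : ℂ) ^ (α z - (j : ℂ))‖ ≤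
        C * (n : ℝ) ^ ((α z).re - N - 1)) : LetterAt T z₀ f := by
  refine ⟨hf, fun r => ?_⟩
  obtain ⟨N, hN⟩ := exists_nat_gt ((α z₀).re - r)
  refine ⟨∑ j ∈ Finset.range (N + 1), powTerm (c j) (fun z => α z - (j : ℂ)) 0,
    AddSubmonoid.sum_mem _ fun j _ => powTerm_mem (hc j).meromorphicAt
      (hα.fun_sub analyticAt_const) (by rwa [deriv_sub_const_fun]) 0, ?_⟩
  obtain ⟨C, hC⟩ := h N
  refine ⟨0, |C|, abs_nonneg C, eventually_nhdsWithin_of_eventually_nhds ?_⟩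
  have hre : ∀ᶠ z in 𝓝 z₀, (α z).re < (α z₀).re + 1 :=
    (Complex.continuous_re.continuousAt.comp hα.continuousAt).eventually
      (eventually_lt_nhds (lt_add_one _))
  filter_upwards [hC, hre] with z hz hz2 n hn
  have h1 := hz n hn
  simp only [pow_zero, one_mul, Pi.sub_apply, Finset.sum_apply, powTerm, mul_one]
  refine h1.trans (mul_le_mul (le_abs_self C) ?_ (by positivity) (abs_nonneg C))
  exact Real.rpow_le_rpow_of_exponent_le (by exact_mod_cast hn) (by linarith)

theorem IsHolomorphicSmoothFamily.analyticAt {f : ℂ → ℝ → ℂ} (hf : IsHolomorphicSmoothFamily W f)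
    (hz : z₀ ∈ W) (x : ℝ) : AnalyticAt ℂ (fun z => f z x) z₀ := by
  obtain ⟨r, hr, -, a, -, h⟩ := hf.2 z₀ hz
  have h0 := h 0
  simp only [iteratedDeriv_zero] at h0
  have h1 : TendstoLocallyUniformlyOn
      (fun (K : ℕ) (z : ℂ) => ∑ k ∈ Finset.range K, (z - z₀) ^ k * a k x) (fun z => f z x) atTop
      (Metric.ball z₀ r) :=
    h0.comp (fun z : ℂ => (z, x)) (fun z hz => ⟨hz, trivial⟩) (by fun_prop)
  have h2 := h1.differentiableOn (Eventually.of_forall fun K => by fun_prop) Metric.isOpen_ball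
  exact h2.analyticAt (Metric.ball_mem_nhds z₀ hr)

theorem IsSimpleFamily.letterAt (hW : IsOpen W) {α : ℂ → ℂ} {f : ℂ → ℝ → ℂ}
    (hf : IsSimpleFamily W α f) (hz : z₀ ∈ W) (hT : T (deriv α z₀)) : LetterAt T z₀ f := by
  obtain ⟨c, hc, h⟩ := hf.expansion
  have hWn := hW.mem_nhds hz
  refine LetterAt.of_expansion ?_ (hf.order.analyticAt hWn) hT (fun j => (hc j).analyticAt hWn)
    fun N => ?_
  · filter_upwards [eventually_nhdsWithin_of_eventually_nhds hWn] with z hz n _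
    exact hf.holomorphic.analyticAt hz n
  · obtain ⟨ε, hε, hb⟩ := Metric.nhds_basis_closedBall.mem_iff.1 hWn
    obtain ⟨C, hC⟩ := h _ (isCompact_closedBall z₀ ε) hb N 0
    refine ⟨C, ?_⟩
    filter_upwards [Metric.closedBall_mem_nhds z₀ hε] with z hz n hn
    simpa using hC z hz n (by exact_mod_cast hn)

theorem IsSimpleFamily.letterAt_const {α : ℂ → ℂ} {f : ℂ → ℝ → ℂ}
    (hf : IsSimpleFamily W α f) {z₁ : ℂ} (hz : z₁ ∈ W) :
    LetterAt (fun _ => True) z₀ (fun _ => f z₁) := by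
  obtain ⟨c, hc, h⟩ := hf.expansion
  refine LetterAt.of_expansion (Eventually.of_forall fun z n _ => analyticAt_const)
    (α := fun _ => α z₁) analyticAt_const trivial (c := fun j _ => c j z₁)
    (fun j => analyticAt_const) fun N => ?_
  obtain ⟨C, hC⟩ := h _ isCompact_singleton (Set.singleton_subset_iff.2 hz) N 0
  refine ⟨C, Eventually.of_forall fun z n hn => ?_⟩
  simpa using hC z₁ rfl n (by exact_mod_cast hn)

variable {A : NonUnitalSubalgebra ℂ (ℝ → ℂ)}

theorem HolomorphicRegularisation.letterAt (hW : IsOpen W) (R : HolomorphicRegularisation W A)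
    (hz : z₀ ∈ W) (σ : A) : LetterAt (fun a => a.re < 0) z₀ (fun z => R.toFun z σ) := by
  obtain ⟨n, α, f, hf, hα, h⟩ := R.sum_of_simple σ
  refine HasExpansion.congr (LetterAt.sum (t := Finset.univ) (f := f)
    fun i _ => (hf i).letterAt hW hz (hα i z₀ hz)) ?_
  filter_upwards [eventually_nhdsWithin_of_eventually_nhds (hW.mem_nhds hz)] with z hz k _
  rw [h z hz, Finset.sum_apply]

theorem HolomorphicRegularisation.letterAt_const (R : HolomorphicRegularisation W A) {z₁ : ℂ}
    (hz : z₁ ∈ W) (σ : A) : LetterAt (fun _ => True) z₀ (fun _ => R.toFun z₁ σ) := by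
  obtain ⟨n, α, f, hf, hα, h⟩ := R.sum_of_simple σ
  refine HasExpansion.congr (LetterAt.sum (t := Finset.univ) (f := fun i _ => f i z₁)
    fun i _ => (hf i).letterAt_const hz) (Eventually.of_forall fun z k _ => ?_)
  rw [h z₁ hz, Finset.sum_apply]

end Letters

section FiniteParts

open Filter

variable {z₀ : ℂ} {F G : ℂ → ℕ → ℂ} {r : ℝ} {T : ℂ → Prop}

theorem ErrAt.tendsto (h : ErrAt z₀ r F) (hr : r < 0) :
    ∀ᶠ z in 𝓝[≠] z₀, Tendsto (F z) atTop (𝓝 0) := by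
  obtain ⟨m, K, -, h⟩ := h
  filter_upwards [h, self_mem_nhdsWithin] with z hz hne
  have hne' : (z - z₀) ^ m ≠ 0 := pow_ne_zero _ (sub_ne_zero.2 hne)
  have h1 : Tendsto (fun n : ℕ => K * (n : ℝ) ^ r) atTop (𝓝 0) := by
    have := (tendsto_rpow_neg_atTop (neg_pos.2 hr)).comp tendsto_natCast_atTop_atTop
    simpa using this.const_mul K
  have h2 : Tendsto (fun n => (z - z₀) ^ m * F z n) atTop (𝓝 0) :=
    squeeze_zero_norm' ((eventually_ge_atTop 1).mono fun n hn => hz n hn) h1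
  simpa [inv_mul_cancel_left₀ hne'] using h2.const_mul ((z - z₀) ^ m)⁻¹

theorem hasFinitePart_zero_of_mem_mainTerms (h : F ∈ mainTerms (fun a => a.re < 0) z₀) :
    ∀ᶠ z in 𝓝[≠] z₀, HasFinitePart (F z) 0 := by
  induction h using AddSubmonoid.closure_induction with
  | mem F h =>
    obtain ⟨d, β, l, hd, hβ, hT, rfl⟩ := h
    rcases hβ.eventually_eq_zero_or_eventually_ne_zero with h0 | h0
    · have : deriv β z₀ = 0 := by
        rw [EventuallyEq.deriv_eq (f := fun _ => (0 : ℂ)) h0]; simp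
      simp [this] at hT
    · exact h0.mono fun z hz => HasFinitePart.term _ _ _ fun h => hz h.1
  | zero => exact Eventually.of_forall fun z => HasFinitePart.of_tendsto tendsto_const_nhds
  | add F G _ _ hF hG =>
    filter_upwards [hF, hG] with z h1 h2
    simpa using h1.add h2

theorem exists_hasFinitePart_of_mem_mainTerms (h : F ∈ mainTerms T z₀) :
    ∀ᶠ z in 𝓝[≠] z₀, ∃ c, HasFinitePart (F z) c := by
  induction h using AddSubmonoid.closure_induction with
  | mem F h =>
    obtain ⟨d, β, l, hd, hβ, hT, rfl⟩ := h
    refine Eventually.of_forall fun z => ?_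
    by_cases h0 : β z = 0 ∧ l = 0
    · refine ⟨d z, HasFinitePart.of_tendsto ((tendsto_const_nhds (x := d z)).congr fun n => ?_)⟩
      simp only [powTerm, h0.1, h0.2, Complex.cpow_zero, pow_zero, mul_one]
    · exact ⟨0, HasFinitePart.term _ _ _ h0⟩
  | zero => exact Eventually.of_forall fun z => ⟨0, HasFinitePart.of_tendsto tendsto_const_nhds⟩
  | add F G _ _ hF hG =>
    filter_upwards [hF, hG] with z ⟨c, h1⟩ ⟨d, h2⟩
    exact ⟨_, h1.add h2⟩

theorem HasExpansion.exists_hasFinitePart {S : ℕ → ℂ}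
    (h : HasExpansion (fullTerms T z₀) z₀ (fun _ => S)) : ∃ c, HasFinitePart S c := by
  obtain ⟨H, hH, e⟩ := h.2 (-1)
  obtain ⟨M, hM, d, hd, rfl⟩ := mem_fullTerms.1 hH
  obtain ⟨z, h1, c, h2⟩ :=
    ((e.tendsto (by norm_num)).and (exists_hasFinitePart_of_mem_mainTerms hM)).exists
  refine ⟨_, ((HasFinitePart.of_tendsto h1).add (h2.add (HasFinitePart.of_tendsto
    (tendsto_const_nhds (x := d z))))).congr (Eventually.of_forall fun n => ?_)⟩
  simp

theorem hasFinitePart_of_errAt {M : ℂ → ℕ → ℂ} {d : ℂ → ℂ}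
    (hM : M ∈ mainTerms (fun a => a.re < 0) z₀)
    (h : ErrAt z₀ (-1) (F - (M + fun z _ => d z))) :
    ∀ᶠ z in 𝓝[≠] z₀, HasFinitePart (F z) (d z) := by
  filter_upwards [h.tendsto (by norm_num), hasFinitePart_zero_of_mem_mainTerms hM] with z h1 h2
  have h3 := (HasFinitePart.of_tendsto h1).add (h2.add (HasFinitePart.of_tendsto
    (tendsto_const_nhds (x := d z))))
  rw [zero_add, zero_add] at h3
  refine h3.congr (Eventually.of_forall fun n => ?_)
  simp

theorem HasExpansion.exists_meromorphic
    (h : HasExpansion (fullTerms (fun a => a.re < 0) z₀) z₀ F) :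
    ∃ C : ℂ → ℂ, MeromorphicAt C z₀ ∧ ∀ᶠ z in 𝓝[≠] z₀, HasFinitePart (F z) (C z) := by
  obtain ⟨H, hH, e⟩ := h.2 (-1)
  obtain ⟨M, hM, d, hd, rfl⟩ := mem_fullTerms.1 hH
  exact ⟨d, hd, hasFinitePart_of_errAt hM e⟩

theorem HasExpansion.finitePart_mul
    (hF : HasExpansion (fullTerms (fun a => a.re < 0) z₀) z₀ F)
    (hG : HasExpansion (fullTerms (fun a => a.re < 0) z₀) z₀ G) :
    ∀ᶠ z in 𝓝[≠] z₀, finitePart (F z * G z) = finitePart (F z) * finitePart (G z) := by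
  have hT : ∀ a b : ℂ, a.re < 0 → b.re < 0 → (a + b).re < 0 := fun a b ha hb => by
    rw [Complex.add_re]; linarith
  obtain ⟨H, hH, H', hH', e1, e2, e3⟩ := exists_mul_approx hF le_rfl hG hF (-1)
  obtain ⟨M, hM, d, hd, rfl⟩ := mem_fullTerms.1 hH
  obtain ⟨M', hM', d', hd', rfl⟩ := mem_fullTerms.1 hH'
  obtain ⟨P, hP, h⟩ := exists_mul_mem_mainTerms hT hM hM'
  have e4 : ErrAt z₀ (-1) (F * G - (P + (fun z n => d z * M' z n) + (fun z n => d' z * M z n) +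
      fun z _ => d z * d' z)) := by
    refine e3.congr (Eventually.of_forall fun z n hn => ?_)
    have := h z n hn
    simp only [Pi.sub_apply, Pi.mul_apply, Pi.add_apply] at this ⊢
    linear_combination -this
  filter_upwards [hasFinitePart_of_errAt hM e1, hasFinitePart_of_errAt hM' e2,
    hasFinitePart_of_errAt (AddSubmonoid.add_mem _ (AddSubmonoid.add_mem _ hP
      (const_mul_mem_mainTerms hd hM')) (const_mul_mem_mainTerms hd' hM)) e4] with z h1 h2 h3
  rw [finitePart_eq h1, finitePart_eq h2]
  exact finitePart_eq h3

end FiniteParts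

section Regularised

open Filter

variable {W : Set ℂ} {A : NonUnitalSubalgebra ℂ (ℝ → ℂ)}

theorem HolomorphicRegularisation.star_apply (R : HolomorphicRegularisation W A) (v : Ineq) (z : ℂ)
    (x : TensorAlgebra ℂ A) :
    R.star v z x = hoffmanExp v.sign (mapLetters (R.toFun z) (hoffmanLog v.sign x)) := rfl

theorem HolomorphicRegularisation.star_one (R : HolomorphicRegularisation W A) (v : Ineq) (z : ℂ) :
    R.star v z 1 = 1 := by
  rw [star_apply, hoffmanLog_eq, hoffmanExp_eq, blockSum_one, map_one, blockSum_one]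

theorem HolomorphicRegularisation.star_stuffle (R : HolomorphicRegularisation W A) (v : Ineq)
    (z : ℂ) (x y : TensorAlgebra ℂ A) :
    R.star v z (stuffle v.sign x y) = stuffle v.sign (R.star v z x) (R.star v z y) := by
  simp only [star_apply, hoffmanLog_stuffle, mapLetters_shuffle, hoffmanExp_shuffle]

theorem HolomorphicRegularisation.hasExpansion (hW : IsOpen W) (R : HolomorphicRegularisation W A)
    (v : Ineq) {z₀ : ℂ} (hz : z₀ ∈ W) (x : TensorAlgebra ℂ A) :
    HasExpansion (fullTerms (fun a => a.re < 0) z₀) z₀ (fun z => truncSum v (R.star v z x)) :=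
  hasExpansion_hoffman (fun a b ha hb => by rw [Complex.add_re]; linarith) v R.toFun
    (R.letterAt hW hz) _

theorem HolomorphicRegularisation.exists_hasFinitePart (R : HolomorphicRegularisation W A)
    (v : Ineq) {z : ℂ} (hz : z ∈ W) (x : TensorAlgebra ℂ A) :
    ∃ c, HasFinitePart (truncSum v (R.star v z x)) c :=
  (hasExpansion_hoffman (z₀ := 0) (T := fun _ => True) (fun _ _ _ _ => trivial) v
    (fun _ => R.toFun z) (R.letterAt_const hz) (hoffmanLog v.sign x)).exists_hasFinitePart

end Regularised

section Meromorphic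

open Filter

variable {W : Set ℂ} {f g : ℂ → ℂ}

theorem Mero.exists_mk (F : Mero W) : ∃ (f : ℂ → ℂ) (hf : MeromorphicOn f W), F = Mero.mk f hf := by
  obtain ⟨⟨f, hf⟩, rfl⟩ := Ideal.Quotient.mk_surjective F
  exact ⟨f, hf, rfl⟩

theorem Mero.mk_eq_mk_iff (hf : MeromorphicOn f W) (hg : MeromorphicOn g W) :
    Mero.mk f hf = Mero.mk g hg ↔ ∀ᶠ z in codiscreteWithin W, f z = g z := by
  refine Ideal.Quotient.eq.trans ?_
  show (∀ᶠ z in codiscreteWithin W, f z - g z = 0) ↔ _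
  simp only [sub_eq_zero]

theorem Mero.mk_eq_mk_of_punctured (hf : MeromorphicOn f W) (hg : MeromorphicOn g W)
    (h : ∀ z₀ ∈ W, ∀ᶠ z in 𝓝[≠] z₀, f z = g z) : Mero.mk f hf = Mero.mk g hg := by
  rw [Mero.mk_eq_mk_iff]
  refine mem_codiscreteWithin.2 fun z₀ hz₀ => ?_
  rw [Filter.disjoint_principal_right]
  filter_upwards [h z₀ hz₀] with z hz hz2
  exact hz2.2 hz

theorem eventually_punctured_of_codiscreteWithin (hW : IsOpen W) {z₀ : ℂ} (hz₀ : z₀ ∈ W)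
    {p : ℂ → Prop} (h : ∀ᶠ z in codiscreteWithin W, p z) : ∀ᶠ z in 𝓝[≠] z₀, p z := by
  have := mem_codiscreteWithin.1 h z₀ hz₀
  rw [Filter.disjoint_principal_right] at this
  filter_upwards [this, eventually_nhdsWithin_of_eventually_nhds (hW.mem_nhds hz₀)] with z h1 h2
  by_contra h3
  exact h1 ⟨h2, h3⟩

theorem Mero.IsGivenBy.add {F G : Mero W} (hF : F.IsGivenBy f) (hG : G.IsGivenBy g) :
    (F + G).IsGivenBy (f + g) := by
  obtain ⟨hf, rfl⟩ := hF
  obtain ⟨hg, rfl⟩ := hG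
  exact ⟨hf.add hg, rfl⟩

theorem Mero.IsGivenBy.mul {F G : Mero W} (hF : F.IsGivenBy f) (hG : G.IsGivenBy g) :
    (F * G).IsGivenBy (f * g) := by
  obtain ⟨hf, rfl⟩ := hF
  obtain ⟨hg, rfl⟩ := hG
  exact ⟨hf.mul hg, rfl⟩

theorem Mero.IsGivenBy.smul (c : ℂ) {F : Mero W} (hF : F.IsGivenBy f) :
    (c • F).IsGivenBy (c • f) := by
  obtain ⟨hf, rfl⟩ := hF
  exact ⟨hf.const_smul c, rfl⟩

theorem Mero.isGivenBy_one : (1 : Mero W).IsGivenBy 1 := ⟨MeromorphicOn.const 1, rfl⟩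

theorem Mero.isGivenBy_zero : (0 : Mero W).IsGivenBy 0 := ⟨MeromorphicOn.const 0, rfl⟩

theorem Mero.IsGivenBy.eventually_eq (hW : IsOpen W) {F : Mero W} (hF : F.IsGivenBy f)
    (hG : F.IsGivenBy g) {z₀ : ℂ} (hz₀ : z₀ ∈ W) : ∀ᶠ z in 𝓝[≠] z₀, f z = g z := by
  obtain ⟨hf, rfl⟩ := hF
  obtain ⟨hg, h⟩ := hG
  exact eventually_punctured_of_codiscreteWithin hW hz₀ ((Mero.mk_eq_mk_iff hf hg).1 h)

theorem Mero.HasValueAtZero.add {F G : Mero W} {c d : ℂ} (hF : F.HasValueAtZero c)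
    (hG : G.HasValueAtZero d) : (F + G).HasValueAtZero (c + d) := by
  obtain ⟨f, hf, ha, rfl⟩ := hF
  obtain ⟨g, hg, hb, rfl⟩ := hG
  exact ⟨f + g, hf.add hg, ha.add hb, rfl⟩

theorem Mero.HasValueAtZero.mul {F G : Mero W} {c d : ℂ} (hF : F.HasValueAtZero c)
    (hG : G.HasValueAtZero d) : (F * G).HasValueAtZero (c * d) := by
  obtain ⟨f, hf, ha, rfl⟩ := hF
  obtain ⟨g, hg, hb, rfl⟩ := hG
  exact ⟨f * g, hf.mul hg, ha.mul hb, rfl⟩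

theorem Mero.HasValueAtZero.smul (t : ℂ) {F : Mero W} {c : ℂ} (hF : F.HasValueAtZero c) :
    (t • F).HasValueAtZero (t * c) := by
  obtain ⟨f, hf, ha, rfl⟩ := hF
  exact ⟨t • f, hf.smul t, analyticAt_const.smul ha, rfl⟩

theorem Mero.hasValueAtZero_one : (1 : Mero W).HasValueAtZero 1 :=
  ⟨1, Mero.isGivenBy_one, analyticAt_const, rfl⟩

theorem Mero.hasValueAtZero_zero : (0 : Mero W).HasValueAtZero 0 :=
  ⟨0, Mero.isGivenBy_zero, analyticAt_const, rfl⟩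

theorem Mero.HasValueAtZero.unique (hW : IsOpen W) (h0 : (0 : ℂ) ∈ W) {F : Mero W} {c d : ℂ}
    (hc : F.HasValueAtZero c) (hd : F.HasValueAtZero d) : c = d := by
  obtain ⟨f, hf, ha, rfl⟩ := hc
  obtain ⟨g, hg, hb, rfl⟩ := hd
  exact tendsto_nhds_unique_of_eventuallyEq (ha.continuousAt.tendsto.mono_left nhdsWithin_le_nhds)
    (hb.continuousAt.tendsto.mono_left nhdsWithin_le_nhds) (hf.eventually_eq hW hg h0)

/-- The functions with values in `z⁻¹ ℂ[z⁻¹]`. -/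
def polarPart (W : Set ℂ) : Submodule ℂ (Mero W) where
  carrier := {F | F.IsPolePart}
  zero_mem' := ⟨0, by simp, by simp only [Polynomial.eval_zero]; exact Mero.isGivenBy_zero⟩
  add_mem' := by
    rintro F G ⟨p, hp, hF⟩ ⟨q, hq, hG⟩
    refine ⟨p + q, by simp [hp, hq], ?_⟩
    simp only [Polynomial.eval_add]
    exact hF.add hG
  smul_mem' := by
    rintro c F ⟨p, hp, hF⟩
    refine ⟨c • p, by simp [hp], ?_⟩
    simp only [Polynomial.eval_smul]
    exact hF.smul c

theorem mul_mem_polarPart {F G : Mero W} (hF : F ∈ polarPart W) (hG : G ∈ polarPart W) :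
    F * G ∈ polarPart W := by
  obtain ⟨p, hp, hF⟩ := hF
  obtain ⟨q, hq, hG⟩ := hG
  refine ⟨p * q, by simp [Polynomial.mul_coeff_zero, hp], ?_⟩
  simp only [Polynomial.eval_mul]
  exact hF.mul hG

/-- The functions that are holomorphic at `0`. -/
def holomorphicAtZero (W : Set ℂ) : Submodule ℂ (Mero W) where
  carrier := {F | ∃ c, F.HasValueAtZero c}
  zero_mem' := ⟨0, Mero.hasValueAtZero_zero⟩
  add_mem' := by
    rintro F G ⟨c, hc⟩ ⟨d, hd⟩
    exact ⟨_, hc.add hd⟩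
  smul_mem' := by
    rintro t F ⟨c, hc⟩
    exact ⟨_, hc.smul t⟩

theorem polynomial_eq_zero_of_bounded {p : Polynomial ℂ} (hp : p.coeff 0 = 0) {c : ℂ}
    (h : Tendsto (fun z : ℂ => p.eval z⁻¹) (𝓝[≠] 0) (𝓝 c)) : p = 0 := by
  by_cases hd : 0 < p.degree
  · have h1 : Tendsto (fun z : ℂ => ‖z⁻¹‖) (𝓝[≠] 0) atTop :=
      tendsto_norm_inv_nhdsNE_zero_atTop
    exact absurd h.norm (not_tendsto_nhds_of_tendsto_atTop (p.tendsto_norm_atTop hd h1) _)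
  · rw [Polynomial.eq_C_of_degree_le_zero (not_lt.1 hd), hp, Polynomial.C_0]

theorem disjoint_polarPart_holomorphicAtZero (hW : IsOpen W) (h0 : (0 : ℂ) ∈ W) :
    Disjoint (polarPart W) (holomorphicAtZero W) := by
  rw [Submodule.disjoint_def]
  rintro F ⟨p, hp, hF⟩ ⟨c, f, hf, ha, -⟩
  have : p = 0 := by
    refine polynomial_eq_zero_of_bounded hp (c := f 0) ?_
    exact (ha.continuousAt.tendsto.mono_left nhdsWithin_le_nhds).congr'
      (hf.eventually_eq hW hF h0)
  subst this
  obtain ⟨hm, rfl⟩ := hF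
  simp only [Polynomial.eval_zero]
  rfl

theorem exists_polar_decomposition (n : ℕ) : ∀ g : ℂ → ℂ, AnalyticAt ℂ g 0 →
    ∃ (p : Polynomial ℂ) (h : ℂ → ℂ), p.coeff 0 = 0 ∧ AnalyticAt ℂ h 0 ∧
      ∀ z ≠ 0, z⁻¹ ^ n * g z = p.eval z⁻¹ + h z := by
  induction n with
  | zero => exact fun g hg => ⟨0, g, by simp, hg, by simp⟩
  | succ n ih =>
    intro g hg
    obtain ⟨q, hq⟩ := hg
    obtain ⟨p, h, hp, hh, e⟩ := ih (dslope g 0) ⟨_, hq.has_fpower_series_dslope_fslope⟩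
    refine ⟨p + Polynomial.C (g 0) * Polynomial.X ^ (n + 1), h, by simp [hp], hh, fun z hz => ?_⟩
    have e1 : g z = g 0 + z * dslope g 0 z := by
      have := sub_smul_dslope g 0 z
      rw [sub_zero, smul_eq_mul] at this
      rw [this]; ring
    have e2 : z⁻¹ ^ (n + 1) * (z * dslope g 0 z) = z⁻¹ ^ n * dslope g 0 z := by
      rw [pow_succ, mul_assoc, inv_mul_cancel_left₀ hz]
    rw [e1, mul_add, e2, e z hz]
    simp
    ring

theorem meromorphicOn_eval_inv (p : Polynomial ℂ) : MeromorphicOn (fun z => p.eval z⁻¹) W := by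
  intro z _
  simp only [Polynomial.eval_eq_sum_range]
  fun_prop

theorem codisjoint_polarPart_holomorphicAtZero (h0 : (0 : ℂ) ∈ W) :
    Codisjoint (polarPart W) (holomorphicAtZero W) := by
  classical
  rw [codisjoint_iff, Submodule.eq_top_iff']
  intro F
  obtain ⟨f, hf, rfl⟩ := F.exists_mk
  obtain ⟨n, hn⟩ := hf 0 h0
  obtain ⟨p, h, hp, hh, e⟩ := exists_polar_decomposition n _ hn
  have hm : MeromorphicOn (Function.update (fun z => f z - p.eval z⁻¹) 0 (h 0)) W :=
    fun z hz => ((hf z hz).sub (meromorphicOn_eval_inv p z hz)).update 0 (h 0)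
  refine Submodule.mem_sup.2 ⟨Mero.mk _ (meromorphicOn_eval_inv p), ⟨p, hp, _, rfl⟩,
    Mero.mk _ hm, ⟨h 0, _, ⟨hm, rfl⟩, ?_, by simp⟩, ?_⟩
  · refine hh.congr (Eventually.of_forall fun z => ?_)
    rcases eq_or_ne z 0 with rfl | hz
    · simp
    · have := e z hz
      rw [sub_zero, smul_eq_mul, inv_pow, inv_mul_cancel_left₀ (pow_ne_zero n hz)] at this
      rw [Function.update_of_ne hz, this]
      ring
  · refine Mero.mk_eq_mk_of_punctured ((meromorphicOn_eval_inv p).add hm) hf fun z₀ _ => ?_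
    have h1 : ∀ᶠ z : ℂ in 𝓝[≠] z₀, z ≠ 0 := by
      rcases eq_or_ne z₀ 0 with rfl | hz
      · exact self_mem_nhdsWithin
      · exact eventually_nhdsWithin_of_eventually_nhds (isOpen_ne.mem_nhds hz)
    filter_upwards [h1] with z hz
    simp [Function.update_of_ne hz]

theorem isCompl_polarPart (hW : IsOpen W) (h0 : (0 : ℂ) ∈ W) :
    IsCompl (polarPart W) (holomorphicAtZero W) :=
  ⟨disjoint_polarPart_holomorphicAtZero hW h0, codisjoint_polarPart_holomorphicAtZero h0⟩

end Meromorphic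

section Convolution

set_option linter.unusedSectionVars false

variable {B : Type*} [NonUnitalCommRing B] [Module ℂ B]
variable {S : Type*} [CommRing S] [Algebra ℂ S]

theorem conv_word (φ ψ : TensorAlgebra ℂ B →ₗ[ℂ] S) (u : List B) :
    conv φ ψ (word u) = ∑ i ∈ Finset.range (u.length + 1),
      φ (word (u.take i)) * ψ (word (u.drop i)) := by
  simp [conv, deconc_word, deconcWord_eq_sum]

theorem conv_word' (φ ψ : TensorAlgebra ℂ B →ₗ[ℂ] S) (hψ : ψ 1 = 1) (u : List B) :
    conv φ ψ (word u) = φ (word u) + ∑ i ∈ Finset.range u.length,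
      φ (word (u.take i)) * ψ (word (u.drop i)) := by
  rw [conv_word, Finset.sum_range_succ, add_comm]
  simp [hψ]

/-- The counterterms: the recursion `φ(u) = - P (∑_{i<|u|} φ(u₁⋯u_i) ψ(u_{i+1}⋯))`. -/
def countertermWord (P : S →ₗ[ℂ] S) (ψ : TensorAlgebra ℂ B →ₗ[ℂ] S) : List B → S
  | [] => 1
  | a :: u => - P (∑ i : Fin (u.length + 1),
      countertermWord P ψ ((a :: u).take i) * ψ (word ((a :: u).drop i)))
termination_by u => u.length
decreasing_by
  simp only [List.length_take, List.length_cons]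
  have := i.2
  omega

theorem countertermWord_eq (P : S →ₗ[ℂ] S) (ψ : TensorAlgebra ℂ B →ₗ[ℂ] S) {u : List B}
    (hu : u ≠ []) : countertermWord P ψ u = - P (∑ i ∈ Finset.range u.length,
      countertermWord P ψ (u.take i) * ψ (word (u.drop i))) := by
  cases u with
  | nil => exact absurd rfl hu
  | cons a u =>
    rw [countertermWord, List.length_cons, Finset.sum_range]

theorem take_append_cons_of_lt (u v : List B) (x : B) {i : ℕ} (h : u.length < i) :
    (u ++ x :: v).take i = u ++ x :: v.take (i - u.length - 1) := by
  rw [List.take_append, List.take_of_length_le h.le,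
    show i - u.length = (i - u.length - 1) + 1 by omega, List.take_succ_cons, Nat.add_sub_cancel]

theorem drop_append_cons_of_lt (u v : List B) (x : B) {i : ℕ} (h : u.length < i) :
    (u ++ x :: v).drop i = v.drop (i - u.length - 1) := by
  rw [List.drop_append, List.drop_eq_nil_of_le h.le, List.nil_append,
    show i - u.length = (i - u.length - 1) + 1 by omega, List.drop_succ_cons, Nat.add_sub_cancel]

theorem isMultilinear_countertermWord (P : S →ₗ[ℂ] S) (ψ : TensorAlgebra ℂ B →ₗ[ℂ] S) :
    IsMultilinear (countertermWord P ψ : List B → S) where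
  add u v x y := by
    induction hn : v.length using Nat.strong_induction_on generalizing v with
    | _ n ih =>
    rw [countertermWord_eq P ψ (by simp), countertermWord_eq P ψ (by simp),
      countertermWord_eq P ψ (by simp), ← neg_add, ← map_add]
    simp only [List.length_append, List.length_cons, ← Finset.sum_add_distrib]
    congr 2
    refine Finset.sum_congr rfl fun i hi => ?_
    rcases lt_or_ge u.length i with h | h
    · simp only [take_append_cons_of_lt u v _ h, drop_append_cons_of_lt u v _ h]
      rw [ih _ (by rw [List.length_take]; rw [Finset.mem_range] at hi; omega) _ rfl, add_mul]
    · simp only [List.take_append_of_le_length h, List.drop_append_of_le_length h,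
        isMultilinear_word.add, map_add, mul_add]
  smul u v c x := by
    induction hn : v.length using Nat.strong_induction_on generalizing v with
    | _ n ih =>
    rw [countertermWord_eq P ψ (by simp), countertermWord_eq P ψ (by simp), smul_neg, ← map_smul]
    simp only [List.length_append, List.length_cons, Finset.smul_sum]
    congr 2
    refine Finset.sum_congr rfl fun i hi => ?_
    rcases lt_or_ge u.length i with h | h
    · simp only [take_append_cons_of_lt u v _ h, drop_append_cons_of_lt u v _ h]
      rw [ih _ (by rw [List.length_take]; rw [Finset.mem_range] at hi; omega) _ rfl,
        smul_mul_assoc]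
    · simp only [List.take_append_of_le_length h, List.drop_append_of_le_length h,
        isMultilinear_word.smul, map_smul, mul_smul_comm]

variable [IsScalarTower ℂ B B] [SMulCommClass ℂ B B]

theorem conv_stuffleWord (ε : ℂ) (φ ψ : TensorAlgebra ℂ B →ₗ[ℂ] S) (u w : List B) :
    conv φ ψ (stuffleWord ε u w) =
      ∑ i ∈ Finset.range (u.length + 1), ∑ j ∈ Finset.range (w.length + 1),
        φ (stuffleWord ε (u.take i) (w.take j)) * ψ (stuffleWord ε (u.drop i) (w.drop j)) := by
  simp [conv, deconc_stuffleWord]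

theorem IsCharacter.map_stuffleWord {ε : ℂ} {χ : TensorAlgebra ℂ B →ₗ[ℂ] S}
    (h : IsCharacter ε χ) (u w : List B) :
    χ (stuffleWord ε u w) = χ (word u) * χ (word w) := by
  rw [← stuffle_word, h.2]

/-- If `φ` is multiplicative on the pairs of proper prefixes of two words, the defects of
multiplicativity of `φ` and of `φ * ψ` agree. -/
theorem conv_stuffleWord_sub {ε : ℂ} {φ ψ : TensorAlgebra ℂ B →ₗ[ℂ] S} (hψ : IsCharacter ε ψ)
    (u w : List B) (h : ∀ i ≤ u.length, ∀ j ≤ w.length, i + j < u.length + w.length →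
      φ (stuffleWord ε (u.take i) (w.take j)) = φ (word (u.take i)) * φ (word (w.take j))) :
    conv φ ψ (stuffleWord ε u w) - conv φ ψ (word u) * conv φ ψ (word w) =
      φ (stuffleWord ε u w) - φ (word u) * φ (word w) := by
  rw [conv_stuffleWord, conv_word, conv_word, Finset.sum_mul_sum, ← Finset.sum_sub_distrib]
  simp only [← Finset.sum_sub_distrib]
  rw [Finset.sum_eq_single u.length, Finset.sum_eq_single w.length]
  · simp [stuffleWord, hψ.1]
  · intro j hj hne
    rw [Finset.mem_range] at hj
    rw [h _ le_rfl _ (by omega) (by omega), hψ.map_stuffleWord]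
    ring
  · simp
  · intro i hi hne
    refine Finset.sum_eq_zero fun j hj => ?_
    rw [Finset.mem_range] at hi hj
    rw [h _ (by omega) _ (by omega) (by omega), hψ.map_stuffleWord]
    ring
  · simp

end Convolution

section Birkhoff

set_option linter.unusedSectionVars false

variable {B : Type*} [NonUnitalCommRing B] [Module ℂ B]
variable {W : Set ℂ} {Ψ Ψm Ψp : TensorAlgebra ℂ B →ₗ[ℂ] Mero W}

theorem exists_isBirkhoff (hW : IsOpen W) (h0 : (0 : ℂ) ∈ W) (hΨ : Ψ 1 = 1) :
    ∃ Ψm Ψp : TensorAlgebra ℂ B →ₗ[ℂ] Mero W, IsBirkhoff Ψ Ψm Ψp := by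
  set P := (polarPart W).projection (holomorphicAtZero W) (isCompl_polarPart hW h0)
  set Ψm : TensorAlgebra ℂ B →ₗ[ℂ] Mero W :=
    ofWords (countertermWord P Ψ) (isMultilinear_countertermWord P Ψ)
  have hm : ∀ u, Ψm (word u) = countertermWord P Ψ u := fun u => ofWords_word _ _ u
  refine ⟨Ψm, conv Ψm Ψ, rfl, ?_, fun a x => ?_, fun x => ?_⟩
  · rw [← word_nil, hm, countertermWord]
  · show _ ∈ polarPart W
    induction x using word_induction with
    | word u =>
      rw [← word_cons, hm, countertermWord_eq P Ψ (by simp)]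
      exact neg_mem (Submodule.projection_apply_mem _ _)
    | add x y hx hy => rw [mul_add, map_add]; exact add_mem hx hy
    | smul c x hx => rw [mul_smul_comm, map_smul]; exact Submodule.smul_mem _ c hx
  · show _ ∈ holomorphicAtZero W
    induction x using word_induction with
    | word u =>
      rw [conv_word' _ _ hΨ]
      simp only [hm]
      cases u with
      | nil =>
        simp only [countertermWord, List.length_nil, Finset.range_zero, Finset.sum_empty, add_zero]
        exact ⟨1, Mero.hasValueAtZero_one⟩
      | cons a u =>
        rw [countertermWord_eq P Ψ (by simp), neg_add_eq_sub]
        exact Submodule.sub_projection_mem _ _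
    | add x y hx hy => rw [map_add]; exact add_mem hx hy
    | smul c x hx => rw [map_smul]; exact Submodule.smul_mem _ c hx

theorem IsBirkhoff.minus_cons (h : IsBirkhoff Ψ Ψm Ψp) (a : B) (u : List B) :
    Ψm (word (a :: u)) ∈ polarPart W := by
  rw [word_cons]
  exact h.minus_pole a (word u)

theorem IsBirkhoff.plus_mem (h : IsBirkhoff Ψ Ψm Ψp) (x : TensorAlgebra ℂ B) :
    Ψp x ∈ holomorphicAtZero W := h.plus_holomorphic x

theorem IsBirkhoff.plus_word (h : IsBirkhoff Ψ Ψm Ψp) (hΨ : Ψ 1 = 1) (u : List B) :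
    Ψp (word u) = Ψm (word u) + ∑ i ∈ Finset.range u.length,
      Ψm (word (u.take i)) * Ψ (word (u.drop i)) := by
  rw [← h.factor, conv_word' _ _ hΨ]

theorem IsBirkhoff.plus_one (h : IsBirkhoff Ψ Ψm Ψp) (hΨ : Ψ 1 = 1) : Ψp 1 = 1 := by
  have := h.plus_word hΨ []
  simpa [h.minus_one] using this

theorem IsBirkhoff.unique (hW : IsOpen W) (h0 : (0 : ℂ) ∈ W) (hΨ : Ψ 1 = 1)
    {Ψm' Ψp' : TensorAlgebra ℂ B →ₗ[ℂ] Mero W} (h : IsBirkhoff Ψ Ψm Ψp)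
    (h' : IsBirkhoff Ψ Ψm' Ψp') : Ψm' = Ψm ∧ Ψp' = Ψp := by
  have key : Ψm' = Ψm := by
    refine hom_ext_word fun u => ?_
    induction hn : u.length using Nat.strong_induction_on generalizing u with
    | _ n ih =>
    cases u with
    | nil => rw [word_nil, h.minus_one, h'.minus_one]
    | cons a u =>
      have e : Ψm' (word (a :: u)) - Ψm (word (a :: u)) =
          Ψp' (word (a :: u)) - Ψp (word (a :: u)) := by
        have hs : ∑ i ∈ Finset.range (a :: u).length,
            Ψm' (word ((a :: u).take i)) * Ψ (word ((a :: u).drop i)) =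
            ∑ i ∈ Finset.range (a :: u).length,
            Ψm (word ((a :: u).take i)) * Ψ (word ((a :: u).drop i)) := by
          refine Finset.sum_congr rfl fun i hi => ?_
          rw [Finset.mem_range] at hi
          rw [ih _ (by rw [List.length_take]; omega) _ rfl]
        rw [h.plus_word hΨ, h'.plus_word hΨ, hs]
        ring
      rw [← sub_eq_zero]
      refine Submodule.disjoint_def.1 (disjoint_polarPart_holomorphicAtZero hW h0) _
        (sub_mem (h'.minus_cons a u) (h.minus_cons a u)) ?_
      rw [e]
      exact sub_mem (h'.plus_mem _) (h.plus_mem _)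
  exact ⟨key, by rw [← h.factor, ← h'.factor, key]⟩

variable [IsScalarTower ℂ B B] [SMulCommClass ℂ B B]

theorem IsBirkhoff.isCharacter (hW : IsOpen W) (h0 : (0 : ℂ) ∈ W) {ε : ℂ} (hΨ : IsCharacter ε Ψ)
    (h : IsBirkhoff Ψ Ψm Ψp) : IsCharacter ε Ψm ∧ IsCharacter ε Ψp := by
  have hmul : ∀ {F G : Mero W}, F ∈ holomorphicAtZero W → G ∈ holomorphicAtZero W →
      F * G ∈ holomorphicAtZero W := fun ⟨_, hc⟩ ⟨_, hd⟩ => ⟨_, hc.mul hd⟩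
  have key : ∀ u w, Ψm (stuffleWord ε u w) = Ψm (word u) * Ψm (word w) := by
    intro u w
    induction hn : u.length + w.length using Nat.strong_induction_on generalizing u w with
    | _ n ih =>
    cases u with
    | nil => rw [stuffleWord, word_nil, h.minus_one, one_mul]
    | cons a u =>
    cases w with
    | nil => rw [stuffleWord_nil_right, word_nil, h.minus_one, mul_one]
    | cons b w =>
      have e := conv_stuffleWord_sub (φ := Ψm) hΨ (a :: u) (b :: w) fun i hi j hj hij =>
        ih _ (by simp only [List.length_take]; omega) _ _ rfl
      rw [h.factor] at e
      rw [← sub_eq_zero]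
      refine Submodule.disjoint_def.1 (disjoint_polarPart_holomorphicAtZero hW h0) _
        (sub_mem ?_ (mul_mem_polarPart (h.minus_cons a u) (h.minus_cons b w))) ?_
      · rw [stuffleWord, map_add, map_add]
        exact add_mem (add_mem (h.minus_pole _ _) (h.minus_pole _ _)) (h.minus_pole _ _)
      · rw [← e]
        exact sub_mem (h.plus_mem _) (hmul (h.plus_mem _) (h.plus_mem _))
  refine ⟨isCharacter_of_word h.minus_one key, isCharacter_of_word (h.plus_one hΨ.1) fun u w => ?_⟩
  have e := conv_stuffleWord_sub (φ := Ψm) hΨ u w fun i _ j _ _ => key _ _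
  rw [h.factor, key, sub_self] at e
  exact sub_eq_zero.1 e

theorem exists_linear_value (hW : IsOpen W) (h0 : (0 : ℂ) ∈ W)
    (h : ∀ x, ∃ c, (Ψp x).HasValueAtZero c) :
    ∃ ψ : TensorAlgebra ℂ B →ₗ[ℂ] ℂ, ∀ x, (Ψp x).HasValueAtZero (ψ x) := by
  choose ψ hψ using h
  refine ⟨{ toFun := ψ, map_add' := fun x y => ?_, map_smul' := fun c x => ?_ }, hψ⟩
  · refine (hψ (x + y)).unique hW h0 ?_
    rw [map_add]
    exact (hψ x).add (hψ y)
  · refine (hψ (c • x)).unique hW h0 ?_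
    rw [map_smul]
    exact (hψ x).smul c

theorem isCharacter_value (hW : IsOpen W) (h0 : (0 : ℂ) ∈ W) {ε : ℂ} (hΨ : IsCharacter ε Ψp)
    {ψ : TensorAlgebra ℂ B →ₗ[ℂ] ℂ} (h : ∀ x, (Ψp x).HasValueAtZero (ψ x)) : IsCharacter ε ψ := by
  constructor
  · refine (h 1).unique hW h0 ?_
    rw [hΨ.1]
    exact Mero.hasValueAtZero_one
  · intro x y
    refine (h _).unique hW h0 ?_
    rw [hΨ.2]
    exact (h x).mul (h y)

end Birkhoff

section Character

open Filter

variable {W : Set ℂ} {A : NonUnitalSubalgebra ℂ (ℝ → ℂ)}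

theorem HolomorphicRegularisation.meromorphicOn (hW : IsOpen W) (R : HolomorphicRegularisation W A)
    (v : Ineq) (x : TensorAlgebra ℂ A) :
    MeromorphicOn (fun z => cutoffNestedSum v (R.star v z x)) W := by
  intro z₀ hz₀
  obtain ⟨C, hC, h⟩ := (R.hasExpansion hW v hz₀ x).exists_meromorphic
  exact hC.congr (h.mono fun z hz => (finitePart_eq hz).symm)

theorem HolomorphicRegularisation.exists_character (hW : IsOpen W)
    (R : HolomorphicRegularisation W A) (v : Ineq) :
    ∃ Ψ : TensorAlgebra ℂ A →ₗ[ℂ] Mero W,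
      (∀ x, (Ψ x).IsGivenBy fun z => cutoffNestedSum v (R.star v z x)) ∧
      IsCharacter v.sign Ψ := by
  have hfp : ∀ {z}, z ∈ W → ∀ x, HasFinitePart (truncSum v (R.star v z x))
      (cutoffNestedSum v (R.star v z x)) := fun hz x => by
    obtain ⟨c, hc⟩ := R.exists_hasFinitePart v hz x
    rwa [cutoffNestedSum, finitePart_eq hc]
  have hev : ∀ z₀ ∈ W, ∀ᶠ z in 𝓝[≠] z₀, z ∈ W := fun z₀ hz₀ =>
    eventually_nhdsWithin_of_eventually_nhds (hW.mem_nhds hz₀)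
  set Ψ : TensorAlgebra ℂ A →ₗ[ℂ] Mero W :=
    { toFun := fun x => Mero.mk _ (R.meromorphicOn hW v x)
      map_add' := fun x y => Mero.mk_eq_mk_of_punctured _
        ((R.meromorphicOn hW v x).add (R.meromorphicOn hW v y)) fun z₀ hz₀ =>
          (hev z₀ hz₀).mono fun z hz => by
            refine (hfp hz (x + y)).unique ?_
            rw [map_add, map_add]
            exact (hfp hz x).add (hfp hz y)
      map_smul' := fun c x => Mero.mk_eq_mk_of_punctured _
        ((R.meromorphicOn hW v x).const_smul c) fun z₀ hz₀ =>
          (hev z₀ hz₀).mono fun z hz => by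
            refine (hfp hz (c • x)).unique ?_
            rw [map_smul, map_smul]
            exact (hfp hz x).smul c } with hΨ
  refine ⟨Ψ, fun x => ⟨R.meromorphicOn hW v x, rfl⟩, ?_, fun x y => ?_⟩
  · refine Mero.mk_eq_mk_of_punctured _ (MeromorphicOn.const 1) fun z₀ hz₀ =>
      Eventually.of_forall fun z => ?_
    rw [R.star_one, cutoffNestedSum, truncSum_one]
    exact finitePart_eq (HasFinitePart.of_tendsto tendsto_const_nhds)
  · refine Mero.mk_eq_mk_of_punctured _
      ((R.meromorphicOn hW v x).mul (R.meromorphicOn hW v y)) fun z₀ hz₀ => ?_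
    filter_upwards [(R.hasExpansion hW v hz₀ x).finitePart_mul (R.hasExpansion hW v hz₀ y)]
      with z hz
    rw [R.star_stuffle, cutoffNestedSum, truncSum_stuffle, hz]
    rfl

theorem truncSumWord_singleton (v : Ineq) (f : ℝ → ℂ) (N : ℕ) :
    truncSumWord v [f] N = ∑ n ∈ Finset.Icc 1 N, f n := by
  simp [truncSumWord]

theorem HolomorphicRegularisation.star_ι (R : HolomorphicRegularisation W A) (v : Ineq) (z : ℂ)
    (σ : A) : R.star v z (TensorAlgebra.ι ℂ σ) = TensorAlgebra.ι ℂ (R.toFun z σ) := by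
  have h1 : hoffmanLog v.sign (TensorAlgebra.ι ℂ σ) = TensorAlgebra.ι ℂ σ := by
    rw [← word_singleton, hoffmanLog_eq, blockSum_word]
    simp [blockSumWord, blockSumAux, word_singleton]
  have h2 : hoffmanExp v.sign (TensorAlgebra.ι ℂ (R.toFun z σ)) =
      TensorAlgebra.ι ℂ (R.toFun z σ) := by
    rw [← word_singleton, hoffmanExp_eq, blockSum_word]
    simp [blockSumWord, blockSumAux, word_singleton]
  rw [star_apply, h1, mapLetters_ι, h2]

theorem HolomorphicRegularisation.apply_zero (R : HolomorphicRegularisation W A) {z : ℂ}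
    (hz : z ∈ W) (σ : A) : R.toFun z σ 0 = 0 := by
  obtain ⟨n, α, f, hf, -, h⟩ := R.sum_of_simple σ
  rw [h z hz, Finset.sum_apply]
  refine Finset.sum_eq_zero fun i _ => ?_
  exact image_eq_zero_of_notMem_tsupport fun h0 => lt_irrefl (0 : ℝ) (Set.mem_Ioi.1 ((hf i).support z hz h0))

theorem HolomorphicRegularisation.cutoffSum_eq (R : HolomorphicRegularisation W A) (v : Ineq)
    {z : ℂ} (hz : z ∈ W) (σ : A) :
    cutoffSum (R.toFun z σ) = cutoffNestedSum v (R.star v z (TensorAlgebra.ι ℂ σ)) := by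
  rw [cutoffSum, cutoffNestedSum, R.star_ι]
  congr 1
  funext N
  rw [← word_singleton, truncSum_word, truncSumWord_singleton, Finset.sum_range_succ',
    Nat.cast_zero, R.apply_zero hz, add_zero, Finset.range_eq_Ico,
    Finset.sum_Ico_add' (fun n : ℕ => R.toFun z σ n) 0 N 1]
  rfl

/-- The value at `0` of the holomorphic part on letters is the finite part of the cut-off sum. -/
theorem hasFinitePartAtZero_cutoffSum (hW : IsOpen W) (h0 : (0 : ℂ) ∈ W)
    (R : HolomorphicRegularisation W A) (v : Ineq) {Ψ Ψm Ψp : TensorAlgebra ℂ A →ₗ[ℂ] Mero W}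
    (hΨ : ∀ x, (Ψ x).IsGivenBy fun z => cutoffNestedSum v (R.star v z x)) (hΨ1 : Ψ 1 = 1)
    (h : IsBirkhoff Ψ Ψm Ψp) {c : ℂ} (σ : A)
    (hc : (Ψp (TensorAlgebra.ι ℂ σ)).HasValueAtZero c) :
    HasFinitePartAtZero (fun z => cutoffSum (R.toFun z σ)) c := by
  obtain ⟨g, hg, hga, rfl⟩ := hc
  have e := h.plus_word hΨ1 [σ]
  simp only [List.length_singleton, Finset.range_one, Finset.sum_singleton, List.take_zero,
    List.drop_zero, word_nil, h.minus_one, one_mul, word_singleton] at e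
  obtain ⟨p, hp, hpm⟩ := h.minus_pole σ 1
  rw [mul_one] at hpm
  have h1 : (Ψ (TensorAlgebra.ι ℂ σ)).IsGivenBy (g + (-1 : ℂ) • fun z => p.eval z⁻¹) := by
    have := hg.add (hpm.smul (-1))
    rw [e] at this
    simpa using this
  refine ⟨-p, g, by simp [hp], hga, rfl, ?_⟩
  filter_upwards [(hΨ _).eventually_eq hW h1 h0,
    eventually_nhdsWithin_of_eventually_nhds (hW.mem_nhds h0)] with z hz hzW
  rw [R.cutoffSum_eq v hzW, hz]
  simp
  ring

end Character

section Symbols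

/-- The function `h` is smooth on `]0,∞[` and satisfies symbol estimates of order `m` at infinity. -/
def SymbolEstimates (m : ℝ) (h : ℝ → ℂ) : Prop :=
  (∀ ξ : ℝ, 0 < ξ → ContDiffAt ℝ ∞ h ξ) ∧
    ∀ γ : ℕ, ∃ C : ℝ, ∀ ξ : ℝ, 1 ≤ ξ → ‖iteratedDeriv γ h ξ‖ ≤ C * ξ ^ (m - γ)

namespace SymbolEstimates

variable {m m' : ℝ} {h h' : ℝ → ℂ}

theorem congr (H : SymbolEstimates m h) (e : ∀ x : ℝ, 0 < x → h x = h' x) :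
    SymbolEstimates m h' := by
  have e' : ∀ x : ℝ, 0 < x → h =ᶠ[𝓝 x] h' := fun x hx =>
    (eventually_gt_nhds hx).mono e
  refine ⟨fun ξ hξ => (H.1 ξ hξ).congr_of_eventuallyEq (e' ξ hξ).symm, fun γ => ?_⟩
  obtain ⟨C, hC⟩ := H.2 γ
  exact ⟨C, fun ξ hξ => by rw [← (e' ξ (by linarith)).iteratedDeriv_eq]; exact hC ξ hξ⟩

theorem mono (H : SymbolEstimates m h) (hm : m ≤ m') : SymbolEstimates m' h := by
  refine ⟨H.1, fun γ => ?_⟩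
  obtain ⟨C, hC⟩ := H.2 γ
  refine ⟨|C|, fun ξ hξ => (hC ξ hξ).trans (mul_le_mul (le_abs_self C) ?_ ?_ (abs_nonneg C))⟩
  · exact Real.rpow_le_rpow_of_exponent_le hξ (by linarith)
  · exact Real.rpow_nonneg (by linarith) _

theorem add (H : SymbolEstimates m h) (H' : SymbolEstimates m h') : SymbolEstimates m (h + h') := by
  refine ⟨fun ξ hξ => (H.1 ξ hξ).add (H'.1 ξ hξ), fun γ => ?_⟩
  obtain ⟨C, hC⟩ := H.2 γ
  obtain ⟨C', hC'⟩ := H'.2 γ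
  refine ⟨C + C', fun ξ hξ => ?_⟩
  have h0 : 0 < ξ := by linarith
  rw [iteratedDeriv_add ((H.1 ξ h0).of_le (by exact_mod_cast le_top))
    ((H'.1 ξ h0).of_le (by exact_mod_cast le_top)), add_mul]
  exact (norm_add_le _ _).trans (add_le_add (hC ξ hξ) (hC' ξ hξ))

theorem zero : SymbolEstimates m 0 :=
  ⟨fun _ _ => contDiffAt_const, fun γ => ⟨0, fun ξ _ => by simp⟩⟩

theorem sum {ι : Type*} {t : Finset ι} {f : ι → ℝ → ℂ} (H : ∀ i ∈ t, SymbolEstimates m (f i)) :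
    SymbolEstimates m (∑ i ∈ t, f i) :=
  Finset.sum_induction _ (SymbolEstimates m) (fun _ _ => add) zero H

theorem mul (H : SymbolEstimates m h) (H' : SymbolEstimates m' h') :
    SymbolEstimates (m + m') (h * h') := by
  refine ⟨fun ξ hξ => (H.1 ξ hξ).mul (H'.1 ξ hξ), fun γ => ?_⟩
  choose C hC using H.2
  choose C' hC' using H'.2
  refine ⟨∑ i ∈ Finset.range (γ + 1), γ.choose i * C i * C' (γ - i), fun ξ hξ => ?_⟩
  have h0 : 0 < ξ := by linarith
  rw [iteratedDeriv_mul ((H.1 ξ h0).of_le (by exact_mod_cast le_top))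
    ((H'.1 ξ h0).of_le (by exact_mod_cast le_top)), Finset.sum_mul]
  refine norm_sum_le_of_le _ fun i hi => ?_
  rw [norm_mul, norm_mul, Complex.norm_natCast]
  have e : ξ ^ (m + m' - γ) = ξ ^ (m - i) * ξ ^ (m' - (γ - i : ℕ)) := by
    rw [← Real.rpow_add h0, Nat.cast_sub (by simp at hi; omega)]
    ring_nf
  have h1 := mul_le_mul (hC i ξ hξ) (hC' (γ - i) ξ hξ) (norm_nonneg _)
    ((norm_nonneg _).trans (hC i ξ hξ))
  calc _ = (γ.choose i : ℝ) * (‖iteratedDeriv i h ξ‖ * ‖iteratedDeriv (γ - i) h' ξ‖) := by ring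
    _ ≤ (γ.choose i : ℝ) * (C i * ξ ^ (m - i) * (C' (γ - i) * ξ ^ (m' - (γ - i : ℕ)))) := by
      gcongr
    _ = _ := by rw [e]; ring

theorem const_smul (c : ℂ) (H : SymbolEstimates m h) : SymbolEstimates m (c • h) := by
  refine ⟨fun ξ hξ => (H.1 ξ hξ).const_smul c, fun γ => ?_⟩
  obtain ⟨C, hC⟩ := H.2 γ
  refine ⟨‖c‖ * C, fun ξ hξ => ?_⟩
  have e : iteratedDeriv γ (c • h) ξ = c * iteratedDeriv γ h ξ :=
    iteratedDeriv_const_mul c ((H.1 ξ (by linarith)).of_le (by exact_mod_cast le_top))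
  rw [e, norm_mul, mul_assoc]
  exact mul_le_mul_of_nonneg_left (hC ξ hξ) (norm_nonneg c)

theorem cpow (β : ℂ) : SymbolEstimates β.re (fun x : ℝ => (x : ℂ) ^ β) := by
  have e : ∀ x : ℝ, 0 < x → ∀ β : ℂ, (x : ℂ) ^ β = Complex.exp ((Real.log x : ℂ) * β) :=
    fun x hx β => by
      rw [Complex.cpow_def_of_ne_zero (by exact_mod_cast hx.ne'), Complex.ofReal_log hx.le]
  have hd : ∀ x : ℝ, 0 < x → ∀ β : ℂ,
      HasDerivAt (fun x : ℝ => (x : ℂ) ^ β) (β * (x : ℂ) ^ (β - 1)) x := fun x hx β => by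
    have := (HasDerivAt.cpow_const (c := β) (hasDerivAt_id (x : ℂ))
      (Complex.ofReal_mem_slitPlane.2 hx)).comp_ofReal
    simpa using this
  refine ⟨fun ξ hξ => ?_, fun γ => ?_⟩
  · have h1 : ContDiffAt ℝ ∞ (fun x : ℝ => Complex.exp ((Real.log x : ℂ) * β)) ξ :=
      ((Complex.ofRealCLM.contDiff.contDiffAt.comp ξ (Real.contDiffAt_log.2 hξ.ne')).mul
        contDiffAt_const).cexp
    exact h1.congr_of_eventuallyEq ((eventually_gt_nhds hξ).mono fun x hx => e x hx β)
  · have key : ∃ c : ℂ, ∀ x : ℝ, 0 < x →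
        iteratedDeriv γ (fun x : ℝ => (x : ℂ) ^ β) x = c * (x : ℂ) ^ (β - γ) := by
      induction γ with
      | zero => exact ⟨1, fun x _ => by simp⟩
      | succ γ ih =>
        obtain ⟨c, hc⟩ := ih
        refine ⟨c * (β - γ), fun x hx => ?_⟩
        rw [iteratedDeriv_succ, Filter.EventuallyEq.deriv_eq ((eventually_gt_nhds hx).mono hc),
          ((hd x hx (β - γ)).const_mul c).deriv]
        push_cast
        ring_nf
    obtain ⟨c, hc⟩ := key
    refine ⟨‖c‖, fun ξ hξ => ?_⟩
    rw [hc ξ (by linarith), norm_mul, Complex.norm_cpow_eq_rpow_re_of_pos (by linarith)]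
    simp

end SymbolEstimates

theorem isSymbol_iff {α : ℂ} {f : ℝ → ℂ} : IsSymbol α f ↔
    ContDiff ℝ ∞ f ∧ tsupport f ⊆ Set.Ioi 0 ∧ ∃ c : ℕ → ℂ, ∀ N : ℕ,
      SymbolEstimates (α.re - N - 1) (fun x : ℝ => f x - ∑ j ∈ Finset.range (N + 1),
        c j * (x : ℂ) ^ (α - (j : ℂ))) := by
  refine and_congr_right fun hf => and_congr_right fun _ => exists_congr fun c =>
    forall_congr' fun N => ⟨fun h => ⟨fun ξ hξ => ?_, h⟩, fun h => h.2⟩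
  refine hf.contDiffAt.sub ?_
  exact ContDiffAt.sum fun j _ => contDiffAt_const.mul ((SymbolEstimates.cpow _).1 ξ hξ)

theorem IsSymbol.smul {α : ℂ} {f : ℝ → ℂ} (ε : ℂ) (hf : IsSymbol α f) : IsSymbol α (ε • f) := by
  rw [isSymbol_iff] at hf ⊢
  obtain ⟨h1, h2, c, h3⟩ := hf
  refine ⟨h1.const_smul ε, (tsupport_smul_subset_right (fun _ => ε) f).trans h2,
    fun j => ε * c j, fun N => ((h3 N).const_smul ε).congr fun x _ => ?_⟩
  simp [mul_sub, Finset.mul_sum, mul_assoc]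

/-- The product of two symbols is a symbol whose order is the sum of the orders. -/
theorem IsSymbol.mul {α β : ℂ} {f g : ℝ → ℂ} (hf : IsSymbol α f) (hg : IsSymbol β g) :
    IsSymbol (α + β) (f * g) := by
  rw [isSymbol_iff] at hf hg ⊢
  obtain ⟨f1, f2, c, f3⟩ := hf
  obtain ⟨g1, g2, d, g3⟩ := hg
  refine ⟨f1.mul g1, (tsupport_mul_subset_left (f := f) (g := g)).trans f2,
    fun j => ∑ p ∈ Finset.HasAntidiagonal.antidiagonal j, c p.1 * d p.2, fun N => ?_⟩
  have hsum : ∀ (β : ℂ) (d : ℕ → ℂ), SymbolEstimates β.re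
      (∑ k ∈ Finset.range (N + 1), fun x : ℝ => d k * (x : ℂ) ^ (β - (k : ℂ))) := fun β d =>
    SymbolEstimates.sum fun k _ => ((SymbolEstimates.cpow (β - k)).const_smul (d k)).mono (by simp)
  have hf0 : SymbolEstimates α.re f :=
    (((f3 N).mono (by linarith [N.cast_nonneg (α := ℝ)])).add (hsum α c)).congr
      fun x _ => by simp
  set S := Finset.range (N + 1) ×ˢ Finset.range (N + 1)
  set t : ℕ × ℕ → ℝ → ℂ := fun p x => (c p.1 * d p.2) * (x : ℂ) ^ (α + β - p.1 - p.2)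
  have ht : SymbolEstimates ((α + β).re - N - 1) (∑ p ∈ S with ¬ p.1 + p.2 ≤ N, t p) := by
    refine SymbolEstimates.sum fun p hp =>
      ((SymbolEstimates.cpow (α + β - p.1 - p.2)).const_smul (c p.1 * d p.2)).mono ?_
    have h1 : N + 1 ≤ p.1 + p.2 := by
      have := (Finset.mem_filter.1 hp).2
      omega
    have h2 : (N : ℝ) + 1 ≤ p.1 + p.2 := by exact_mod_cast h1
    simp only [Complex.sub_re, Complex.natCast_re]
    linarith
  have e1 : SymbolEstimates ((α + β).re - N - 1) (f * _) :=
    (hf0.mul (g3 N)).mono (by rw [Complex.add_re]; linarith)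
  have e2 := ((f3 N).mul (hsum β d)).mono
    (show _ ≤ (α + β).re - N - 1 by rw [Complex.add_re]; linarith)
  refine ((e1.add e2).add ht).congr fun x hx => ?_
  have hx0 : (x : ℂ) ≠ 0 := by exact_mod_cast hx.ne'
  have hprod : (∑ i ∈ Finset.range (N + 1), c i * (x : ℂ) ^ (α - (i : ℂ))) *
      ∑ k ∈ Finset.range (N + 1), d k * (x : ℂ) ^ (β - (k : ℂ)) = ∑ p ∈ S, t p x := by
    rw [Finset.sum_mul_sum, ← Finset.sum_product']
    refine Finset.sum_congr rfl fun p _ => ?_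
    have : (x : ℂ) ^ (α + β - p.1 - p.2) = (x : ℂ) ^ (α - p.1) * (x : ℂ) ^ (β - p.2) := by
      rw [← Complex.cpow_add _ _ hx0]
      ring_nf
    simp only [t, this]
    ring
  have hdiag : ∑ j ∈ Finset.range (N + 1),
      (∑ p ∈ Finset.HasAntidiagonal.antidiagonal j, c p.1 * d p.2) * (x : ℂ) ^ (α + β - (j : ℂ)) =
      ∑ p ∈ S with p.1 + p.2 ≤ N, t p x := by
    rw [← Finset.sum_fiberwise_of_maps_to (g := fun p : ℕ × ℕ => p.1 + p.2)
      (t := Finset.range (N + 1)) (fun p hp => by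
        have := (Finset.mem_filter.1 hp).2
        simp only [Finset.mem_range]
        omega)]
    refine Finset.sum_congr rfl fun j hj => ?_
    rw [Finset.sum_mul]
    refine Finset.sum_congr ?_ fun p hp => ?_
    · ext p
      simp only [Finset.HasAntidiagonal.mem_antidiagonal, Finset.mem_filter, S, Finset.mem_product,
        Finset.mem_range] at hj ⊢
      omega
    · simp only [Finset.mem_filter] at hp
      simp only [t, ← hp.2]
      push_cast
      rw [sub_sub]
  rw [hdiag]
  have hsplit := Finset.sum_filter_add_sum_filter_not S (fun p => p.1 + p.2 ≤ N) (t · x)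
  rw [← hprod] at hsplit
  simp only [Pi.add_apply, Pi.mul_apply, Finset.sum_apply]
  linear_combination hsplit

end Symbols

section Orders

/-- The partial sums `s + (a₁ + 1) + ⋯ + (a_m + 1)`, `m ≥ 1`, are all negative. -/
def PartialSumsNeg : ℝ → List ℝ → Prop
  | _, [] => True
  | s, a :: l => s + a + 1 < 0 ∧ PartialSumsNeg (s + a + 1) l

namespace PartialSumsNeg

theorem mono {s s' : ℝ} {l : List ℝ} (h : PartialSumsNeg s' l) (hs : s ≤ s') :
    PartialSumsNeg s l := by
  induction l generalizing s s' with
  | nil => trivial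
  | cons a l ih => exact ⟨by linarith [h.1], ih h.2 (by linarith)⟩

theorem exists_pos_add {s : ℝ} {l : List ℝ} (h : PartialSumsNeg s l) {b : ℝ} (hb : 0 < b) :
    ∃ η, 0 < η ∧ η ≤ b ∧ PartialSumsNeg (s + η) l := by
  induction l generalizing s b with
  | nil => exact ⟨b, hb, le_rfl, trivial⟩
  | cons a l ih =>
    obtain ⟨η, h1, h2, h3⟩ := ih h.2 (b := min b (-(s + a + 1) / 2))
      (lt_min hb (by linarith [h.1]))
    have h4 := h2.trans (min_le_right _ _)
    refine ⟨η, h1, h2.trans (min_le_left _ _), by linarith [h.1], h3.mono (by linarith)⟩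

theorem of_append {s : ℝ} {l l' : List ℝ} (h : PartialSumsNeg s (l ++ l')) :
    PartialSumsNeg s l := by
  induction l generalizing s with
  | nil => trivial
  | cons a l ih => exact ⟨h.1, ih h.2⟩

theorem merge {s a b : ℝ} {l l' : List ℝ} (h : PartialSumsNeg s (l ++ a :: b :: l')) :
    PartialSumsNeg s (l ++ (a + b) :: l') := by
  induction l generalizing s with
  | nil =>
    obtain ⟨-, h2, h3⟩ := h
    exact ⟨by linarith, h3.mono (by linarith)⟩
  | cons c l ih => exact ⟨h.1, ih h.2⟩

theorem ofFn {k : ℕ} (a : Fin k → ℝ) (s : ℝ)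
    (h : ∀ m : Fin k, s + ∑ i ∈ Finset.Iic m, a i < -((m : ℝ) + 1)) :
    PartialSumsNeg s (List.ofFn a) := by
  induction k generalizing s with
  | zero => trivial
  | succ k ih =>
    rw [List.ofFn_succ]
    have h0 := h 0
    have e0 : Finset.Iic (0 : Fin (k + 1)) = {0} := by
      ext i
      simp
    simp only [e0, Finset.sum_singleton, Fin.val_zero, Nat.cast_zero] at h0
    refine ⟨by linarith, ih _ _ fun m => ?_⟩
    have h1 := h m.succ
    have e1 : ∑ i ∈ Finset.Iic m.succ, a i = a 0 + ∑ i ∈ Finset.Iic m, a i.succ := by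
      have : Finset.Iic m.succ = insert 0 ((Finset.Iic m).map (Fin.succEmb k)) := by
        ext i
        refine Fin.cases ?_ (fun j => ?_) i
        · simp
        · simp
      rw [this, Finset.sum_insert (by simp), Finset.sum_map]
      simp
    rw [e1, Fin.val_succ] at h1
    push_cast at h1
    linarith

end PartialSumsNeg

/-- Near `z = 0`, the values of the family `f` at the positive integers are analytic in `z` and
uniformly `O(n^{a+δ})`, for every `δ > 0`. -/
def OrderNearZero (a : ℝ) (f : ℂ → ℝ → ℂ) : Prop :=
  ∀ δ > 0, ∃ K : ℝ, ∀ᶠ z in 𝓝 (0 : ℂ), ∀ n : ℕ, 1 ≤ n →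
    AnalyticAt ℂ (fun z => f z n) z ∧ ‖f z n‖ ≤ K * (n : ℝ) ^ (a + δ)

theorem OrderNearZero.mul {a b : ℝ} {f g : ℂ → ℝ → ℂ} (hf : OrderNearZero a f)
    (hg : OrderNearZero b g) : OrderNearZero (a + b) (f * g) := by
  intro δ hδ
  obtain ⟨K, hK⟩ := hf (δ / 2) (by linarith)
  obtain ⟨K', hK'⟩ := hg (δ / 2) (by linarith)
  refine ⟨K * K', ?_⟩
  filter_upwards [hK, hK'] with z h1 h2 n hn
  refine ⟨(h1 n hn).1.mul (h2 n hn).1, ?_⟩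
  have hn' : (0 : ℝ) < n := by exact_mod_cast hn
  have e : (n : ℝ) ^ (a + b + δ) = (n : ℝ) ^ (a + δ / 2) * (n : ℝ) ^ (b + δ / 2) := by
    rw [← Real.rpow_add hn']
    ring_nf
  have h3 := mul_le_mul (h1 n hn).2 (h2 n hn).2 (norm_nonneg _)
    ((norm_nonneg _).trans (h1 n hn).2)
  rw [Pi.mul_apply, Pi.mul_apply, norm_mul, e]
  linarith

theorem OrderNearZero.smul {a : ℝ} {f : ℂ → ℝ → ℂ} (c : ℂ) (hf : OrderNearZero a f) :
    OrderNearZero a (c • f) := by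
  intro δ hδ
  obtain ⟨K, hK⟩ := hf δ hδ
  refine ⟨‖c‖ * K, hK.mono fun z h n hn => ⟨(h n hn).1.const_smul (c := c), ?_⟩⟩
  rw [Pi.smul_apply, Pi.smul_apply, norm_smul, mul_assoc]
  exact mul_le_mul_of_nonneg_left (h n hn).2 (norm_nonneg c)

theorem IsSimpleFamily.orderNearZero {W : Set ℂ} (hW : IsOpen W) (h0 : (0 : ℂ) ∈ W) {α : ℂ → ℂ}
    {f : ℂ → ℝ → ℂ} (hf : IsSimpleFamily W α f) : OrderNearZero (α 0).re f := by
  intro δ hδ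
  obtain ⟨c, hc, h⟩ := hf.expansion
  have hWn := hW.mem_nhds h0
  obtain ⟨ε, hε, hb⟩ := Metric.nhds_basis_closedBall.mem_iff.1 hWn
  obtain ⟨C, hC⟩ := h _ (isCompact_closedBall 0 ε) hb 0 0
  have hre : ∀ᶠ z in 𝓝 0, (α z).re < (α 0).re + δ :=
    (Complex.continuous_re.continuousAt.comp (hf.order.analyticAt hWn).continuousAt).eventually
      (eventually_lt_nhds (lt_add_of_pos_right _ hδ))
  have hc0 : ∀ᶠ z in 𝓝 0, ‖c 0 z‖ < ‖c 0 0‖ + 1 :=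
    ((hc 0).analyticAt hWn).continuousAt.norm.eventually (eventually_lt_nhds (lt_add_one _))
  refine ⟨|C| + (‖c 0 0‖ + 1), ?_⟩
  filter_upwards [Metric.closedBall_mem_nhds (0 : ℂ) hε, hre, hc0, hWn] with z hz hz1 hz2 hzW n hn
  refine ⟨hf.holomorphic.analyticAt hzW n, ?_⟩
  have hn1 : (1 : ℝ) ≤ n := by exact_mod_cast hn
  have h1 := hC z hz n hn1
  simp only [iteratedDeriv_zero, zero_add, Finset.range_one, Finset.sum_singleton, Nat.cast_zero,
    sub_zero, Complex.ofReal_natCast] at h1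
  have h2 : ‖c 0 z * (n : ℂ) ^ α z‖ ≤ (‖c 0 0‖ + 1) * (n : ℝ) ^ ((α 0).re + δ) := by
    rw [norm_mul, Complex.norm_natCast_cpow_of_pos hn]
    exact mul_le_mul hz2.le (Real.rpow_le_rpow_of_exponent_le hn1 hz1.le) (by positivity)
      (by positivity)
  have h3 : ‖f z n - c 0 z * (n : ℂ) ^ α z‖ ≤ |C| * (n : ℝ) ^ ((α 0).re + δ) :=
    h1.trans (mul_le_mul (le_abs_self C) (Real.rpow_le_rpow_of_exponent_le hn1 (by linarith))
      (by positivity) (abs_nonneg C))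
  have h4 := norm_le_norm_sub_add (f z n) (c 0 z * (n : ℂ) ^ α z)
  rw [add_mul]
  linarith

end Orders

section Convergence

open Filter

/-- The sequences `S z` converge for `z` near `0`, with a limit which is analytic at `0`. -/
def ConvergesNearZero (S : ℂ → ℕ → ℂ) : Prop :=
  ∃ L : ℂ → ℂ, AnalyticAt ℂ L 0 ∧ ∀ᶠ z in 𝓝 (0 : ℂ), Tendsto (S z) atTop (𝓝 (L z))

theorem ConvergesNearZero.add {S T : ℂ → ℕ → ℂ} (hS : ConvergesNearZero S)
    (hT : ConvergesNearZero T) : ConvergesNearZero (S + T) := by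
  obtain ⟨L, hL, h⟩ := hS
  obtain ⟨M, hM, k⟩ := hT
  exact ⟨L + M, hL.add hM, by filter_upwards [h, k] with z h1 h2 using h1.add h2⟩

theorem ConvergesNearZero.smul {S : ℂ → ℕ → ℂ} (c : ℂ) (hS : ConvergesNearZero S) :
    ConvergesNearZero (c • S) := by
  obtain ⟨L, hL, h⟩ := hS
  exact ⟨c • L, hL.const_smul, h.mono fun z hz => hz.const_smul c⟩

theorem eventually_analyticAt_truncSumWord (v : Ineq) {as : List ℝ} {u : List (ℂ → ℝ → ℂ)}
    (h : List.Forall₂ OrderNearZero as u) : ∀ᶠ z in 𝓝 (0 : ℂ), ∀ N : ℕ,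
      AnalyticAt ℂ (fun z => truncSumWord v (u.map (· z)) N) z := by
  induction h with
  | nil => exact Eventually.of_forall fun z N => analyticAt_const
  | @cons a f as u hf _ ih =>
    obtain ⟨K, hK⟩ := hf 1 one_pos
    filter_upwards [hK, ih] with z h1 h2 N
    simp only [List.map_cons, truncSumWord]
    exact Finset.analyticAt_fun_sum _ fun n hn =>
      (h1 n (Finset.mem_Icc.1 hn).1).1.mul (h2 _)

theorem Ineq.below_le (v : Ineq) (n : ℕ) : v.below n ≤ n := by
  cases v
  · exact Nat.sub_le n 1
  · exact le_rfl

/-- The general term of a nested sum is estimated by means of a bound for the inner sums. -/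
theorem exists_norm_term_le (v : Ineq) {a t : ℝ} {as : List ℝ} {f : ℂ → ℝ → ℂ}
    {u : List (ℂ → ℝ → ℂ)} (hf : OrderNearZero a f) (hc : PartialSumsNeg (-t) (a :: as))
    (ih : ∀ t : ℝ, 0 ≤ t → PartialSumsNeg (-t) as → ∃ K : ℝ, ∀ᶠ z in 𝓝 (0 : ℂ),
      ∀ N M : ℕ, N ≤ M → 1 ≤ M → ‖truncSumWord v (u.map (· z)) N‖ ≤ K * (M : ℝ) ^ t) :
    ∃ K : ℝ, ∃ η > 0, ∀ᶠ z in 𝓝 (0 : ℂ), ∀ n : ℕ, 1 ≤ n →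
      ‖f z n * truncSumWord v (u.map (· z)) (v.below n)‖ ≤ K * (n : ℝ) ^ (t - 1 - η) := by
  obtain ⟨h1, h2⟩ := hc
  obtain ⟨η, hη, hηt, h3⟩ := h2.exists_pos_add (b := t - a - 1) (by linarith)
  obtain ⟨K, hK⟩ := ih (t - a - 1 - η) (by linarith) (h3.mono (by linarith))
  obtain ⟨K', hK'⟩ := hf (η / 2) (by linarith)
  refine ⟨K' * K, η / 2, by linarith, ?_⟩
  filter_upwards [hK, hK'] with z hz hz' n hn
  have hn' : (0 : ℝ) < n := by exact_mod_cast hn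
  have e : (n : ℝ) ^ (t - 1 - η / 2) = (n : ℝ) ^ (a + η / 2) * (n : ℝ) ^ (t - a - 1 - η) := by
    rw [← Real.rpow_add hn']
    ring_nf
  have h4 := mul_le_mul (hz' n hn).2 (hz _ n (v.below_le n) hn) (norm_nonneg _)
    ((norm_nonneg _).trans (hz' n hn).2)
  rw [norm_mul, e]
  linarith

theorem exists_norm_truncSumWord_le (v : Ineq) {as : List ℝ} {u : List (ℂ → ℝ → ℂ)}
    (h : List.Forall₂ OrderNearZero as u) (t : ℝ) (ht : 0 ≤ t) (hc : PartialSumsNeg (-t) as) :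
    ∃ K : ℝ, ∀ᶠ z in 𝓝 (0 : ℂ), ∀ N M : ℕ, N ≤ M → 1 ≤ M →
      ‖truncSumWord v (u.map (· z)) N‖ ≤ K * (M : ℝ) ^ t := by
  induction h generalizing t with
  | nil =>
    refine ⟨1, Eventually.of_forall fun z N M _ hM => ?_⟩
    simpa [truncSumWord] using Real.one_le_rpow (by exact_mod_cast hM) ht
  | @cons a f as u hf _ ih =>
    obtain ⟨K, η, hη, hK⟩ := exists_norm_term_le v hf hc ih
    have hs : Summable fun n : ℕ => (n : ℝ) ^ (-1 - η) := Real.summable_nat_rpow.2 (by linarith)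
    refine ⟨|K| * ∑' n : ℕ, (n : ℝ) ^ (-1 - η), hK.mono fun z hz N M hNM hM => ?_⟩
    rw [List.map_cons, truncSumWord]
    calc _ ≤ ∑ n ∈ Finset.Icc 1 N, |K| * (M : ℝ) ^ t * (n : ℝ) ^ (-1 - η) := by
          refine norm_sum_le_of_le _ fun n hn => ?_
          obtain ⟨hn1, hnN⟩ := Finset.mem_Icc.1 hn
          have hn0 : (0 : ℝ) < n := by exact_mod_cast hn1
          have e : (n : ℝ) ^ (t - 1 - η) = (n : ℝ) ^ t * (n : ℝ) ^ (-1 - η) := by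
            rw [← Real.rpow_add hn0]
            ring_nf
          refine (hz n hn1).trans ?_
          rw [e, mul_assoc]
          have : (n : ℝ) ^ t ≤ (M : ℝ) ^ t :=
            Real.rpow_le_rpow hn0.le (by exact_mod_cast hnN.trans hNM) ht
          refine mul_le_mul (le_abs_self K) ?_ (by positivity) (abs_nonneg K)
          exact mul_le_mul_of_nonneg_right this (by positivity)
      _ = |K| * (M : ℝ) ^ t * ∑ n ∈ Finset.Icc 1 N, (n : ℝ) ^ (-1 - η) := by
          rw [Finset.mul_sum]
      _ ≤ |K| * (M : ℝ) ^ t * ∑' n : ℕ, (n : ℝ) ^ (-1 - η) := by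
          refine mul_le_mul_of_nonneg_left ?_ (by positivity)
          exact hs.sum_le_tsum _ fun n _ => by positivity
      _ = _ := by ring

theorem convergesNearZero_truncSumWord (v : Ineq) {as : List ℝ} {u : List (ℂ → ℝ → ℂ)}
    (h : List.Forall₂ OrderNearZero as u) (hc : PartialSumsNeg 0 as) :
    ConvergesNearZero fun z => truncSumWord v (u.map (· z)) := by
  cases h with
  | nil => exact ⟨fun _ => 1, analyticAt_const, Eventually.of_forall fun z => tendsto_const_nhds⟩
  | @cons a f as u hf h =>
    obtain ⟨K, η, hη, hK⟩ := exists_norm_term_le v hf (t := 0) (by simpa using hc)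
      (exists_norm_truncSumWord_le v h)
    obtain ⟨K', hK'⟩ := hf 1 one_pos
    obtain ⟨r, hr, hball⟩ := Metric.eventually_nhds_iff_ball.1
      (hK.and (hK'.and (eventually_analyticAt_truncSumWord v h)))
    set g : ℕ → ℂ → ℂ := fun n z =>
      f z (n + 1 : ℕ) * truncSumWord v (u.map (· z)) (v.below (n + 1))
    have hs : Summable fun n : ℕ => K * ((n + 1 : ℕ) : ℝ) ^ (0 - 1 - η) :=
      ((summable_nat_add_iff 1).2 (Real.summable_nat_rpow.2
        (by linarith : 0 - 1 - η < -1))).mul_left K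
    have hle : ∀ (n : ℕ) (z : ℂ), z ∈ Metric.ball (0 : ℂ) r →
        ‖g n z‖ ≤ K * ((n + 1 : ℕ) : ℝ) ^ (0 - 1 - η) := fun n z hz =>
      (hball z hz).1 (n + 1) (Nat.le_add_left 1 n)
    have hd : DifferentiableOn ℂ (fun z => ∑' n, g n z) (Metric.ball 0 r) := by
      refine Complex.differentiableOn_tsum_of_summable_norm hs (fun n z hz => ?_)
        Metric.isOpen_ball hle
      obtain ⟨-, h1, h2⟩ := hball z hz
      exact ((h1 (n + 1) (Nat.le_add_left 1 n)).1.mul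
        (h2 _)).differentiableAt.differentiableWithinAt
    refine ⟨_, hd.analyticAt (Metric.ball_mem_nhds 0 hr), ?_⟩
    filter_upwards [Metric.ball_mem_nhds (0 : ℂ) hr] with z hz
    refine ((Summable.of_norm_bounded hs fun n => hle n z hz).hasSum.tendsto_sum_nat).congr
      fun N => ?_
    rw [List.map_cons, truncSumWord, Finset.range_eq_Ico,
      Finset.sum_Ico_add' (fun n : ℕ => f z n * truncSumWord v (u.map (· z)) (v.below n)) 0 N 1]
    rfl

end Convergence

section BlockSums

set_option linter.unusedSectionVars false

variable {B : Type*} [NonUnitalCommRing B] [Module ℂ B] [IsScalarTower ℂ B B] [SMulCommClass ℂ B B]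

theorem forall₂_append_singleton {O : ℝ → B → Prop} {as : List ℝ} {u : List B} {a : ℝ} {x : B}
    (h : List.Forall₂ O as u) (hx : O a x) : List.Forall₂ O (as ++ [a]) (u ++ [x]) :=
  List.rel_append h (.cons hx .nil)

/-- A linear property of words satisfying an order condition is inherited by the block sums. -/
theorem blockSum_word_induction {O : ℝ → B → Prop} {Q : TensorAlgebra ℂ B → Prop} (ε : ℂ)
    (hO : ∀ {a b x y}, O a x → O b y → O (a + b) (ε • (x * y)))
    (hword : ∀ {as u}, List.Forall₂ O as u → PartialSumsNeg 0 as → Q (word u))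
    (hadd : ∀ {x y}, Q x → Q y → Q (x + y)) (hsmul : ∀ (c : ℂ) {x}, Q x → Q (c • x))
    (c : ℕ → ℂ) {as : List ℝ} {u : List B} (hu : List.Forall₂ O as u)
    (hc : PartialSumsNeg 0 as) : Q (blockSum ε c (word u)) := by
  have key : ∀ (bs : List ℝ) (u : List B), List.Forall₂ O bs u → ∀ (as : List ℝ) (p : List B)
      (b : ℝ) (y : B) (i : ℕ), List.Forall₂ O as p → O b y → PartialSumsNeg 0 (as ++ b :: bs) →
      Q (word p * blockSumAux ε c y i u) := by
    intro bs u hu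
    induction hu with
    | nil =>
      intro as p b y i hp hy hc
      rw [blockSumAux, mul_smul_comm, ← word_singleton, ← word_append]
      exact hsmul _ (hword (forall₂_append_singleton hp hy) hc)
    | @cons b' x bs u hx _ ih =>
      intro as p b y i hp hy hc
      rw [blockSumAux, mul_add, mul_smul_comm, ← mul_assoc, ← word_singleton, ← word_append]
      refine hadd (hsmul _ (ih _ _ b' x 1 (forall₂_append_singleton hp hy) hx ?_))
        (ih _ _ (b + b') _ _ hp (hO hy hx) hc.merge)
      simpa using hc
  rw [blockSum_word]
  cases hu with
  | nil => exact hword .nil trivial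
  | cons hx hu =>
    have := key _ _ hu [] [] _ _ 1 .nil hx hc
    rwa [word_nil, one_mul] at this

end BlockSums

section Values

open Filter

variable {W : Set ℂ} {A : NonUnitalSubalgebra ℂ (ℝ → ℂ)}

/-- The value at `z` of a family of functions. -/
def evalFamily (z : ℂ) : (ℂ → ℝ → ℂ) →ₗ[ℂ] (ℝ → ℂ) := LinearMap.proj z

theorem map_evalFamily (z : ℂ) (u : List (ℂ → ℝ → ℂ)) : u.map (evalFamily z) = u.map (· z) := rfl

theorem mapLetters_evalFamily_hoffmanExp (v : Ineq) (z : ℂ) (u : List (ℂ → ℝ → ℂ)) :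
    mapLetters (evalFamily z) (hoffmanExp v.sign (word u)) =
      hoffmanExp v.sign (word (u.map (· z))) := by
  rw [hoffmanExp_eq, hoffmanExp_eq, mapLetters_blockSum (evalFamily z) (fun _ _ => rfl),
    mapLetters_word, map_evalFamily]

theorem convergesNearZero_hoffmanExp (v : Ineq) {as : List ℝ} {u : List (ℂ → ℝ → ℂ)}
    (h : List.Forall₂ OrderNearZero as u) (hc : PartialSumsNeg 0 as) :
    ConvergesNearZero fun z => truncSum v (hoffmanExp v.sign (word (u.map (· z)))) := by
  simp only [← mapLetters_evalFamily_hoffmanExp]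
  refine blockSum_word_induction (O := OrderNearZero)
    (Q := fun x => ConvergesNearZero fun z => truncSum v (mapLetters (evalFamily z) x)) v.sign
    (fun hx hy => (hx.mul hy).smul _) (fun h hc => ?_) (fun hx hy => ?_) (fun c _ hx => ?_) _ h hc
  · simp only [mapLetters_word, truncSum_word, map_evalFamily]
    exact convergesNearZero_truncSumWord v h hc
  · simp only [map_add]
    exact hx.add hy
  · simp only [map_smul]
    exact hx.smul c

theorem HolomorphicRegularisation.convergesNearZero (hW : IsOpen W) (h0 : (0 : ℂ) ∈ W)
    (R : HolomorphicRegularisation W A) (hR : R.PerturbsOrders) (v : Ineq) {as : List ℝ}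
    {u : List A} (h : List.Forall₂ (fun (a : ℝ) (σ : A) => ∃ α : ℂ, α.re = a ∧ IsSymbol α (σ : ℝ → ℂ)) as u)
    (hc : PartialSumsNeg 0 as) : ConvergesNearZero fun z => truncSum v (R.star v z (word u)) := by
  refine blockSum_word_induction (Q := fun x => ConvergesNearZero fun z =>
      truncSum v (hoffmanExp v.sign (mapLetters (R.toFun z) x))) v.sign
    (fun hx hy => ?_) (fun {as u} h hc => ?_) (fun hx hy => ?_) (fun c _ hx => ?_) _ h hc
  · obtain ⟨α, rfl, hα⟩ := hx
    obtain ⟨β, rfl, hβ⟩ := hy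
    exact ⟨α + β, Complex.add_re _ _, (hα.mul hβ).smul _⟩
  · have h' : List.Forall₂ OrderNearZero as (u.map fun σ z => R.toFun z σ) := by
      refine List.forall₂_map_right_iff.2 (h.imp fun a σ hσ => ?_)
      obtain ⟨α, rfl, hα⟩ := hσ
      obtain ⟨α', rfl, -, hf⟩ := hR σ α hα
      exact hf.orderNearZero hW h0
    have := convergesNearZero_hoffmanExp v h' hc
    simp only [List.map_map] at this
    simpa only [mapLetters_word] using! this
  · simp only [map_add]
    exact hx.add hy
  · simp only [map_smul]
    exact hx.smul c

theorem HolomorphicRegularisation.star_zero (R : HolomorphicRegularisation W A) (v : Ineq)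
    (u : List A) : R.star v 0 (word u) = word (u.map fun σ : A => (σ : ℝ → ℂ)) := by
  have h : ∀ a b, R.toFun 0 (a * b) = R.toFun 0 a * R.toFun 0 b := fun a b => by
    simp [R.at_zero]
  rw [star_apply, hoffmanLog_eq, mapLetters_blockSum _ h, ← hoffmanLog_eq, hoffmanExp_hoffmanLog,
    mapLetters_word]
  exact congrArg word (List.map_congr_left fun σ _ => R.at_zero σ)

variable {Ψ Ψm Ψp : TensorAlgebra ℂ A →ₗ[ℂ] Mero W}

theorem exists_hasValueAtZero_of_partialSumsNeg (hW : IsOpen W) (h0 : (0 : ℂ) ∈ W)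
    (R : HolomorphicRegularisation W A) (hR : R.PerturbsOrders) (v : Ineq)
    (hΨ : ∀ x, (Ψ x).IsGivenBy fun z => cutoffNestedSum v (R.star v z x)) {as : List ℝ}
    {u : List A} (h : List.Forall₂ (fun (a : ℝ) (σ : A) => ∃ α : ℂ, α.re = a ∧ IsSymbol α (σ : ℝ → ℂ)) as u)
    (hc : PartialSumsNeg 0 as) : ∃ c, (Ψ (word u)).HasValueAtZero c ∧
      Tendsto (truncSumWord v (u.map fun σ : A => (σ : ℝ → ℂ))) atTop (𝓝 c) := by
  obtain ⟨L, hL, hlim⟩ := R.convergesNearZero hW h0 hR v h hc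
  have e : L =ᶠ[𝓝 0] fun z => cutoffNestedSum v (R.star v z (word u)) := hlim.mono fun z hz =>
    (finitePart_eq (HasFinitePart.of_tendsto hz)).symm
  refine ⟨L 0, ⟨_, hΨ _, hL.congr e, e.eq_of_nhds.symm⟩, ?_⟩
  have : Tendsto (truncSum v (R.star v 0 (word u))) atTop (𝓝 (L 0)) := hlim.self_of_nhds
  rwa [R.star_zero, truncSum_word] at this

/-- The counterterms of the words satisfying the convergence condition vanish. -/
theorem IsBirkhoff.minus_eq_zero (hW : IsOpen W) (h0 : (0 : ℂ) ∈ W)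
    (R : HolomorphicRegularisation W A) (hR : R.PerturbsOrders) (v : Ineq)
    (hΨ : ∀ x, (Ψ x).IsGivenBy fun z => cutoffNestedSum v (R.star v z x)) (hΨ1 : Ψ 1 = 1)
    (h : IsBirkhoff Ψ Ψm Ψp) {as : List ℝ} {u : List A}
    (hu : List.Forall₂ (fun (a : ℝ) (σ : A) => ∃ α : ℂ, α.re = a ∧ IsSymbol α (σ : ℝ → ℂ)) as u)
    (hc : PartialSumsNeg 0 as) : Ψp (word u) = Ψ (word u) ∧ (u ≠ [] → Ψm (word u) = 0) := by
  induction hn : u.length using Nat.strong_induction_on generalizing as u with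
  | _ n ih =>
  cases u with
  | nil => exact ⟨by rw [word_nil, h.plus_one hΨ1, hΨ1], fun h => absurd rfl h⟩
  | cons σ u =>
    have e := h.plus_word hΨ1 (σ :: u)
    rw [Finset.sum_eq_single_of_mem 0 (by simp) (fun i hi hi0 => ?_)] at e
    · rw [List.take_zero, List.drop_zero, word_nil, h.minus_one, one_mul] at e
      have hm : Ψm (word (σ :: u)) ∈ holomorphicAtZero W := by
        obtain ⟨c, hc, -⟩ := exists_hasValueAtZero_of_partialSumsNeg hW h0 R hR v hΨ hu hc
        have hΨh : Ψ (word (σ :: u)) ∈ holomorphicAtZero W := ⟨c, hc⟩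
        rw [eq_sub_of_add_eq e.symm]
        exact Submodule.sub_mem _ (h.plus_mem _) hΨh
      have hm0 := Submodule.disjoint_def.1 (disjoint_polarPart_holomorphicAtZero hW h0) _
        (h.minus_cons σ u) hm
      exact ⟨by rw [e, hm0, zero_add], fun _ => hm0⟩
    · rw [Finset.mem_range] at hi
      have hlen : ((σ :: u).take i).length = i := by simp at hi ⊢; omega
      rw [(ih i (by omega) (List.forall₂_take i hu)
        (PartialSumsNeg.of_append (l' := as.drop i) (by rwa [List.take_append_drop])) hlen).2
        (fun h => hi0 (by rw [h] at hlen; exact hlen.symm)), zero_mul]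

/-- The renormalised nested sums agree with the convergent ones. -/
theorem tendsto_truncSumWord_of_partialSumsNeg (hW : IsOpen W) (h0 : (0 : ℂ) ∈ W)
    (R : HolomorphicRegularisation W A) (hR : R.PerturbsOrders) (v : Ineq)
    (hΨ : ∀ x, (Ψ x).IsGivenBy fun z => cutoffNestedSum v (R.star v z x)) (hΨ1 : Ψ 1 = 1)
    (h : IsBirkhoff Ψ Ψm Ψp) {ψ : TensorAlgebra ℂ A →ₗ[ℂ] ℂ}
    (hψ : ∀ x, (Ψp x).HasValueAtZero (ψ x)) {as : List ℝ} {u : List A}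
    (hu : List.Forall₂ (fun (a : ℝ) (σ : A) => ∃ α : ℂ, α.re = a ∧ IsSymbol α (σ : ℝ → ℂ)) as u)
    (hc : PartialSumsNeg 0 as) :
    Tendsto (truncSumWord v (u.map fun σ : A => (σ : ℝ → ℂ))) atTop (𝓝 (ψ (word u))) := by
  obtain ⟨c, hc', hlim⟩ := exists_hasValueAtZero_of_partialSumsNeg hW h0 R hR v hΨ hu hc
  have e := hψ (word u)
  rw [(h.minus_eq_zero hW h0 R hR v hΨ hΨ1 hu hc).1] at e
  rwa [e.unique hW h0 hc']

end Values

end NestedSums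

end

theorem mainTheorem3 (W : Set ℂ) (hW : IsOpen W) (hW0 : (0 : ℂ) ∈ W)
    (A : NonUnitalSubalgebra ℂ (ℝ → ℂ)) (hA : ∀ σ ∈ A, σ ∈ symbolSpace)
    (R : HolomorphicRegularisation W A)
    (hR : R.PerturbsOrders) (hR' : R.LowersOrders) (v : Ineq) :
    -- all the cut-off nested sums below are genuine finite parts
    (∀ (x : TensorAlgebra ℂ A), ∀ z ∈ W, ∃ c, HasFinitePart (truncSum v (R.star v z x)) c) ∧
    ∃ (Ψ Ψm Ψp : TensorAlgebra ℂ A →ₗ[ℂ] Mero W) (ψ : TensorAlgebra ℂ A →ₗ[ℂ] ℂ),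
      -- `Ψ` is the meromorphic stuffle character
      (∀ x, (Ψ x).IsGivenBy fun z => cutoffNestedSum v (R.star v z x)) ∧
      IsCharacter v.sign Ψ ∧
      -- `(Ψm, Ψp)` is its unique Birkhoff decomposition, and consists of characters
      IsBirkhoff Ψ Ψm Ψp ∧
      (∀ Ψm' Ψp', IsBirkhoff Ψ Ψm' Ψp' → Ψm' = Ψm ∧ Ψp' = Ψp) ∧
      IsCharacter v.sign Ψm ∧ IsCharacter v.sign Ψp ∧
      -- `ψ` is the value of `Ψp` at `0`, and is a character
      (∀ x, (Ψp x).HasValueAtZero (ψ x)) ∧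
      IsCharacter v.sign ψ ∧
      -- `ψ` extends the finite part at `0` of the cut-off sum
      (∀ σ : A, HasFinitePartAtZero (fun z => cutoffSum (R.toFun z σ))
        (ψ (TensorAlgebra.ι ℂ σ))) ∧
      -- `ψ` coincides with the ordinary nested sums when these converge
      (∀ (k : ℕ) (σ : Fin k → A) (α : Fin k → ℂ), (∀ i, IsSymbol (α i) (σ i)) →
        (∀ m : Fin k, (∑ i ∈ Finset.Iic m, α i).re < -((m : ℝ) + 1)) →
        Filter.Tendsto (truncSumWord v (List.ofFn fun i => (σ i : ℝ → ℂ))) Filter.atTop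
          (𝓝 (ψ (word (List.ofFn σ))))) := by
  obtain ⟨Ψ, hΨ, hΨc⟩ := R.exists_character hW v
  obtain ⟨Ψm, Ψp, h⟩ := exists_isBirkhoff hW hW0 hΨc.1
  obtain ⟨ψ, hψ⟩ := exists_linear_value hW hW0 h.plus_holomorphic
  obtain ⟨hm, hp⟩ := h.isCharacter hW hW0 hΨc
  refine ⟨fun x z hz => R.exists_hasFinitePart v hz x, Ψ, Ψm, Ψp, ψ, hΨ, hΨc, h,
    fun Ψm' Ψp' h' => h.unique hW hW0 hΨc.1 h', hm, hp, hψ, isCharacter_value hW hW0 hp hψ,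
    fun σ => hasFinitePartAtZero_cutoffSum hW hW0 R v hΨ hΨc.1 h σ (hψ _),
    fun k σ α hσ hα => ?_⟩
  have hu : List.Forall₂ (fun (a : ℝ) (σ : A) => ∃ α : ℂ, α.re = a ∧ IsSymbol α (σ : ℝ → ℂ))
      (List.ofFn fun i => (α i).re) (List.ofFn σ) := by
    refine List.forall₂_iff_get.2 ⟨by simp, fun i h1 h2 => ?_⟩
    simp only [List.get_ofFn]
    exact ⟨_, rfl, hσ _⟩
  have hc : PartialSumsNeg 0 (List.ofFn fun i => (α i).re) :=
    PartialSumsNeg.ofFn _ _ fun m => by simpa only [zero_add, Complex.re_sum] using hα m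
  have := tendsto_truncSumWord_of_partialSumsNeg hW hW0 R hR v hΨ hΨc.1 h hψ hu hc
  rwa [List.map_ofFn] at this
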